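/- Let $\tau>0$ and $t\in\mathbb R$. Put $\xi_{cr}=\tfrac14(\tau^2-t)^2$ if $t<\tau^2$ and $\xi_{cr}=0$ if $t\ge\tau^2$. **Roots.** For a symbol $s(w)=w+d_0+\frac{d_1}{w}+\frac{d_2}{w^2}+\frac{d_3}{w^3}$ with $d_3\neq 0$, let $w_1(z),\dots,w_4(z)$ be the solutions of $s(w)=z$, with multiplicity, numbered so that $|w_1(z)|\ge|w_2(z)|\ge|w_3(z)|\ge|w_4(z)|$ (arbitrarily in case of ties). Put $\Gamma_j=\{z\in\mathbb C: |w_j(z)|=|w_{j+1}(z)|\}$ and $$d\mu_j(z)=\frac1{2\pi i}\sum_{k=1}^{j}\left(\frac{w_{k-}'(z)}{w_{k-}(z)}-\frac{w_{k+}'(z)}{w_{k+}(z)}\right)dz,\qquad z\in\Gamma_j,$$ where $\pm$ denote limiting values from the left ($+$) and from the right ($-$) of the oriented arc. *Case $\xi>\xi_{cr}$.* Let $a(\xi)=\frac16\bigl(\tau^2-t+\sqrt{(\tau^2-t)^2+12\xi}\bigr)$, $b(\xi)=a(\xi)(3a(\xi)+t)$, $c(\xi)=\tau^2a(\xi)^3$.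 Let $w_j(z;\xi)$, $\Gamma_j(\xi)$, $\mu_j^\xi$ be the objects above for the symbol $s_1(w;\xi)=w+\frac{b(\xi)}{w}+\frac{c(\xi)}{w^3}$. *Case $0<\xi<\xi_{cr}$.* Let $a_{0}(\xi),a_1(\xi)=\frac12\bigl(\tau^2-t\mp\sqrt{(\tau^2-t)^2-4\xi}\bigr)$, $b_0=a_0(a_0+2a_1+t)$, $b_1=a_1(2a_0+a_1+t)$, $c_0=\tau^2a_0^2a_1$, $c_1=\tau^2a_0a_1^2$. Let $\widehat w_j(z;\xi)$, $\widehat\Gamma_j(\xi)$, $\widehat\mu_j^\xi$ be the objects above for the symbol $$\widehat s_2(w;\xi)=w+(b_0+b_1)+\frac{c_0+c_1+b_0b_1}{w}+\frac{b_0c_1+c_0b_1}{w^2}+\frac{c_0c_1}{w^3}.$$ Put $w_j(z;\xi)=\widehat w_j(z^2;\xi)$, $\Gamma_j(\xi)=\{z: z^2\in\widehat\Gamma_j(\xi)\}$ and $d\mu_2^\xi(z)=|z|\,\frac{d\widehat\mu_2^\xi}{dx}(z^2)\,|dz|$ on $\Gamma_2(\xi)$. **Averaged objects.** For $x\in\mathbb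 R$ and $j=1,3$ let $$\widetilde V_j(x)=\frac12\int_0^{\xi_{cr}}\log\left|\frac{w_j(x;\xi)}{w_{j+1}(x;\xi)}\right|d\xi+\int_{\xi_{cr}}^\infty\log\left|\frac{w_j(x;\xi)}{w_{j+1}(x;\xi)}\right|d\xi ,\qquad \widetilde\sigma=\int_0^\infty\mu_2^\xi\,d\xi .$$ **Explicit objects.** For $x\in\mathbb R$ let $\omega_1(x),\omega_2(x),\dots$ be the real solutions (with multiplicity) of $\omega^3+t\omega=\tau x$, numbered so that $|\omega_1(x)|\ge|\omega_2(x)|\ge\cdots$. Let $$V_1(x)=\frac{x^2}2-\frac34\omega_1(x)^4-\frac12t\,\omega_1(x)^2 .$$ Let $V_3(x)=\frac34\omega_2(x)^4+\frac12t\,\omega_2(x)^2-\frac34\omega_3(x)^4-\frac12t\,\omega_3(x)^2$ if $t<0$ and $|x|<x^*:=\frac{2(-t)^{3/2}}{3\sqrt3\,\tau}$, and $V_3(x)=0$ otherwise. Let $y^*=\frac{2t^{3/2}}{3\sqrt3\,\tau}$ if $t\ge0$ and $y^*=0$ if $t<0$. Let $\sigma$ be the measure on $i\mathbb R\setminus(-iy^*,iy^*)$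 with density $$\frac{d\sigma(z)}{|dz|}=\frac\tau\pi\operatorname{Re}\omega_1(z),$$ where for $z\in i\mathbb R$, $|z|>y^*$, $\omega_1(z)$ is the solution of $\omega^3+t\omega=\tau z$ with positive real part. **Theorem.** The averaged objects are well defined: $\Gamma_2(\xi)\subset i\mathbb R$ for every $\xi>0$, $\xi\ne\xi_{cr}$; the integrals defining $\widetilde V_1(x)$ and $\widetilde V_3(x)$ converge absolutely for every $x\in\mathbb R$; and $\xi\mapsto\mu_2^\xi$ is measurable (up to a null set of $\xi$). Moreover, there is a constant $C$, depending only on $t$ and $\tau$, such that $$\widetilde V_1(x)=V_1(x)+C\quad(x\in\mathbb R),\qquad \widetilde V_3(x)=V_3(x)\quad(x\in\mathbb R),\qquad \widetilde\sigma=\sigma .$$ -/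

import Mathlib

open MeasureTheory Set Filter Topology Polynomial

noncomputable section

namespace TwoMatrix

/-! ## Numbering of the solutions of an algebraic equation -/

open Classical in
/-- The roots of `p`, listed with multiplicity and with non-increasing absolute value. Roots of
equal absolute value come in an arbitrary order. -/
def sortedRoots {K : Type*} [NormedField K] (p : K[X]) : List K :=
  p.roots.toList.insertionSort (fun u v => ‖v‖ ≤ ‖u‖)

/-- For the symbol `s(w) = w + d₀ + d₁ / w + d₂ / w² + d₃ / w³`, this is the polynomial
`w³ (s(w) - z)` in the variable `w`. If `d₃ ≠ 0` its roots are the solutions of `s(w) = z`. -/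
def symbolPoly (d : Fin 4 → ℝ) (z : ℂ) : ℂ[X] :=
  X ^ 4 + C ((d 0 : ℂ) - z) * X ^ 3 + C (d 1 : ℂ) * X ^ 2 + C (d 2 : ℂ) * X + C (d 3 : ℂ)

/-- The solution `w_j(z)`, `j = 1, 2, 3, 4`, of `s(w) = z`, where
`|w₁(z)| ≥ |w₂(z)| ≥ |w₃(z)| ≥ |w₄(z)|`. -/
def symbolRoot (d : Fin 4 → ℝ) (j : ℕ) (z : ℂ) : ℂ :=
  (sortedRoots (symbolPoly d z)).getD (j - 1) 0

/-- The density with respect to arc length `|dz|` of the measure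
`dμ_j(z) = (1 / (2 π i)) ∑_{k ≤ j} (w_{k-}'(z) / w_{k-}(z) - w_{k+}'(z) / w_{k+}(z)) dz`
at a point `z` of a straight arc with unit tangent vector `T`, so that `dz = T |dz|`.
The `+` side is on the left of the arc, in the direction `i T`, and the `-` side on the right,
in the direction `-i T`. -/
def arcDensity (d : Fin 4 → ℝ) (j : ℕ) (T z : ℂ) : ℂ :=
  1 / (2 * Real.pi * Complex.I) *
    (∑ k ∈ Finset.Icc 1 j,
      (limUnder (𝓝[>] (0 : ℝ)) (fun h : ℝ => logDeriv (symbolRoot d k) (z - h * (Complex.I * T))) -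
        limUnder (𝓝[>] (0 : ℝ))
          (fun h : ℝ => logDeriv (symbolRoot d k) (z + h * (Complex.I * T))))) * T

/-! ## The two symbols -/

/-- The critical value `ξ_cr`. -/
def xiCr (t τ : ℝ) : ℝ := if t < τ ^ 2 then (τ ^ 2 - t) ^ 2 / 4 else 0

/-- `a(ξ)`, for `ξ > ξ_cr`. -/
def aOne (t τ ξ : ℝ) : ℝ := (τ ^ 2 - t + √((τ ^ 2 - t) ^ 2 + 12 * ξ)) / 6

/-- `b(ξ)`, for `ξ > ξ_cr`. -/
def bOne (t τ ξ : ℝ) : ℝ := aOne t τ ξ * (3 * aOne t τ ξ + t)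

/-- `c(ξ)`, for `ξ > ξ_cr`. -/
def cOne (t τ ξ : ℝ) : ℝ := τ ^ 2 * aOne t τ ξ ^ 3

/-- Coefficients of `s₁(w; ξ) = w + b(ξ) / w + c(ξ) / w³`, for `ξ > ξ_cr`. -/
def symbolOne (t τ ξ : ℝ) : Fin 4 → ℝ := ![0, bOne t τ ξ, 0, cOne t τ ξ]

/-- `a₀(ξ)`, for `0 < ξ < ξ_cr`. -/
def aEven (t τ ξ : ℝ) : ℝ := (τ ^ 2 - t - √((τ ^ 2 - t) ^ 2 - 4 * ξ)) / 2

/-- `a₁(ξ)`, for `0 < ξ < ξ_cr`. -/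
def aOdd (t τ ξ : ℝ) : ℝ := (τ ^ 2 - t + √((τ ^ 2 - t) ^ 2 - 4 * ξ)) / 2

/-- `b₀(ξ)`, for `0 < ξ < ξ_cr`. -/
def bEven (t τ ξ : ℝ) : ℝ := aEven t τ ξ * (aEven t τ ξ + 2 * aOdd t τ ξ + t)

/-- `b₁(ξ)`, for `0 < ξ < ξ_cr`. -/
def bOdd (t τ ξ : ℝ) : ℝ := aOdd t τ ξ * (2 * aEven t τ ξ + aOdd t τ ξ + t)

/-- `c₀(ξ)`, for `0 < ξ < ξ_cr`. -/
def cEven (t τ ξ : ℝ) : ℝ := τ ^ 2 * aEven t τ ξ ^ 2 * aOdd t τ ξ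

/-- `c₁(ξ)`, for `0 < ξ < ξ_cr`. -/
def cOdd (t τ ξ : ℝ) : ℝ := τ ^ 2 * aEven t τ ξ * aOdd t τ ξ ^ 2

/-- Coefficients `A(ξ), B(ξ), C(ξ), D(ξ)` of the doubled symbol
`ŝ₂(w; ξ) = w + A(ξ) + B(ξ) / w + C(ξ) / w² + D(ξ) / w³`, for `0 < ξ < ξ_cr`. -/
def symbolTwo (t τ ξ : ℝ) : Fin 4 → ℝ :=
  ![bEven t τ ξ + bOdd t τ ξ,
    cEven t τ ξ + cOdd t τ ξ + bEven t τ ξ * bOdd t τ ξ,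
    bEven t τ ξ * cOdd t τ ξ + cEven t τ ξ * bOdd t τ ξ,
    cEven t τ ξ * cOdd t τ ξ]

/-- `w_j(z; ξ)`: the ordered solutions of `s₁(w; ξ) = z` in the one-cut case, and
`w_j(z; ξ) = ŵ_j(z²; ξ)`, with `ŵ_j` the ordered solutions of `ŝ₂(w; ξ) = z`, in the two-cut case.
The single value `ξ = ξ_cr` is irrelevant; it is treated with the one-cut case. -/
def w (t τ : ℝ) (j : ℕ) (z : ℂ) (ξ : ℝ) : ℂ :=
  if ξ < xiCr t τ then symbolRoot (symbolTwo t τ ξ) j (z ^ 2)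
  else symbolRoot (symbolOne t τ ξ) j z

/-- `Γ_j(ξ)`, `j = 1, 2, 3`. -/
def Γ (t τ : ℝ) (j : ℕ) (ξ : ℝ) : Set ℂ := {z | ‖w t τ j z ξ‖ = ‖w t τ (j + 1) z ξ‖}

/-! ## The averaged external fields and the averaged constraint -/

/-- `log |w_j(x; ξ) / w_{j+1}(x; ξ)|`. -/
def logRatio (t τ : ℝ) (j : ℕ) (x ξ : ℝ) : ℝ := Real.log ‖w t τ j x ξ / w t τ (j + 1) x ξ‖

/-- `½ ∫_0^{ξ_cr} log |w_j / w_{j+1}| dξ + ∫_{ξ_cr}^∞ log |w_j / w_{j+1}| dξ`. -/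
def averagedField (t τ : ℝ) (j : ℕ) (x : ℝ) : ℝ :=
  1 / 2 * (∫ ξ in Ioo 0 (xiCr t τ), logRatio t τ j x ξ) +
    ∫ ξ in Ioi (xiCr t τ), logRatio t τ j x ξ

/-- The averaged external field `Ṽ₁`. -/
def tildeV₁ (t τ : ℝ) (x : ℝ) : ℝ := averagedField t τ 1 x

/-- The averaged external field `Ṽ₃`. -/
def tildeV₃ (t τ : ℝ) (x : ℝ) : ℝ := averagedField t τ 3 x

/-- The parametrization `y ↦ i y` of the imaginary axis by arc length. -/
def imagAxis (y : ℝ) : ℂ := y * Complex.I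

/-- The density of `μ₂^ξ` with respect to `|dz|` at the point `z = i y` of `Γ₂(ξ)`. In the two-cut
case this is `|z| (dμ̂₂^ξ / dx)(z²)`, where `μ̂₂^ξ` belongs to the doubled symbol. The imaginary
axis is oriented upwards and the real axis to the right. -/
def μ₂Density (t τ ξ y : ℝ) : ℂ :=
  if ξ < xiCr t τ then
    ‖imagAxis y‖ * arcDensity (symbolTwo t τ ξ) 2 1 (imagAxis y ^ 2)
  else arcDensity (symbolOne t τ ξ) 2 Complex.I (imagAxis y)

/-- The measure `μ₂^ξ` on `Γ₂(ξ) ⊆ iℝ`, as a measure on `ℂ`. -/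
def μ₂ (t τ ξ : ℝ) : Measure ℂ :=
  ((volume.restrict {y : ℝ | imagAxis y ∈ Γ t τ 2 ξ}).withDensity
    (fun y => ENNReal.ofReal (μ₂Density t τ ξ y).re)).map imagAxis

/-- The averaged constraint `σ̃ = ∫_0^∞ μ₂^ξ dξ`, that is, `σ̃(B) = ∫_0^∞ μ₂^ξ(B) dξ`. -/
def tildeσ (t τ : ℝ) : Measure ℂ := Measure.bind (volume.restrict (Ioi (0 : ℝ))) (μ₂ t τ)

/-! ## The explicit external fields and the explicit constraint -/

/-- The real solutions `ω_j(x)`, `j = 1, 2, …`, of `ω³ + t ω = τ x`, for real `x`, listed with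
multiplicity such that `|ω₁(x)| ≥ |ω₂(x)| ≥ …`. There are one or three of them. -/
def ωReal (t τ : ℝ) (j : ℕ) (x : ℝ) : ℝ :=
  (sortedRoots (X ^ 3 + C t * X - C (τ * x) : ℝ[X])).getD (j - 1) 0

/-- `x*`, for `t ≤ 0`. -/
def xStar (t τ : ℝ) : ℝ := 2 * (-t) ^ (3 / 2 : ℝ) / (3 * √3 * τ)

/-- `y*`. -/
def yStar (t τ : ℝ) : ℝ := if t < 0 then 0 else 2 * t ^ (3 / 2 : ℝ) / (3 * √3 * τ)

/-- The external field `V₁`. -/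
def V₁ (t τ : ℝ) (x : ℝ) : ℝ :=
  x ^ 2 / 2 - 3 / 4 * ωReal t τ 1 x ^ 4 - 1 / 2 * t * ωReal t τ 1 x ^ 2

/-- The external field `V₃`. -/
def V₃ (t τ : ℝ) (x : ℝ) : ℝ :=
  if t < 0 ∧ |x| < xStar t τ then
    3 / 4 * ωReal t τ 2 x ^ 4 + 1 / 2 * t * ωReal t τ 2 x ^ 2
      - 3 / 4 * ωReal t τ 3 x ^ 4 - 1 / 2 * t * ωReal t τ 3 x ^ 2
  else 0

open Classical in
/-- For `z` on the imaginary axis: the solution `ω₁(z)` of `ω³ + t ω = τ z` with positive real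
part. It exists and is unique for `z = i y` with `|y| > y*`, and also for `y = 0` if `t < 0`;
where there is none, the value is `0`. -/
def ωImag (t τ : ℝ) (z : ℂ) : ℂ :=
  if h : ∃ ω : ℂ, ω ^ 3 + t * ω = τ * z ∧ 0 < ω.re then h.choose else 0

/-- The constraint `σ`: the measure on `(-i∞, -i y*] ∪ [i y*, i∞)` with density
`(τ / π) Re ω₁(z)` with respect to `|dz|`. -/
def σ (t τ : ℝ) : Measure ℂ :=
  ((volume.restrict {y : ℝ | yStar t τ ≤ |y|}).withDensity
    (fun y => ENNReal.ofReal (τ / Real.pi * (ωImag t τ (imagAxis y)).re))).map imagAxis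

end TwoMatrix

end

/-!
Everything is expressed through `W = w²` and `Z = z²`. With the coefficients `coef t τ ξ` the
equation for `W` has the same form in both cases: it is the doubled symbol in the two-cut case, and
the square of `s₁` in the one-cut case (`symbolTwo_eq_coef`, `isSortedRoots_sq`). As a function of
`W` this symbol has four negative zeros (`exists_negZeros`), so `|s|` is strictly monotone in `Re W`
on each circle `|W| = r`. Hence two roots of equal modulus are equal or complex conjugate; for
`Z > 0` the second and the third root have different moduli, and for `Z < 0` so have the first and
the second, and the third and the fourth (`NegZeros.norm_two_lt_one`, `NegZeros.norm_one_lt_zero`,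
`NegZeros.norm_three_lt_two`). The support of `μ₂^ξ` is therefore contained in `iℝ`.

The external fields. Along a branch of simple roots for constant `Z`, the elementary function
`potential` of `W` and `ξ` has the `ξ`-derivative `½ log |W|` plus a function of `ξ` alone
(`exists_hasDerivAt_potential`). So the difference of the potentials of two neighbouring roots is a
primitive of the integrand, also across the points where the two roots collide
(`hasDerivAt_potGap`). It vanishes for large `ξ`, and the integral is minus its limit at `ξ = 0`
(`integral_logGap_Ioi`). In this limit the rescaled reciprocals `τ² a₀ a₁ / W` converge to
`M - s`, where `s` is the limit of `a₀ + a₁` and `M` runs through the solutions of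
`M (M + t)² = τ² Z`, that is, the squares of the solutions of `ω³ + t ω = τ z`
(`exists_limitData`), which gives `V₁` and `V₃`. The limits are taken along ultrafilters, since
sorted roots converge along an ultrafilter to sorted roots of the limiting equation.

The constraint. At a point where the second and the third root are conjugate and not real, the two
one-sided limits of `w'/w` are the logarithmic derivatives of the two branches of the inverse of the
symbol (`arcDensity_two_eq`), so the density is explicit (`μ₂Density_eq`). For constant `Z < 0` it
is minus the `ξ`-derivative of the imaginary part of the elementary function `coordProd`
(`hasDerivAt_densityPrimitive`), which vanishes where the two roots are real and for large `ξ`, and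
whose limit at `ξ = 0` is the density of `σ`. Tonelli's theorem then gives `tildeσ = σ`.
-/

namespace TwoMatrix

/-! ### Ordered roots of quartic polynomials -/

/-- The monic quartic `W⁴ + q₀ W³ + q₁ W² + q₂ W + q₃`. -/
noncomputable def quartic (q : Fin 4 → ℂ) (W : ℂ) : ℂ :=
  W ^ 4 + q 0 * W ^ 3 + q 1 * W ^ 2 + q 2 * W + q 3

/-- `ρ` lists the roots of `quartic q` with multiplicity and non-increasing modulus. That these
are all the roots is expressed by Vieta's formulas, which are closed conditions and hence survive
limits. -/
structure IsSortedRoots (q ρ : Fin 4 → ℂ) : Prop where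
  v0 : ρ 0 + ρ 1 + ρ 2 + ρ 3 = -q 0
  v1 : ρ 0 * ρ 1 + ρ 0 * ρ 2 + ρ 0 * ρ 3 + ρ 1 * ρ 2 + ρ 1 * ρ 3 + ρ 2 * ρ 3 = q 1
  v2 : ρ 0 * ρ 1 * ρ 2 + ρ 0 * ρ 1 * ρ 3 + ρ 0 * ρ 2 * ρ 3 + ρ 1 * ρ 2 * ρ 3 = -q 2
  v3 : ρ 0 * ρ 1 * ρ 2 * ρ 3 = q 3
  le10 : ‖ρ 1‖ ≤ ‖ρ 0‖
  le21 : ‖ρ 2‖ ≤ ‖ρ 1‖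
  le32 : ‖ρ 3‖ ≤ ‖ρ 2‖

theorem IsSortedRoots.quartic_eq {q ρ : Fin 4 → ℂ} (h : IsSortedRoots q ρ) (W : ℂ) :
    quartic q W = (W - ρ 0) * (W - ρ 1) * (W - ρ 2) * (W - ρ 3) := by
  rw [quartic]
  linear_combination W ^ 3 * h.v0 - W ^ 2 * h.v1 + W * h.v2 - h.v3

theorem IsSortedRoots.root {q ρ : Fin 4 → ℂ} (h : IsSortedRoots q ρ) (j : Fin 4) :
    quartic q (ρ j) = 0 := by
  rw [h.quartic_eq]; fin_cases j <;> simp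

theorem IsSortedRoots.mem {q ρ : Fin 4 → ℂ} (h : IsSortedRoots q ρ) {W : ℂ}
    (hW : quartic q W = 0) : W = ρ 0 ∨ W = ρ 1 ∨ W = ρ 2 ∨ W = ρ 3 := by
  rw [h.quartic_eq] at hW
  simpa [sub_eq_zero, or_assoc] using hW

/-- A polynomial identity between `quartic` and a product of linear factors gives Vieta's
formulas. -/
theorem isSortedRoots_of_quartic_eq {q ρ : Fin 4 → ℂ}
    (h : ∀ W, quartic q W = (W - ρ 0) * (W - ρ 1) * (W - ρ 2) * (W - ρ 3))
    (h1 : ‖ρ 1‖ ≤ ‖ρ 0‖) (h2 : ‖ρ 2‖ ≤ ‖ρ 1‖) (h3 : ‖ρ 3‖ ≤ ‖ρ 2‖) : IsSortedRoots q ρ := by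
  have a0 := h 0
  have a1 := h 1
  have a2 := h (-1)
  have a3 := h 2
  simp only [quartic] at a0 a1 a2 a3
  refine ⟨?_, ?_, ?_, ?_, h1, h2, h3⟩
  · linear_combination a0 / 2 - a1 / 2 - a2 / 6 + a3 / 6
  · linear_combination a0 - a1 / 2 - a2 / 2
  · linear_combination -a0 / 2 + a1  - a2 / 3 - a3 / 6
  · linear_combination -a0

theorem IsSortedRoots.norm_antitone {q ρ : Fin 4 → ℂ} (h : IsSortedRoots q ρ) {i j : Fin 4}
    (hij : i ≤ j) : ‖ρ j‖ ≤ ‖ρ i‖ := by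
  have h1 := h.le10
  have h2 := h.le21
  have h3 := h.le32
  fin_cases i <;> fin_cases j <;> simp_all <;> linarith

/-- Two ordered enumerations of the roots of a quartic have the same moduli. -/
theorem IsSortedRoots.norm_eq {q ρ ρ' : Fin 4 → ℂ} (h : IsSortedRoots q ρ)
    (h' : IsSortedRoots q ρ') (j : Fin 4) : ‖ρ j‖ = ‖ρ' j‖ := by
  have key : ∀ {σ : Fin 4 → ℂ}, IsSortedRoots q σ →
      (X ^ 4 + C (q 0) * X ^ 3 + C (q 1) * X ^ 2 + C (q 2) * X + C (q 3) : ℂ[X])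
        = (([σ 0, σ 1, σ 2, σ 3] : Multiset ℂ).map (fun a => X - C a)).prod := by
    intro σ hσ
    refine Polynomial.funext fun W => ?_
    have := hσ.quartic_eq W
    rw [quartic] at this
    simp [this]
    ring
  have e := (key h).symm.trans (key h')
  have e2 := congrArg Polynomial.roots e
  rw [roots_multiset_prod_X_sub_C, roots_multiset_prod_X_sub_C] at e2
  have perm := Multiset.coe_eq_coe.1 e2
  have perm2 := perm.map (fun z : ℂ => ‖z‖)
  have srt : ∀ {σ : Fin 4 → ℂ}, IsSortedRoots q σ →
      ([σ 0, σ 1, σ 2, σ 3].map (fun z : ℂ => ‖z‖)).Pairwise (fun a b : ℝ => b ≤ a) := by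
    intro σ hσ
    have h1 := hσ.le10
    have h2 := hσ.le21
    have h3 := hσ.le32
    simp
    refine ⟨⟨h1, ?_, ?_⟩, ⟨h2, ?_⟩, h3⟩ <;> linarith
  have := List.Perm.eq_of_pairwise (le := fun a b : ℝ => b ≤ a)
    (fun a b _ _ h1 h2 => le_antisymm h2 h1) (srt h) (srt h') perm2
  simp at this
  fin_cases j <;> simp [this]

theorem IsSortedRoots.norm_le {q ρ : Fin 4 → ℂ} (h : IsSortedRoots q ρ) (j : Fin 4) :
    ‖ρ j‖ ≤ 1 + ‖q 0‖ + ‖q 1‖ + ‖q 2‖ + ‖q 3‖ := by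
  by_contra! hlt
  set R := ‖ρ j‖ with hR
  have hq : ∀ i, 0 ≤ ‖q i‖ := fun i => norm_nonneg _
  have h1 : 1 < R := by linarith [hq 0, hq 1, hq 2, hq 3]
  have hr := h.root j
  have e : ρ j ^ 4 = -(q 0 * ρ j ^ 3 + q 1 * ρ j ^ 2 + q 2 * ρ j + q 3) := by
    rw [quartic] at hr; linear_combination hr
  have e2 : R ^ 4 ≤ ‖q 0‖ * R ^ 3 + ‖q 1‖ * R ^ 2 + ‖q 2‖ * R + ‖q 3‖ := by
    have := congrArg norm e
    rw [norm_neg, norm_pow, ← hR] at this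
    rw [this]
    refine (norm_add_le _ _).trans (add_le_add ((norm_add_le _ _).trans (add_le_add
      ((norm_add_le _ _).trans (add_le_add ?_ ?_)) ?_)) le_rfl) <;> simp [hR]
  have p3 : 0 < R ^ 3 := by positivity
  have b2 : R ^ 2 ≤ R ^ 3 := pow_le_pow_right₀ h1.le (by norm_num)
  have b1 : R ≤ R ^ 3 := by simpa using pow_le_pow_right₀ h1.le (show 1 ≤ 3 by norm_num)
  have b0 : 1 ≤ R ^ 3 := one_le_pow₀ h1.le
  have : R ^ 4 ≤ (‖q 0‖ + ‖q 1‖ + ‖q 2‖ + ‖q 3‖) * R ^ 3 := by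
    have := mul_le_mul_of_nonneg_left b2 (hq 1)
    have := mul_le_mul_of_nonneg_left b1 (hq 2)
    have := mul_le_mul_of_nonneg_left b0 (hq 3)
    linarith
  have : R * R ^ 3 ≤ (‖q 0‖ + ‖q 1‖ + ‖q 2‖ + ‖q 3‖) * R ^ 3 := by linarith [pow_succ' R 3]
  have := le_of_mul_le_mul_right this p3
  linarith

/-- Continuity of roots: along an ultrafilter on which the coefficients converge, ordered roots
converge to ordered roots of the limit quartic. -/
theorem exists_tendsto_sortedRoots {ι : Type*} (U : Ultrafilter ι) {q : ι → Fin 4 → ℂ}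
    {ρ : ι → Fin 4 → ℂ} {q0 : Fin 4 → ℂ} (hq : Tendsto q U (𝓝 q0))
    (hρ : ∀ᶠ i in (U : Filter ι), IsSortedRoots (q i) (ρ i)) :
    ∃ ρ0, IsSortedRoots q0 ρ0 ∧ Tendsto ρ U (𝓝 ρ0) := by
  have hq' : ∀ j, Tendsto (fun i => q i j) U (𝓝 (q0 j)) := fun j => (tendsto_pi_nhds.1 hq) j
  set B := 1 + ‖q0 0‖ + ‖q0 1‖ + ‖q0 2‖ + ‖q0 3‖ + 1 with hB
  have hbd : ∀ᶠ i in (U : Filter ι),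
      1 + ‖q i 0‖ + ‖q i 1‖ + ‖q i 2‖ + ‖q i 3‖ < B := by
    have : Tendsto (fun i => 1 + ‖q i 0‖ + ‖q i 1‖ + ‖q i 2‖ + ‖q i 3‖) U
        (𝓝 (1 + ‖q0 0‖ + ‖q0 1‖ + ‖q0 2‖ + ‖q0 3‖)) :=
      ((((hq' 0).norm.const_add 1).add (hq' 1).norm).add (hq' 2).norm).add (hq' 3).norm
    exact this.eventually (gt_mem_nhds (by linarith))
  have hmem : Metric.closedBall (0 : Fin 4 → ℂ) B ∈ U.map ρ := by
    rw [Ultrafilter.mem_map]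
    filter_upwards [hρ, hbd] with i hi hb
    rw [mem_preimage, mem_closedBall_zero_iff, pi_norm_le_iff_of_nonneg (by positivity)]
    exact fun j => (hi.norm_le j).trans hb.le
  obtain ⟨ρ0, -, hlim⟩ := isCompact_iff_ultrafilter_le_nhds'.1
    (isCompact_closedBall (0 : Fin 4 → ℂ) B) _ hmem
  have hlim' : Tendsto ρ U (𝓝 ρ0) := hlim
  have hj : ∀ j, Tendsto (fun i => ρ i j) U (𝓝 (ρ0 j)) := fun j => (tendsto_pi_nhds.1 hlim') j
  refine ⟨ρ0, ⟨?_, ?_, ?_, ?_, ?_, ?_, ?_⟩, hlim'⟩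
  · refine tendsto_nhds_unique ((((hj 0).add (hj 1)).add (hj 2)).add (hj 3))
      ((hq' 0).neg.congr' ?_)
    filter_upwards [hρ] with i hi using hi.v0.symm
  · refine tendsto_nhds_unique ((((((hj 0).mul (hj 1)).add ((hj 0).mul (hj 2))).add
      ((hj 0).mul (hj 3))).add ((hj 1).mul (hj 2))).add ((hj 1).mul (hj 3)) |>.add
      ((hj 2).mul (hj 3))) ((hq' 1).congr' ?_)
    filter_upwards [hρ] with i hi using hi.v1.symm
  · refine tendsto_nhds_unique (((((hj 0).mul (hj 1)).mul (hj 2)).add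
      (((hj 0).mul (hj 1)).mul (hj 3))).add (((hj 0).mul (hj 2)).mul (hj 3)) |>.add
      (((hj 1).mul (hj 2)).mul (hj 3))) ((hq' 2).neg.congr' ?_)
    filter_upwards [hρ] with i hi using hi.v2.symm
  · refine tendsto_nhds_unique ((((hj 0).mul (hj 1)).mul (hj 2)).mul (hj 3))
      ((hq' 3).congr' ?_)
    filter_upwards [hρ] with i hi using hi.v3.symm
  · refine le_of_tendsto_of_tendsto (hj 1).norm (hj 0).norm ?_
    filter_upwards [hρ] with i hi using hi.le10
  · refine le_of_tendsto_of_tendsto (hj 2).norm (hj 1).norm ?_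
    filter_upwards [hρ] with i hi using hi.le21
  · refine le_of_tendsto_of_tendsto (hj 3).norm (hj 2).norm ?_
    filter_upwards [hρ] with i hi using hi.le32

/-- Reversal: `κ / ρ`, in the opposite order, lists the roots of the reversed and rescaled
quartic. -/
theorem IsSortedRoots.reverse {q ρ : Fin 4 → ℂ} (h : IsSortedRoots q ρ) (h3 : q 3 ≠ 0) (κ : ℂ) :
    IsSortedRoots ![κ * q 2 / q 3, κ ^ 2 * q 1 / q 3, κ ^ 3 * q 0 / q 3, κ ^ 4 / q 3]
      ![κ / ρ 3, κ / ρ 2, κ / ρ 1, κ / ρ 0] := by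
  have hp := h.v3
  have n0 : ρ 0 ≠ 0 := by rintro e; apply h3; rw [← hp, e]; ring
  have n1 : ρ 1 ≠ 0 := by rintro e; apply h3; rw [← hp, e]; ring
  have n2 : ρ 2 ≠ 0 := by rintro e; apply h3; rw [← hp, e]; ring
  have n3 : ρ 3 ≠ 0 := by rintro e; apply h3; rw [← hp, e]; ring
  have m : ∀ {a b : ℂ}, b ≠ 0 → ‖b‖ ≤ ‖a‖ → ‖κ / a‖ ≤ ‖κ / b‖ := by
    intro a b hb hab
    rw [norm_div, norm_div]
    exact div_le_div_of_nonneg_left (norm_nonneg _) (norm_pos_iff.2 hb) hab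
  have q0 : q 0 = -(ρ 0 + ρ 1 + ρ 2 + ρ 3) := by rw [h.v0]; ring
  have q2 : q 2 = -(ρ 0 * ρ 1 * ρ 2 + ρ 0 * ρ 1 * ρ 3 + ρ 0 * ρ 2 * ρ 3 + ρ 1 * ρ 2 * ρ 3) := by
    rw [h.v2]; ring
  refine ⟨?_, ?_, ?_, ?_, ?_, ?_, ?_⟩
  · simp; rw [← hp, q2]; field_simp
  · simp; rw [← hp, ← h.v1]; field_simp; ring
  · simp; rw [← hp, q0]; field_simp
  · simp; rw [← hp]; field_simp
  · simpa using m n3 h.le32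
  · simpa using m n2 h.le21
  · simpa using m n1 h.le10

/-- The coefficients of `symbolPoly d z`. -/
noncomputable def symbolCoef (d : Fin 4 → ℝ) (z : ℂ) : Fin 4 → ℂ := ![d 0 - z, d 1, d 2, d 3]

/-- The four ordered roots `w₁, …, w₄` of a symbol, indexed by `Fin 4`. -/
noncomputable def symbolRoots (d : Fin 4 → ℝ) (z : ℂ) (i : Fin 4) : ℂ := symbolRoot d (i + 1) z

theorem coe_sortedRoots {K : Type*} [NormedField K] (p : K[X]) :
    (sortedRoots p : Multiset K) = p.roots := by
  classical
  rw [sortedRoots, Multiset.coe_eq_coe.2 (List.perm_insertionSort _ _), Multiset.coe_toList]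

theorem pairwise_sortedRoots {K : Type*} [NormedField K] (p : K[X]) :
    (sortedRoots p).Pairwise (fun u v => ‖v‖ ≤ ‖u‖) := by
  classical
  rw [sortedRoots]
  have : Std.Total (fun u v : K => ‖v‖ ≤ ‖u‖) := ⟨fun a b => le_total _ _⟩
  have : IsTrans K (fun u v : K => ‖v‖ ≤ ‖u‖) := ⟨fun a b c h1 h2 => h2.trans h1⟩
  exact List.pairwise_insertionSort _ _

theorem isSortedRoots_symbolRoots (d : Fin 4 → ℝ) (z : ℂ) :
    IsSortedRoots (symbolCoef d z) (symbolRoots d z) := by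
  classical
  set l := sortedRoots (symbolPoly d z) with hl
  have hperm : (l : Multiset ℂ) = (symbolPoly d z).roots := by
    rw [hl, coe_sortedRoots]
  have hmon : (symbolPoly d z).Monic := by rw [symbolPoly]; monicity!
  have hdeg : (symbolPoly d z).natDegree = 4 := by rw [symbolPoly]; compute_degree!
  have hsplit := IsAlgClosed.splits (symbolPoly d z)
  have hlen : l.length = 4 := by
    have := hsplit.natDegree_eq_card_roots
    rw [hdeg, ← hperm] at this
    simpa using this.symm
  have hpw : l.Pairwise (fun u v => ‖v‖ ≤ ‖u‖) := pairwise_sortedRoots _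
  have hprod : symbolPoly d z = ((l : Multiset ℂ).map (fun a => X - C a)).prod := by
    rw [hperm]; exact hsplit.eq_prod_roots_of_monic hmon
  obtain ⟨a, b, c, e, habc⟩ : ∃ a b c e, l = [a, b, c, e] := by
    match l, hlen with
    | [a, b, c, e], _ => exact ⟨a, b, c, e, rfl⟩
  have r0 : symbolRoots d z 0 = a := by simp [symbolRoots, symbolRoot, ← hl, habc]
  have r1 : symbolRoots d z 1 = b := by simp [symbolRoots, symbolRoot, ← hl, habc]
  have r2 : symbolRoots d z 2 = c := by simp [symbolRoots, symbolRoot, ← hl, habc]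
  have r3 : symbolRoots d z 3 = e := by simp [symbolRoots, symbolRoot, ← hl, habc]
  rw [habc] at hpw hprod
  simp at hpw
  refine isSortedRoots_of_quartic_eq (fun W => ?_) ?_ ?_ ?_
  · have := congrArg (Polynomial.eval W) hprod
    simp [symbolPoly] at this
    rw [r0, r1, r2, r3]
    simp [quartic, symbolCoef]
    rw [this]; ring
  · rw [r0, r1]; exact hpw.1.1
  · rw [r1, r2]; exact hpw.2.1.1
  · rw [r3, r2]; exact hpw.2.2

end TwoMatrix

namespace TwoMatrix

/-! ### Quartics with negative zeros, perturbed by a multiple of `W³` -/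

/-- The polynomial `W⁴ + d₀ W³ + d₁ W² + d₂ W + d₃` is `∏ (W + ζᵢ)` with all `ζᵢ` positive. -/
structure NegZeros (d ζ : Fin 4 → ℝ) : Prop where
  pos : ∀ i, 0 < ζ i
  c0 : d 0 = ζ 0 + ζ 1 + ζ 2 + ζ 3
  c1 : d 1 = ζ 0 * ζ 1 + ζ 0 * ζ 2 + ζ 0 * ζ 3 + ζ 1 * ζ 2 + ζ 1 * ζ 3 + ζ 2 * ζ 3
  c2 : d 2 = ζ 0 * ζ 1 * ζ 2 + ζ 0 * ζ 1 * ζ 3 + ζ 0 * ζ 2 * ζ 3 + ζ 1 * ζ 2 * ζ 3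
  c3 : d 3 = ζ 0 * ζ 1 * ζ 2 * ζ 3

/-- `W s'(W)` for the symbol `s(W) = W + d₀ + d₁ / W + d₂ / W² + d₃ / W³`. At a root of
`s(W) = z` it vanishes exactly when the root is multiple. -/
noncomputable def symbolEuler (d : Fin 4 → ℝ) (W : ℂ) : ℂ :=
  W - d 1 / W - 2 * d 2 / W ^ 2 - 3 * d 3 / W ^ 3

theorem quartic_symbolCoef (d : Fin 4 → ℝ) (z W : ℂ) : quartic (symbolCoef d z) W =
    W ^ 4 + (d 0 - z) * W ^ 3 + d 1 * W ^ 2 + d 2 * W + d 3 := by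
  simp [quartic, symbolCoef]

theorem quartic_symbolCoef_conj (d : Fin 4 → ℝ) (Z : ℝ) {W : ℂ}
    (h : quartic (symbolCoef d Z) W = 0) :
    quartic (symbolCoef d Z) ((starRingEnd ℂ) W) = 0 := by
  rw [quartic_symbolCoef] at h ⊢
  have := congrArg (starRingEnd ℂ) h
  simpa using this

theorem symbolEuler_conj (d : Fin 4 → ℝ) (W : ℂ) :
    symbolEuler d ((starRingEnd ℂ) W) = (starRingEnd ℂ) (symbolEuler d W) := by
  simp [symbolEuler, map_ofNat]

/-- At a root, `symbolEuler` is the derivative of the quartic up to a factor. -/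
theorem symbolEuler_mul {d : Fin 4 → ℝ} {z W : ℂ} (hW : W ≠ 0)
    (h : quartic (symbolCoef d z) W = 0) :
    symbolEuler d W * W ^ 2 = 4 * W ^ 3 + 3 * (d 0 - z) * W ^ 2 + 2 * d 1 * W + d 2 := by
  rw [quartic_symbolCoef] at h
  rw [symbolEuler]
  field_simp
  linear_combination -3 * h

theorem symbolEuler_eq_prod {d : Fin 4 → ℝ} {z : ℂ} {ρ : Fin 4 → ℂ}
    (h : IsSortedRoots (symbolCoef d z) ρ) {W : ℂ} (hW : W ≠ 0)
    (hr : quartic (symbolCoef d z) W = 0) :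
    symbolEuler d W * W ^ 2 = (W - ρ 1) * (W - ρ 2) * (W - ρ 3) + (W - ρ 0) * (W - ρ 2) * (W - ρ 3)
      + (W - ρ 0) * (W - ρ 1) * (W - ρ 3) + (W - ρ 0) * (W - ρ 1) * (W - ρ 2) := by
  rw [symbolEuler_mul hW hr]
  have h0 := h.v0
  have h1 := h.v1
  have h2 := h.v2
  simp [symbolCoef] at h0 h1 h2
  linear_combination 3 * W ^ 2 * h0 - 2 * W * h1 + h2

/-- At a simple root the Euler derivative `w s'(w)` of the symbol does not vanish. -/
theorem symbolEuler_ne_zero_of_unique {d : Fin 4 → ℝ} {z : ℂ} {ρ : Fin 4 → ℂ}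
    (h : IsSortedRoots (symbolCoef d z) ρ) {j : Fin 4} (hW : ρ j ≠ 0)
    (hne : ∀ i, i ≠ j → ρ i ≠ ρ j) : symbolEuler d (ρ j) ≠ 0 := by
  intro h0
  have key := symbolEuler_eq_prod h hW (h.root j)
  rw [h0, zero_mul] at key
  have hs : ∀ i, i ≠ j → ρ j - ρ i ≠ 0 := fun i hi => sub_ne_zero.2 (hne i hi).symm
  fin_cases j
  · have a := hs 1 (by decide)
    have b := hs 2 (by decide)
    have c := hs 3 (by decide)
    simp at key a b c
    simp_all
  · have a := hs 0 (by decide)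
    have b := hs 2 (by decide)
    have c := hs 3 (by decide)
    simp at key a b c
    simp_all
  · have a := hs 0 (by decide)
    have b := hs 1 (by decide)
    have c := hs 3 (by decide)
    simp at key a b c
    simp_all
  · have a := hs 0 (by decide)
    have b := hs 1 (by decide)
    have c := hs 2 (by decide)
    simp at key a b c
    simp_all

theorem symbolEuler_eq_zero_of_eq {d : Fin 4 → ℝ} {z : ℂ} {ρ : Fin 4 → ℂ}
    (h : IsSortedRoots (symbolCoef d z) ρ) {i j : Fin 4} (hij : i ≠ j) (hW : ρ j ≠ 0)
    (he : ρ i = ρ j) : symbolEuler d (ρ j) = 0 := by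
  have key := symbolEuler_eq_prod h hW (h.root j)
  have hz : symbolEuler d (ρ j) * ρ j ^ 2 = 0 := by
    rw [key]
    have : ρ j - ρ i = 0 := by rw [he, sub_self]
    fin_cases i <;> fin_cases j <;> simp_all
  exact (mul_eq_zero.1 hz).resolve_right (pow_ne_zero _ hW)

namespace NegZeros

variable {d ζ : Fin 4 → ℝ}

theorem d3_pos (h : NegZeros d ζ) : 0 < d 3 := by
  have := h.pos 0; have := h.pos 1; have := h.pos 2; have := h.pos 3
  rw [h.c3]; positivity

theorem d2_pos (h : NegZeros d ζ) : 0 < d 2 := by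
  have := h.pos 0; have := h.pos 1; have := h.pos 2; have := h.pos 3
  rw [h.c2]; positivity

theorem d1_pos (h : NegZeros d ζ) : 0 < d 1 := by
  have := h.pos 0; have := h.pos 1; have := h.pos 2; have := h.pos 3
  rw [h.c1]; positivity

theorem quartic_eq (h : NegZeros d ζ) (z W : ℂ) : quartic (symbolCoef d z) W =
    (W + ζ 0) * (W + ζ 1) * (W + ζ 2) * (W + ζ 3) - z * W ^ 3 := by
  rw [quartic_symbolCoef, h.c0, h.c1, h.c2, h.c3]
  push_cast; ring

theorem prod_eq (h : NegZeros d ζ) {z W : ℂ} (hr : quartic (symbolCoef d z) W = 0) :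
    (W + ζ 0) * (W + ζ 1) * (W + ζ 2) * (W + ζ 3) = z * W ^ 3 := by
  rw [h.quartic_eq] at hr; linear_combination hr

theorem root_ne_zero (h : NegZeros d ζ) {z W : ℂ} (hr : quartic (symbolCoef d z) W = 0) :
    W ≠ 0 := by
  rintro rfl
  rw [quartic_symbolCoef] at hr
  simp at hr
  exact h.d3_pos.ne' hr

theorem norm_add_lt {W W' : ℂ} (hn : ‖W‖ = ‖W'‖) (hre : W.re < W'.re) {x : ℝ} (hx : 0 < x) :
    ‖W + x‖ < ‖W' + x‖ := by
  have e : W.re ^ 2 + W.im ^ 2 = W'.re ^ 2 + W'.im ^ 2 := by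
    have := congrArg (· ^ 2) hn
    simp only [← Complex.normSq_eq_norm_sq, Complex.normSq_apply] at this
    linarith
  refine lt_of_pow_lt_pow_left₀ 2 (norm_nonneg _) ?_
  rw [← Complex.normSq_eq_norm_sq, ← Complex.normSq_eq_norm_sq, Complex.normSq_apply,
    Complex.normSq_apply]
  simp
  nlinarith

/-- On a circle about the origin, `|∏ (W + ζᵢ)|` strictly increases with `Re W`. -/
theorem norm_prod_lt (h : NegZeros d ζ) {W W' : ℂ} (hn : ‖W‖ = ‖W'‖) (hre : W.re < W'.re) :
    ‖(W + ζ 0) * (W + ζ 1) * (W + ζ 2) * (W + ζ 3)‖ <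
      ‖(W' + ζ 0) * (W' + ζ 1) * (W' + ζ 2) * (W' + ζ 3)‖ := by
  simp only [norm_mul]
  have k := fun i => norm_add_lt hn hre (h.pos i)
  exact mul_lt_mul'' (mul_lt_mul'' (mul_lt_mul'' (k 0) (k 1) (norm_nonneg _) (norm_nonneg _)) (k 2)
    (by positivity) (norm_nonneg _)) (k 3) (by positivity) (norm_nonneg _)

/-- Two roots of equal modulus are equal or complex conjugate. -/
theorem eq_or_conj (h : NegZeros d ζ) {z W W' : ℂ} (hr : quartic (symbolCoef d z) W = 0)
    (hr' : quartic (symbolCoef d z) W' = 0) (hn : ‖W‖ = ‖W'‖) :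
    W' = W ∨ W' = (starRingEnd ℂ) W := by
  have a := h.prod_eq hr
  have b := h.prod_eq hr'
  have hnn : ‖z * W ^ 3‖ = ‖z * W' ^ 3‖ := by simp [hn]
  have hre : W.re = W'.re := by
    rcases lt_trichotomy W.re W'.re with hlt | heq | hgt
    · have := h.norm_prod_lt hn hlt
      rw [a, b, hnn] at this; exact absurd this (lt_irrefl _)
    · exact heq
    · have := h.norm_prod_lt hn.symm hgt
      rw [a, b, hnn] at this; exact absurd this (lt_irrefl _)
  have e : W.re ^ 2 + W.im ^ 2 = W'.re ^ 2 + W'.im ^ 2 := by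
    have := congrArg (· ^ 2) hn
    simp only [← Complex.normSq_eq_norm_sq, Complex.normSq_apply] at this
    linarith
  rw [hre] at e
  have : W'.im ^ 2 = W.im ^ 2 := by linarith
  rcases sq_eq_sq_iff_eq_or_eq_neg.1 this with h1 | h1
  · left; exact Complex.ext hre.symm h1
  · right; exact Complex.ext (by simpa using hre.symm) (by simpa using h1)

theorem symbolEuler_eq (h : NegZeros d ζ) {z W : ℂ} (hr : quartic (symbolCoef d z) W = 0)
    (hz : z ≠ 0) : symbolEuler d W =
      z * (1 - (ζ 0 / (W + ζ 0) + ζ 1 / (W + ζ 1) + ζ 2 / (W + ζ 2) + ζ 3 / (W + ζ 3))) := by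
  have hW := h.root_ne_zero hr
  have hp := h.prod_eq hr
  have hp0 : (W + ζ 0) * (W + ζ 1) * (W + ζ 2) * (W + ζ 3) ≠ 0 := by
    rw [hp]; exact mul_ne_zero hz (pow_ne_zero _ hW)
  have n3 := right_ne_zero_of_mul hp0
  have n2 := right_ne_zero_of_mul (left_ne_zero_of_mul hp0)
  have n1 := right_ne_zero_of_mul (left_ne_zero_of_mul (left_ne_zero_of_mul hp0))
  have n0 := left_ne_zero_of_mul (left_ne_zero_of_mul (left_ne_zero_of_mul hp0))
  have hz' : z = (W + ζ 0) * (W + ζ 1) * (W + ζ 2) * (W + ζ 3) / W ^ 3 := by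
    rw [hp]; field_simp
  rw [hz', symbolEuler, h.c1, h.c2, h.c3]
  push_cast
  field_simp
  ring

theorem im_div_add {x : ℝ} {W : ℂ} :
    ((x : ℂ) / (W + x)).im = -(W.im * (x / Complex.normSq (W + x))) := by
  rw [Complex.div_im]; simp; ring

/-- For a real value of the symbol, `Im (W s'(W))` has a definite sign on each half plane. -/
theorem symbolEuler_im (h : NegZeros d ζ) {Z : ℝ} {W : ℂ}
    (hr : quartic (symbolCoef d Z) W = 0) (hZ : Z ≠ 0) :
    ∃ k : ℝ, (W.im ≠ 0 → 0 < k) ∧ (symbolEuler d W).im = Z * W.im * k := by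
  refine ⟨ζ 0 / Complex.normSq (W + ζ 0) + ζ 1 / Complex.normSq (W + ζ 1)
    + ζ 2 / Complex.normSq (W + ζ 2) + ζ 3 / Complex.normSq (W + ζ 3), fun hi => ?_, ?_⟩
  · have : ∀ i, 0 < ζ i / Complex.normSq (W + ζ i) := fun i =>
      div_pos (h.pos i) (Complex.normSq_pos.2 fun h0 => hi (by simpa using congrArg Complex.im h0))
    have p0 := this 0; have p1 := this 1; have p2 := this 2; have p3 := this 3
    positivity
  · rw [h.symbolEuler_eq hr (by exact_mod_cast hZ), Complex.im_ofReal_mul]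
    simp [im_div_add]
    ring

/-- Multiple roots are real. -/
theorem im_eq_zero_of_symbolEuler (h : NegZeros d ζ) {z W : ℂ}
    (hr : quartic (symbolCoef d z) W = 0) (h0 : symbolEuler d W = 0) : W.im = 0 := by
  by_contra hi
  by_cases hz : z = 0
  · have hp := h.prod_eq hr
    rw [hz, zero_mul] at hp
    have nz : ∀ i, W + ζ i ≠ 0 := fun i h1 => hi (by simpa using congrArg Complex.im h1)
    simp [nz] at hp
  · rw [h.symbolEuler_eq hr hz] at h0
    have h1 := (mul_eq_zero.1 h0).resolve_left hz
    have h2 := congrArg Complex.im h1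
    have : ∀ i, 0 < ζ i / Complex.normSq (W + ζ i) := fun i =>
      div_pos (h.pos i) (Complex.normSq_pos.2 fun h0 => hi (by simpa using congrArg Complex.im h0))
    have p0 := this 0; have p1 := this 1; have p2 := this 2; have p3 := this 3
    simp [im_div_add] at h2
    have h3 : W.im * (ζ 0 / Complex.normSq (W + ζ 0) + ζ 1 / Complex.normSq (W + ζ 1)
      + ζ 2 / Complex.normSq (W + ζ 2) + ζ 3 / Complex.normSq (W + ζ 3)) = 0 := by linarith
    rcases mul_eq_zero.1 h3 with h4 | h4
    · exact hi h4
    · linarith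

/-- If the roots are `p`, `conj p`, `a`, `b`, then `a + b` and `a b` are real, and Vieta's formulas
hold over the reals. -/
theorem vieta_of_conj (h : NegZeros d ζ) {Z : ℝ} {p a b : ℂ}
    (hq : ∀ W, quartic (symbolCoef d Z) W = (W - p) * (W - (starRingEnd ℂ) p) * (W - a) * (W - b)) :
    ∃ A B : ℝ, a + b = A ∧ a * b = B ∧ A + 2 * p.re = Z - d 0 ∧
      B + ‖p‖ ^ 2 + 2 * p.re * A = d 1 ∧ 2 * p.re * B + ‖p‖ ^ 2 * A = -d 2 ∧
      ‖p‖ ^ 2 * B = d 3 := by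
  have a0 := hq 0
  have a1 := hq 1
  have a2 := hq (-1)
  have a3 := hq 2
  simp only [quartic_symbolCoef] at a0 a1 a2 a3
  have hp : p * (starRingEnd ℂ) p = ((‖p‖ ^ 2 : ℝ) : ℂ) := by
    rw [Complex.mul_conj, Complex.normSq_eq_norm_sq]
  have hs : p + (starRingEnd ℂ) p = ((2 * p.re : ℝ) : ℂ) := Complex.add_conj p
  have pn : p ≠ 0 := h.root_ne_zero (z := Z) (by rw [hq]; simp)
  have pn2 : (‖p‖ ^ 2 : ℝ) ≠ 0 := pow_ne_zero _ (norm_ne_zero_iff.2 pn)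
  generalize (starRingEnd ℂ) p = p' at *
  have v0 : a + b + (2 * p.re : ℝ) = Z - d 0 := by
    rw [← hs]; linear_combination a0 / 2 - a1 / 2 - a2 / 6 + a3 / 6
  have v1 : a * b + (‖p‖ ^ 2 : ℝ) + (2 * p.re : ℝ) * (a + b) = d 1 := by
    rw [← hs, ← hp]; linear_combination a0 - a1 / 2 - a2 / 2
  have v2 : (2 * p.re : ℝ) * (a * b) + (‖p‖ ^ 2 : ℝ) * (a + b) = -d 2 := by
    rw [← hs, ← hp]; linear_combination -a0 / 2 + a1  - a2 / 3 - a3 / 6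
  have v3 : (‖p‖ ^ 2 : ℝ) * (a * b) = d 3 := by
    rw [← hp]; linear_combination -a0
  have eA : a + b = ((Z - d 0 - 2 * p.re : ℝ) : ℂ) := by push_cast; push_cast at v0; linear_combination v0
  have eB : a * b = ((d 3 / ‖p‖ ^ 2 : ℝ) : ℂ) := by
    rw [Complex.ofReal_div, eq_div_iff (by exact_mod_cast pn2), ← v3]; ring
  rw [eA, eB] at v1 v2
  rw [eB] at v3
  refine ⟨_, _, eA, eB, by ring, ?_, ?_, ?_⟩
  · exact_mod_cast v1
  · exact_mod_cast v2
  · exact_mod_cast v3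

/-- The key exclusion. A pair `p`, `conj p` of roots of modulus `r`, with remaining roots `a`, `b`,
is impossible if `Z` and `(r + a) (r + b)` do not have the same strict sign: the value at `-r` of
`∏ (W + ζᵢ)` is then at least `|Z| r³` in modulus, so that `-r` is a double root, and the sums of
the numbers `uᵢ = r / (ζᵢ - r)` and of their squares contradict `uᵢ (uᵢ + 1) > 0`. -/
theorem not_pair (h : NegZeros d ζ) {Z : ℝ} (hZ : Z ≠ 0) {p : ℂ} {a b : ℂ}
    (hq : ∀ W, quartic (symbolCoef d Z) W = (W - p) * (W - (starRingEnd ℂ) p) * (W - a) * (W - b))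
    (hG : Z * ((‖p‖ + a) * (‖p‖ + b)).re ≤ 0) : False := by
  obtain ⟨A, B, hA, hB, v0, v1, v2, v3⟩ := h.vieta_of_conj hq
  have pr : quartic (symbolCoef d Z) p = 0 := by rw [hq]; simp
  have pn : p ≠ 0 := h.root_ne_zero pr
  set r := ‖p‖ with hr
  have r0 : 0 < r := norm_pos_iff.2 pn
  set G := r ^ 2 + r * A + B with hGd
  have hG' : Z * G ≤ 0 := by
    have : ((r : ℂ) + a) * (r + b) = (G : ℝ) := by
      rw [hGd]; push_cast; rw [← hA, ← hB]; ring
    rw [this, Complex.ofReal_re] at hG; exact hG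
  set c := p.re with hc
  have hcr : -r ≤ c := (abs_le.1 (Complex.abs_re_le_norm p)).1
  -- the value of the unperturbed product at `-r`
  have hprod : (ζ 0 - r) * (ζ 1 - r) * (ζ 2 - r) * (ζ 3 - r)
      = 2 * r * (r + c) * G - Z * r ^ 3 := by
    rw [hGd]
    linear_combination -h.c3 + r * h.c2 - r ^ 2 * h.c1 + r ^ 3 * h.c0 - v3 - r * v2 - r ^ 2 * v1 - r ^ 3 * v0
  have hcr' : c = -r := by
    by_contra hne
    have hlt : -r < c := lt_of_le_of_ne hcr (Ne.symm hne)
    have k := h.norm_prod_lt (W := ((-r : ℝ) : ℂ)) (W' := p)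
      (by rw [Complex.norm_real, Real.norm_eq_abs, abs_neg, abs_of_pos r0]) (by simpa using hlt)
    rw [h.prod_eq pr] at k
    have e1 : (((-r : ℝ) : ℂ) + ζ 0) * ((-r : ℝ) + ζ 1) * ((-r : ℝ) + ζ 2) * ((-r : ℝ) + ζ 3)
        = (((ζ 0 - r) * (ζ 1 - r) * (ζ 2 - r) * (ζ 3 - r) : ℝ) : ℂ) := by push_cast; ring
    rw [e1, hprod, Complex.norm_real, norm_mul, norm_pow, Complex.norm_real, ← hr,
      Real.norm_eq_abs, Real.norm_eq_abs, ← abs_of_pos (pow_pos r0 3), ← abs_mul] at k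
    rw [abs_of_pos (pow_pos r0 3)] at k
    have k2 := sq_lt_sq.2 k
    have m0 : 0 < 2 * r * (r + c) := by have : 0 < r + c := by linarith
                                        positivity
    have m1 := mul_nonneg (mul_nonneg m0.le (neg_nonneg.2 hG')) (pow_pos r0 3).le
    linarith [sq_nonneg (2 * r * (r + c) * G)]
  rw [hcr'] at hprod v0 v1 v2
  have x0 : (ζ 0 - r) * (ζ 1 - r) * (ζ 2 - r) * (ζ 3 - r) = - Z * r ^ 3 := by rw [hprod]; ring
  have xne : (ζ 0 - r) * (ζ 1 - r) * (ζ 2 - r) * (ζ 3 - r) ≠ 0 := by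
    rw [x0]; exact mul_ne_zero (neg_ne_zero.2 hZ) (pow_ne_zero _ r0.ne')
  have x1 : (ζ 0 - r) * (ζ 1 - r) * (ζ 2 - r) + (ζ 0 - r) * (ζ 1 - r) * (ζ 3 - r) +
      (ζ 0 - r) * (ζ 2 - r) * (ζ 3 - r) + (ζ 1 - r) * (ζ 2 - r) * (ζ 3 - r) = 3 * Z * r ^ 2 := by
    linear_combination -h.c2 + 2 * r * h.c1 - 3 * r ^ 2 * h.c0 + v2 + 2 * r * v1 + 3 * r ^ 2 * v0
  have x2 : (ζ 0 - r) * (ζ 1 - r) + (ζ 0 - r) * (ζ 2 - r) + (ζ 0 - r) * (ζ 3 - r) +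
      (ζ 1 - r) * (ζ 2 - r) + (ζ 1 - r) * (ζ 3 - r) + (ζ 2 - r) * (ζ 3 - r)
      = - 3 * Z * r + G := by
    rw [hGd]; linear_combination -h.c1 + 3 * r * h.c0 - v1 - 3 * r * v0
  have n3 := right_ne_zero_of_mul xne
  have n2 := right_ne_zero_of_mul (left_ne_zero_of_mul xne)
  have n1 := right_ne_zero_of_mul (left_ne_zero_of_mul (left_ne_zero_of_mul xne))
  have n0 := left_ne_zero_of_mul (left_ne_zero_of_mul (left_ne_zero_of_mul xne))
  have hu : ∀ i, ζ i - r ≠ 0 → 0 < (r / (ζ i - r)) ^ 2 + r / (ζ i - r) := by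
    intro i hi
    have : (r / (ζ i - r)) ^ 2 + r / (ζ i - r) = r * ζ i / (ζ i - r) ^ 2 := by field_simp; ring
    rw [this]
    have := h.pos i
    have := sq_pos_of_ne_zero hi
    positivity
  have u0 := hu 0 n0
  have u1 := hu 1 n1
  have u2 := hu 2 n2
  have u3 := hu 3 n3
  have s1 : r / (ζ 0 - r) + r / (ζ 1 - r) + r / (ζ 2 - r) + r / (ζ 3 - r) = -3 := by
    have : (r / (ζ 0 - r) + r / (ζ 1 - r) + r / (ζ 2 - r) + r / (ζ 3 - r)) *
      ((ζ 0 - r) * (ζ 1 - r) * (ζ 2 - r) * (ζ 3 - r)) = r * (3 * Z * r ^ 2) := by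
      rw [← x1]; field_simp; ring
    rw [x0] at this
    have : (r / (ζ 0 - r) + r / (ζ 1 - r) + r / (ζ 2 - r) + r / (ζ 3 - r) + 3) * (-Z * r ^ 3) = 0 := by
      linear_combination this
    have := (mul_eq_zero.1 this).resolve_right (by rw [← x0]; exact xne)
    linarith
  have s2 : (r / (ζ 0 - r)) * (r / (ζ 1 - r)) + (r / (ζ 0 - r)) * (r / (ζ 2 - r)) +
      (r / (ζ 0 - r)) * (r / (ζ 3 - r)) + (r / (ζ 1 - r)) * (r / (ζ 2 - r)) +
      (r / (ζ 1 - r)) * (r / (ζ 3 - r)) + (r / (ζ 2 - r)) * (r / (ζ 3 - r)) =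
      3 + (-Z * G) / (Z ^ 2 * r) := by
    have e : (r / (ζ 0 - r)) * (r / (ζ 1 - r)) + (r / (ζ 0 - r)) * (r / (ζ 2 - r)) +
      (r / (ζ 0 - r)) * (r / (ζ 3 - r)) + (r / (ζ 1 - r)) * (r / (ζ 2 - r)) +
      (r / (ζ 1 - r)) * (r / (ζ 3 - r)) + (r / (ζ 2 - r)) * (r / (ζ 3 - r)) =
      r ^ 2 * (-3 * Z * r + G) / ((ζ 0 - r) * (ζ 1 - r) * (ζ 2 - r) * (ζ 3 - r)) := by
      rw [← x2]; field_simp; ring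
    rw [e, x0]; field_simp; ring
  have : 0 ≤ (-Z * G) / (Z ^ 2 * r) := div_nonneg (by linarith) (by positivity)
  nlinarith [congrArg (· ^ 2) s1]

end NegZeros
end TwoMatrix

namespace TwoMatrix
namespace NegZeros

variable {d ζ : Fin 4 → ℝ}

theorem symbolEuler_ne_zero_of_im (h : NegZeros d ζ) {z W : ℂ}
    (hr : quartic (symbolCoef d z) W = 0) (hi : W.im ≠ 0) : symbolEuler d W ≠ 0 :=
  fun h0 => hi (h.im_eq_zero_of_symbolEuler hr h0)

theorem eq_conj_of_norm_eq (h : NegZeros d ζ) {z : ℂ} {ρ : Fin 4 → ℂ}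
    (hρ : IsSortedRoots (symbolCoef d z) ρ) {i j : Fin 4} (hij : i ≠ j) (hn : ‖ρ i‖ = ‖ρ j‖) :
    ρ j = (starRingEnd ℂ) (ρ i) := by
  rcases h.eq_or_conj (hρ.root i) (hρ.root j) hn with he | he
  · have := h.im_eq_zero_of_symbolEuler (hρ.root j)
      (symbolEuler_eq_zero_of_eq hρ hij (h.root_ne_zero (hρ.root j)) he.symm)
    rw [← he, Complex.conj_eq_iff_im.2 this]
  · exact he

/-- Of two real numbers given by a real sum and product, or a conjugate pair. -/
theorem real_or_conj {a b : ℂ} {A B : ℝ} (hA : a + b = A) (hB : a * b = B) :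
    (a.im = 0 ∧ b.im = 0) ∨ b = (starRingEnd ℂ) a := by
  have e1 := congrArg Complex.im hA
  have e2 := congrArg Complex.im hB
  simp at e1 e2
  have hb : b.im = -a.im := by linarith
  by_cases ha : a.im = 0
  · left; exact ⟨ha, by rw [hb, ha, neg_zero]⟩
  · right
    rw [hb] at e2
    have : a.im * (b.re - a.re) = 0 := by linarith
    have := (mul_eq_zero.1 this).resolve_left ha
    exact Complex.ext (by simp; linarith) (by simp [hb])

/-- For positive `Z`, the two middle moduli differ. -/
theorem norm_two_lt_one (h : NegZeros d ζ) {Z : ℝ} (hZ : 0 < Z) {ρ : Fin 4 → ℂ}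
    (hρ : IsSortedRoots (symbolCoef d Z) ρ) : ‖ρ 2‖ < ‖ρ 1‖ := by
  refine lt_of_le_of_ne hρ.le21 fun hn => ?_
  have hc := h.eq_conj_of_norm_eq hρ (i := 1) (j := 2) (by decide) hn.symm
  have hq : ∀ W, quartic (symbolCoef d Z) W =
      (W - ρ 1) * (W - (starRingEnd ℂ) (ρ 1)) * (W - ρ 0) * (W - ρ 3) := by
    intro W; rw [hρ.quartic_eq, ← hc]; ring
  obtain ⟨A, B, hA, hB, v0, v1, v2, v3⟩ := h.vieta_of_conj hq
  have r0 : 0 < ‖ρ 1‖ := norm_pos_iff.2 (h.root_ne_zero (hρ.root 1))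
  -- the outer and inner roots are real
  have hreal : (ρ 0).im = 0 ∧ (ρ 3).im = 0 := by
    rcases real_or_conj hA hB with h1 | h1
    · exact h1
    · have e : ‖ρ 0‖ = ‖ρ 3‖ := by rw [h1, Complex.norm_conj]
      have e1 : ‖ρ 0‖ = ‖ρ 1‖ := le_antisymm (e.le.trans (hρ.le32.trans hρ.le21)) hρ.le10
      rcases h.eq_or_conj (hρ.root 1) (hρ.root 0) e1.symm with h2 | h2
      · have i0 := h.im_eq_zero_of_symbolEuler (hρ.root 0)
          (symbolEuler_eq_zero_of_eq hρ (i := 1) (by decide) (h.root_ne_zero (hρ.root 0)) h2.symm)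
        exact ⟨i0, by rw [h1]; simpa using i0⟩
      · have i0 := h.im_eq_zero_of_symbolEuler (hρ.root 0)
          (symbolEuler_eq_zero_of_eq hρ (i := 2) (by decide) (h.root_ne_zero (hρ.root 0))
            (by rw [hc, h2]))
        exact ⟨i0, by rw [h1]; simpa using i0⟩
  obtain ⟨x, hx⟩ : ∃ x : ℝ, ρ 0 = x := ⟨(ρ 0).re, Complex.ext (by simp) (by simpa using hreal.1)⟩
  obtain ⟨y, hy⟩ : ∃ y : ℝ, ρ 3 = y := ⟨(ρ 3).re, Complex.ext (by simp) (by simpa using hreal.2)⟩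
  have hxr : ‖ρ 1‖ ≤ |x| := by have := hρ.le10; rwa [hx, Complex.norm_real] at this
  have hyr : |y| ≤ ‖ρ 1‖ := by
    have := hρ.le32.trans hρ.le21; rwa [hy, Complex.norm_real] at this
  rw [hx, hy] at hA hB
  have hA' : x + y = A := by exact_mod_cast hA
  have hB' : x * y = B := by exact_mod_cast hB
  have d1 := h.d1_pos
  have d2 := h.d2_pos
  have d3 := h.d3_pos
  set r := ‖ρ 1‖ with hr
  set c := (ρ 1).re with hcdef
  have hB0 : 0 < x * y := by
    rw [hB']; by_contra! hle
    have : r ^ 2 * B ≤ 0 := mul_nonpos_of_nonneg_of_nonpos (by positivity) hle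
    linarith
  rcases lt_or_ge x 0 with hx0 | hx0
  · -- both negative
    have hy0 : y < 0 := by by_contra! hy0; nlinarith
    refine h.not_pair hZ.ne' hq (mul_nonpos_of_nonneg_of_nonpos hZ.le ?_)
    rw [hx, hy]
    rw [abs_of_neg hx0] at hxr
    rw [abs_of_neg hy0] at hyr
    have : ((r : ℂ) + x) * (r + y) = (((r + x) * (r + y) : ℝ) : ℂ) := by push_cast; ring
    rw [this, Complex.ofReal_re]
    exact mul_nonpos_of_nonpos_of_nonneg (by linarith) (by linarith)
  · -- both positive
    have hx0' : 0 < x := lt_of_le_of_ne hx0 (by rintro rfl; simp at hB0)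
    have hy0 : 0 < y := by by_contra! hy0; nlinarith
    rw [abs_of_pos hx0'] at hxr
    rw [abs_of_pos hy0] at hyr
    subst hA' hB'
    have D0 : 0 < x * y := hB0
    have S0 : 0 < x + y := by positivity
    have k1 : r ^ 2 * (x + y) < -(2 * c) * (x * y) := by linarith
    have k2 : -(2 * c) * (x + y) < x * y + r ^ 2 := by linarith
    have k3 : (r ^ 2 * (x + y)) * (x + y) < (x * y + r ^ 2) * (x * y) := by
      calc _ < -(2 * c) * (x * y) * (x + y) := mul_lt_mul_of_pos_right k1 S0
        _ = -(2 * c) * (x + y) * (x * y) := by ring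
        _ < _ := mul_lt_mul_of_pos_right k2 D0
    have k4 : (x * y) ^ 2 ≤ x ^ 2 * r ^ 2 := by
      rw [mul_pow]; exact mul_le_mul_of_nonneg_left (pow_le_pow_left₀ hy0.le hyr 2) (sq_nonneg x)
    nlinarith [mul_pos D0 (pow_pos r0 2), sq_nonneg (r * y)]

/-- For negative `Z`, the largest modulus is attained only once. -/
theorem norm_one_lt_zero (h : NegZeros d ζ) {Z : ℝ} (hZ : Z < 0) {ρ : Fin 4 → ℂ}
    (hρ : IsSortedRoots (symbolCoef d Z) ρ) : ‖ρ 1‖ < ‖ρ 0‖ := by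
  refine lt_of_le_of_ne hρ.le10 fun hn => ?_
  have hc := h.eq_conj_of_norm_eq hρ (i := 0) (j := 1) (by decide) hn.symm
  have hq : ∀ W, quartic (symbolCoef d Z) W =
      (W - ρ 0) * (W - (starRingEnd ℂ) (ρ 0)) * (W - ρ 2) * (W - ρ 3) := by
    intro W; rw [hρ.quartic_eq, ← hc]
  obtain ⟨A, B, hA, hB, -⟩ := h.vieta_of_conj hq
  refine h.not_pair hZ.ne hq (mul_nonpos_of_nonpos_of_nonneg hZ.le ?_)
  have h2 := hρ.norm_antitone (show (0 : Fin 4) ≤ 2 by decide)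
  have h3 := hρ.norm_antitone (show (0 : Fin 4) ≤ 3 by decide)
  rcases real_or_conj hA hB with ⟨i2, i3⟩ | h1
  · simp [i2, i3]
    exact mul_nonneg (by linarith [(abs_le.1 (Complex.abs_re_le_norm (ρ 2))).1])
      (by linarith [(abs_le.1 (Complex.abs_re_le_norm (ρ 3))).1])
  · rw [h1]; simp; nlinarith [sq_nonneg (ρ 2).im, sq_nonneg (‖ρ 0‖ + (ρ 2).re)]

/-- For negative `Z`, the smallest modulus is attained only once. -/
theorem norm_three_lt_two (h : NegZeros d ζ) {Z : ℝ} (hZ : Z < 0) {ρ : Fin 4 → ℂ}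
    (hρ : IsSortedRoots (symbolCoef d Z) ρ) : ‖ρ 3‖ < ‖ρ 2‖ := by
  refine lt_of_le_of_ne hρ.le32 fun hn => ?_
  have hc := h.eq_conj_of_norm_eq hρ (i := 2) (j := 3) (by decide) hn.symm
  have hq : ∀ W, quartic (symbolCoef d Z) W =
      (W - ρ 2) * (W - (starRingEnd ℂ) (ρ 2)) * (W - ρ 0) * (W - ρ 1) := by
    intro W; rw [hρ.quartic_eq, ← hc]; ring
  obtain ⟨A, B, hA, hB, -, -, -, v3⟩ := h.vieta_of_conj hq
  refine h.not_pair hZ.ne hq (mul_nonpos_of_nonpos_of_nonneg hZ.le ?_)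
  have h0 := hρ.norm_antitone (show (0 : Fin 4) ≤ 2 by decide)
  have h1 := hρ.le21
  have hB0 : 0 < B := by
    have d3 := h.d3_pos
    by_contra! hle
    have : ‖ρ 2‖ ^ 2 * B ≤ 0 := mul_nonpos_of_nonneg_of_nonpos (by positivity) hle
    linarith
  rcases real_or_conj hA hB with ⟨i0, i1⟩ | h1
  · have e := congrArg Complex.re hB
    have n0 : ‖ρ 0‖ = |(ρ 0).re| := ((Complex.abs_re_eq_norm).2 i0).symm
    have n1 : ‖ρ 1‖ = |(ρ 1).re| := ((Complex.abs_re_eq_norm).2 i1).symm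
    rw [n0] at h0
    rw [n1] at h1
    simp [i0, i1] at e ⊢
    have r0 := norm_nonneg (ρ 2)
    rcases lt_or_ge (ρ 0).re 0 with hx0 | hx0
    · have hy0 : (ρ 1).re < 0 := by by_contra! hy0; nlinarith
      rw [abs_of_neg hx0] at h0
      rw [abs_of_neg hy0] at h1
      exact mul_nonneg_of_nonpos_of_nonpos (by linarith) (by linarith)
    · have hy0 : 0 ≤ (ρ 1).re := by by_contra! hy0; nlinarith
      positivity
  · rw [h1]; simp; nlinarith [sq_nonneg (ρ 0).im, sq_nonneg (‖ρ 2‖ + (ρ 0).re)]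

/-- The two middle moduli agree only for real non-positive values of the symbol. -/
theorem real_nonpos_of_norm_eq (h : NegZeros d ζ) {z : ℂ} {ρ : Fin 4 → ℂ}
    (hρ : IsSortedRoots (symbolCoef d z) ρ) (hn : ‖ρ 1‖ = ‖ρ 2‖) : z.im = 0 ∧ z.re ≤ 0 := by
  have hc := h.eq_conj_of_norm_eq hρ (i := 1) (j := 2) (by decide) hn
  have e1 := h.prod_eq (hρ.root 1)
  have e2 := h.prod_eq (hρ.root 2)
  have hz : (starRingEnd ℂ) z = z := by
    have e3 := congrArg (starRingEnd ℂ) e1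
    simp only [map_mul, map_add, map_pow, Complex.conj_ofReal, ← hc] at e3
    rw [e3] at e2
    exact mul_right_cancel₀ (pow_ne_zero 3 (h.root_ne_zero (hρ.root 2))) e2
  have hi := Complex.conj_eq_iff_im.1 hz
  refine ⟨hi, ?_⟩
  by_contra! hpos
  have : z = (z.re : ℂ) := Complex.ext (by simp) (by simpa using hi)
  rw [this] at hρ
  exact (h.norm_two_lt_one hpos hρ).ne hn.symm

end NegZeros
end TwoMatrix

namespace TwoMatrix

/-! ### A common form of the two symbols -/

/-- The sum `a₀ + a₁` in the two-cut case, and `2 a` in the one-cut case. -/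
noncomputable def aSum (t τ ξ : ℝ) : ℝ := max (τ ^ 2 - t) (2 * aOne t τ ξ)

/-- The product `a₀ a₁` in the two-cut case, and `a²` in the one-cut case. -/
noncomputable def aProd (t τ ξ : ℝ) : ℝ := min ξ (aOne t τ ξ ^ 2)

/-- The coefficients of the symbol in the variable `W = w²`, as a function of `Z = z²`. In the
two-cut case this is the doubled symbol, in the one-cut case the square of `s₁`. -/
noncomputable def coef (t τ ξ : ℝ) : Fin 4 → ℝ :=
  ![aSum t τ ξ ^ 2 + 2 * aProd t τ ξ + t * aSum t τ ξ,
    τ ^ 2 * aProd t τ ξ * aSum t τ ξ + aProd t τ ξ *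
      (2 * aSum t τ ξ ^ 2 + aProd t τ ξ + 3 * t * aSum t τ ξ + t ^ 2),
    τ ^ 2 * aProd t τ ξ ^ 2 * (3 * aSum t τ ξ + 2 * t),
    τ ^ 4 * aProd t τ ξ ^ 3]

variable {t τ ξ : ℝ}

theorem aOne_pos (t τ : ℝ) (hξ : 0 < ξ) : 0 < aOne t τ ξ := by
  have : |τ ^ 2 - t| < √((τ ^ 2 - t) ^ 2 + 12 * ξ) := by
    rw [← Real.sqrt_sq_eq_abs]
    exact Real.sqrt_lt_sqrt (sq_nonneg _) (by linarith)
  rw [aOne]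
  linarith [neg_abs_le (τ ^ 2 - t)]

theorem aOne_eq (t τ : ℝ) (hξ : 0 ≤ ξ) :
    3 * aOne t τ ξ ^ 2 - (τ ^ 2 - t) * aOne t τ ξ = ξ := by
  have : √((τ ^ 2 - t) ^ 2 + 12 * ξ) ^ 2 = (τ ^ 2 - t) ^ 2 + 12 * ξ :=
    Real.sq_sqrt (by positivity)
  rw [aOne]
  linear_combination this / 12

theorem xiCr_nonneg (t τ : ℝ) : 0 ≤ xiCr t τ := by
  unfold xiCr; split_ifs <;> positivity

theorem continuous_aOne (t τ : ℝ) : Continuous (aOne t τ) := by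
  unfold aOne; fun_prop

theorem continuous_aSum (t τ : ℝ) : Continuous (aSum t τ) := by
  have := continuous_aOne t τ
  unfold aSum; fun_prop

theorem continuous_aProd (t τ : ℝ) : Continuous (aProd t τ) := by
  have := continuous_aOne t τ
  unfold aProd; fun_prop

theorem continuous_coef (t τ : ℝ) : Continuous (coef t τ) := by
  have := continuous_aSum t τ
  have := continuous_aProd t τ
  refine continuous_pi fun i => ?_
  fin_cases i <;> simp [coef] <;> fun_prop

theorem lt_of_lt_xiCr (hξ : 0 < ξ) (h : ξ < xiCr t τ) :
    t < τ ^ 2 ∧ 4 * ξ < (τ ^ 2 - t) ^ 2 := by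
  unfold xiCr at h
  split_ifs at h with h1
  · exact ⟨h1, by linarith⟩
  · linarith

theorem two_cut_a_lt (hξ : 0 < ξ) (h : ξ < xiCr t τ) : 2 * aOne t τ ξ < τ ^ 2 - t := by
  obtain ⟨h1, h2⟩ := lt_of_lt_xiCr hξ h
  have e := aOne_eq t τ hξ.le
  have ha := aOne_pos t τ hξ
  by_contra! hle
  nlinarith

theorem one_cut_le_a (hξ : 0 < ξ) (h : xiCr t τ ≤ ξ) : τ ^ 2 - t ≤ 2 * aOne t τ ξ := by
  have e := aOne_eq t τ hξ.le
  have ha := aOne_pos t τ hξ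
  unfold xiCr at h
  split_ifs at h with h1
  · by_contra! hlt
    nlinarith
  · linarith

theorem two_cut_aSum (hξ : 0 < ξ) (h : ξ < xiCr t τ) : aSum t τ ξ = τ ^ 2 - t :=
  max_eq_left (two_cut_a_lt hξ h).le

theorem two_cut_aProd (hξ : 0 < ξ) (h : ξ < xiCr t τ) : aProd t τ ξ = ξ := by
  refine min_eq_left ?_
  have := two_cut_a_lt hξ h
  nlinarith [aOne_eq t τ hξ.le, aOne_pos t τ hξ]

theorem one_cut_aSum (hξ : 0 < ξ) (h : xiCr t τ ≤ ξ) : aSum t τ ξ = 2 * aOne t τ ξ :=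
  max_eq_right (one_cut_le_a hξ h)

theorem one_cut_aProd (hξ : 0 < ξ) (h : xiCr t τ ≤ ξ) : aProd t τ ξ = aOne t τ ξ ^ 2 := by
  refine min_eq_right ?_
  have := one_cut_le_a hξ h
  nlinarith [aOne_eq t τ hξ.le, aOne_pos t τ hξ]

theorem aProd_pos (t τ : ℝ) (hξ : 0 < ξ) : 0 < aProd t τ ξ :=
  lt_min hξ (pow_pos (aOne_pos t τ hξ) 2)

theorem two_cut_sum (t τ ξ : ℝ) : aEven t τ ξ + aOdd t τ ξ = τ ^ 2 - t := by
  rw [aEven, aOdd]; ring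

theorem two_cut_prod (hξ : 0 < ξ) (h : ξ < xiCr t τ) : aEven t τ ξ * aOdd t τ ξ = ξ := by
  have : √((τ ^ 2 - t) ^ 2 - 4 * ξ) ^ 2 = (τ ^ 2 - t) ^ 2 - 4 * ξ :=
    Real.sq_sqrt (by linarith [(lt_of_lt_xiCr hξ h).2])
  rw [aEven, aOdd]
  linear_combination -this / 4

theorem two_cut_pos (hξ : 0 < ξ) (h : ξ < xiCr t τ) : 0 < aEven t τ ξ ∧ 0 < aOdd t τ ξ := by
  have h1 := two_cut_sum t τ ξ
  have h2 := two_cut_prod hξ h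
  have h3 := (lt_of_lt_xiCr hξ h).1
  have h4 : 0 < aOdd t τ ξ := by
    rw [aOdd]; have := Real.sqrt_nonneg ((τ ^ 2 - t) ^ 2 - 4 * ξ); linarith
  refine ⟨?_, h4⟩
  by_contra! hle
  nlinarith

theorem symbolTwo_eq_coef (hξ : 0 < ξ) (h : ξ < xiCr t τ) : symbolTwo t τ ξ = coef t τ ξ := by
  have h1 := two_cut_sum t τ ξ
  have h2 := two_cut_prod hξ h
  have e1 : aSum t τ ξ = aEven t τ ξ + aOdd t τ ξ := by rw [two_cut_aSum hξ h, h1]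
  have e2 : aProd t τ ξ = aEven t τ ξ * aOdd t τ ξ := by rw [two_cut_aProd hξ h, h2]
  funext i
  fin_cases i <;> simp [symbolTwo, coef, e1, e2, bEven, bOdd, cEven, cOdd] <;> ring

theorem coef_two_cut (hξ : 0 < ξ) (h : ξ < xiCr t τ) : coef t τ ξ =
    ![2 * ξ + τ ^ 2 * (τ ^ 2 - t), ξ ^ 2 + 2 * (τ ^ 2 * (τ ^ 2 - t)) * ξ + τ ^ 4 * ξ,
      τ ^ 2 * (τ ^ 2 - t) * ξ ^ 2 + 2 * τ ^ 4 * ξ ^ 2, τ ^ 4 * ξ ^ 3] := by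
  funext i
  fin_cases i <;> simp [coef, two_cut_aSum hξ h, two_cut_aProd hξ h] <;> ring

theorem coef_one_cut (hξ : 0 < ξ) (h : xiCr t τ ≤ ξ) : coef t τ ξ =
    ![2 * bOne t τ ξ, bOne t τ ξ ^ 2 + 2 * cOne t τ ξ, 2 * bOne t τ ξ * cOne t τ ξ,
      cOne t τ ξ ^ 2] := by
  funext i
  fin_cases i <;> simp [coef, one_cut_aSum hξ h, one_cut_aProd hξ h, bOne, cOne] <;> ring

theorem bOne_eq (t τ : ℝ) (hξ : 0 ≤ ξ) : bOne t τ ξ = ξ + τ ^ 2 * aOne t τ ξ := by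
  rw [bOne]; linear_combination aOne_eq t τ hξ

/-- For every `ξ > 0`, the symbol has four negative zeros in the variable `W`. -/
theorem exists_negZeros (hτ : 0 < τ) (hξ : 0 < ξ) : ∃ ζ, NegZeros (coef t τ ξ) ζ := by
  rcases lt_or_ge ξ (xiCr t τ) with h | h
  · have h1 := two_cut_sum t τ ξ
    have h2 := two_cut_prod hξ h
    obtain ⟨p0, p1⟩ := two_cut_pos hξ h
    refine ⟨![ξ, ξ, τ ^ 2 * aEven t τ ξ, τ ^ 2 * aOdd t τ ξ], ?_, ?_, ?_, ?_, ?_⟩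
    · intro i; fin_cases i <;> simp <;> positivity
    all_goals rw [coef_two_cut hξ h]; simp [← h1]
    · ring
    · linear_combination (-τ ^ 4) * h2
    · linear_combination (-2 * τ ^ 4 * ξ) * h2
    · linear_combination (-ξ ^ 2 * τ ^ 4) * h2
  · have ha := aOne_pos t τ hξ
    have e := aOne_eq t τ hξ.le
    have hb := bOne_eq t τ hξ.le
    have hb0 : 0 < bOne t τ ξ := by rw [hb]; positivity
    have hc0 : 0 < cOne t τ ξ := by rw [cOne]; positivity
    have hle := one_cut_le_a hξ h
    have hdisc : 0 ≤ bOne t τ ξ ^ 2 - 4 * cOne t τ ξ := by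
      rw [bOne, cOne]
      have h1 : aOne t τ ξ + τ ^ 2 ≤ 3 * aOne t τ ξ + t := by linarith
      have h2 : (aOne t τ ξ + τ ^ 2) ^ 2 ≤ (3 * aOne t τ ξ + t) ^ 2 :=
        pow_le_pow_left₀ (by positivity) h1 2
      have h3 : 0 ≤ (3 * aOne t τ ξ + t) ^ 2 - 4 * τ ^ 2 * aOne t τ ξ := by
        nlinarith [sq_nonneg (aOne t τ ξ - τ ^ 2)]
      have := mul_nonneg (sq_nonneg (aOne t τ ξ)) h3
      linarith
    set D := √(bOne t τ ξ ^ 2 - 4 * cOne t τ ξ) with hD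
    have hD2 : D ^ 2 = bOne t τ ξ ^ 2 - 4 * cOne t τ ξ := Real.sq_sqrt hdisc
    have hDb : D < bOne t τ ξ := by
      rw [hD, Real.sqrt_lt' hb0]; linarith
    have hD0 : 0 ≤ D := Real.sqrt_nonneg _
    refine ⟨![(bOne t τ ξ - D) / 2, (bOne t τ ξ - D) / 2, (bOne t τ ξ + D) / 2,
      (bOne t τ ξ + D) / 2], ?_, ?_, ?_, ?_, ?_⟩
    · intro i; fin_cases i <;> simp <;> linarith
    all_goals rw [coef_one_cut hξ h]; simp
    · ring
    · linear_combination hD2 / 2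
    · linear_combination bOne t τ ξ / 2 * hD2
    · have : cOne t τ ξ = (bOne t τ ξ - D) / 2 * ((bOne t τ ξ + D) / 2) := by
        linear_combination hD2 / 4
      rw [this]; ring

/-- In the one-cut case, the squares of the solutions of `s₁(w) = z` are the solutions of the
common equation at `Z = z²`. -/
theorem isSortedRoots_sq (hξ : 0 < ξ) (h : xiCr t τ ≤ ξ) (z : ℂ) :
    IsSortedRoots (symbolCoef (coef t τ ξ) (z ^ 2))
      (fun i => symbolRoots (symbolOne t τ ξ) z i ^ 2) := by
  have hs := isSortedRoots_symbolRoots (symbolOne t τ ξ) z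
  set w := symbolRoots (symbolOne t τ ξ) z
  have m : ∀ {a b : ℂ}, ‖a‖ ≤ ‖b‖ → ‖a ^ 2‖ ≤ ‖b ^ 2‖ := by
    intro a b hab
    rw [norm_pow, norm_pow]
    exact pow_le_pow_left₀ (norm_nonneg _) hab 2
  refine isSortedRoots_of_quartic_eq (fun W => ?_) (m hs.le10) (m hs.le21) (m hs.le32)
  obtain ⟨u, rfl⟩ : ∃ u : ℂ, u ^ 2 = W := ⟨W ^ (1 / 2 : ℂ), by
    rw [← Complex.cpow_nat_mul]; norm_num⟩
  have e1 := hs.quartic_eq u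
  have e2 := hs.quartic_eq (-u)
  rw [quartic_symbolCoef] at e1 e2 ⊢
  rw [coef_one_cut hξ h]
  simp [symbolOne] at e1 e2 ⊢
  have : (u ^ 2 - w 0 ^ 2) * (u ^ 2 - w 1 ^ 2) * (u ^ 2 - w 2 ^ 2) * (u ^ 2 - w 3 ^ 2) =
    ((u - w 0) * (u - w 1) * (u - w 2) * (u - w 3)) *
      ((-u - w 0) * (-u - w 1) * (-u - w 2) * (-u - w 3)) := by ring
  rw [this, ← e1, ← e2]
  ring

theorem w_eq_two_cut (h : ξ < xiCr t τ) (hξ : 0 < ξ) (z : ℂ) (i : Fin 4) :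
    w t τ (i + 1) z ξ = symbolRoots (coef t τ ξ) (z ^ 2) i := by
  rw [w, if_pos h, symbolRoots, symbolTwo_eq_coef hξ h]

theorem w_eq_one_cut (h : xiCr t τ ≤ ξ) (z : ℂ) (i : Fin 4) :
    w t τ (i + 1) z ξ = symbolRoots (symbolOne t τ ξ) z i := by
  rw [w, if_neg h.not_gt, symbolRoots]

/-- In the one-cut case the squares of the roots of `s₁` at `z` are the roots of the common symbol
at `z²`, so that the moduli can be compared even though the numbering has ties. -/
theorem norm_w_sq_one_cut (h : xiCr t τ ≤ ξ) (hξ : 0 < ξ) (z : ℂ) (i : Fin 4) :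
    ‖w t τ (i + 1) z ξ‖ ^ 2 = ‖symbolRoots (coef t τ ξ) (z ^ 2) i‖ := by
  rw [w_eq_one_cut h, ← norm_pow]
  exact (isSortedRoots_sq hξ h z).norm_eq (isSortedRoots_symbolRoots _ _) i

theorem norm_w_eq_iff (hξ : 0 < ξ) (z : ℂ) (i j : Fin 4) :
    ‖w t τ (i + 1) z ξ‖ = ‖w t τ (j + 1) z ξ‖ ↔
      ‖symbolRoots (coef t τ ξ) (z ^ 2) i‖ = ‖symbolRoots (coef t τ ξ) (z ^ 2) j‖ := by
  rcases lt_or_ge ξ (xiCr t τ) with h | h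
  · rw [w_eq_two_cut h hξ, w_eq_two_cut h hξ]
  · rw [← norm_w_sq_one_cut h hξ, ← norm_w_sq_one_cut h hξ]
    exact (pow_left_inj₀ (norm_nonneg _) (norm_nonneg _) two_ne_zero).symm

theorem mem_Gamma_two_iff (hξ : 0 < ξ) (z : ℂ) : z ∈ Γ t τ 2 ξ ↔
    ‖symbolRoots (coef t τ ξ) (z ^ 2) 1‖ = ‖symbolRoots (coef t τ ξ) (z ^ 2) 2‖ :=
  norm_w_eq_iff (t := t) (τ := τ) hξ z 1 2

theorem Gamma_two_subset (hτ : 0 < τ) (hξ : 0 < ξ) {z : ℂ} (hz : z ∈ Γ t τ 2 ξ) : z.re = 0 := by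
  obtain ⟨ζ, hζ⟩ := exists_negZeros (t := t) hτ hξ
  obtain ⟨h1, h2⟩ := hζ.real_nonpos_of_norm_eq (isSortedRoots_symbolRoots _ _)
    ((mem_Gamma_two_iff hξ z).1 hz)
  simp [pow_two] at h1 h2
  by_contra hne
  have : z.im = 0 := by
    have : z.re * z.im = 0 := by linarith
    exact (mul_eq_zero.1 this).resolve_left hne
  rw [this] at h2
  have := mul_self_pos.2 hne
  linarith

end TwoMatrix

namespace TwoMatrix

/-! ### The roots as continuous functions of the parameters -/

/-- Reflection of the lower half plane onto the upper half plane. It removes the ambiguity in the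
order of two complex conjugate roots. -/
noncomputable def upper (W : ℂ) : ℂ := ⟨W.re, |W.im|⟩

theorem continuous_upper : Continuous upper := by
  have : upper = fun W : ℂ => (W.re : ℂ) + |W.im| * Complex.I := by
    funext W; apply Complex.ext <;> simp [upper]
  rw [this]
  fun_prop

theorem upper_eq (W : ℂ) : upper W = W ∨ upper W = (starRingEnd ℂ) W := by
  rcases le_total 0 W.im with h | h
  · left; apply Complex.ext <;> simp [upper, abs_of_nonneg h]
  · right; apply Complex.ext <;> simp [upper, abs_of_nonpos h]

theorem upper_conj (W : ℂ) : upper ((starRingEnd ℂ) W) = upper W := by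
  apply Complex.ext <;> simp [upper]

theorem norm_upper (W : ℂ) : ‖upper W‖ = ‖W‖ := by
  rcases upper_eq W with h | h <;> rw [h]
  exact Complex.norm_conj W

/-- The `j`-th root (in order of decreasing modulus) of the common equation for real `Z`, reflected
to the closed upper half plane. -/
noncomputable def upperRoot (t τ : ℝ) (j : Fin 4) (Z ξ : ℝ) : ℂ :=
  upper (symbolRoots (coef t τ ξ) Z j)

variable {t τ ξ Z : ℝ} {j : Fin 4}

theorem norm_upperRoot : ‖upperRoot t τ j Z ξ‖ = ‖symbolRoots (coef t τ ξ) Z j‖ := norm_upper _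

theorem upperRoot_im_nonneg : 0 ≤ (upperRoot t τ j Z ξ).im := abs_nonneg _

theorem upperRoot_root : quartic (symbolCoef (coef t τ ξ) Z) (upperRoot t τ j Z ξ) = 0 := by
  have h := (isSortedRoots_symbolRoots (coef t τ ξ) Z).root j
  rw [upperRoot]
  rcases upper_eq (symbolRoots (coef t τ ξ) Z j) with h1 | h1 <;> rw [h1]
  · exact h
  · exact quartic_symbolCoef_conj _ _ h

theorem upperRoot_ne_zero (hτ : 0 < τ) (hξ : 0 < ξ) : upperRoot t τ j Z ξ ≠ 0 := by
  obtain ⟨ζ, hζ⟩ := exists_negZeros (t := t) hτ hξ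
  exact hζ.root_ne_zero upperRoot_root

theorem continuous_symbolCoef : Continuous fun p : (Fin 4 → ℝ) × ℂ => symbolCoef p.1 p.2 := by
  refine continuous_pi fun i => ?_
  fin_cases i <;> simp [symbolCoef] <;> fun_prop

/-- The roots, normalized to the upper half plane, are jointly continuous. -/
theorem continuousAt_upperRoot (hτ : 0 < τ) {p : ℝ × ℝ} (hp : 0 < p.2) (j : Fin 4) :
    ContinuousAt (fun p : ℝ × ℝ => upperRoot t τ j p.1 p.2) p := by
  obtain ⟨ζ, hζ⟩ := exists_negZeros (t := t) hτ hp
  have hq : Continuous fun p : ℝ × ℝ => symbolCoef (coef t τ p.2) (p.1 : ℂ) :=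
    continuous_symbolCoef.comp (((continuous_coef t τ).comp continuous_snd).prodMk
      (Complex.continuous_ofReal.comp continuous_fst))
  rw [ContinuousAt, tendsto_iff_ultrafilter]
  intro U hU
  obtain ⟨ρ0, h0, hlim⟩ := exists_tendsto_sortedRoots U (hq.continuousAt.mono_left hU)
    (Eventually.of_forall fun p : ℝ × ℝ => isSortedRoots_symbolRoots (coef t τ p.2) (p.1 : ℂ))
  have h1 : upper (ρ0 j) = upperRoot t τ j p.1 p.2 := by
    rw [upperRoot]
    have hs := isSortedRoots_symbolRoots (coef t τ p.2) (p.1 : ℂ)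
    rcases hζ.eq_or_conj (hs.root j) (h0.root j) (hs.norm_eq h0 j) with h | h
    · rw [h]
    · rw [h, upper_conj]
  rw [← h1]
  exact (continuous_upper.tendsto _).comp (tendsto_pi_nhds.1 hlim j)

theorem continuousAt_upperRoot_right (hτ : 0 < τ) (hξ : 0 < ξ) (j : Fin 4) (Z : ℝ) :
    ContinuousAt (fun ξ => upperRoot t τ j Z ξ) ξ :=
  (continuousAt_upperRoot (p := (Z, ξ)) hτ hξ j).comp (f := fun ξ => (Z, ξ)) (by fun_prop)

/-! ### Derivatives with respect to the parameter -/

/-- The derivative of a continuous branch of simple roots of a family of quartics. -/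
theorem hasDerivAt_root {q : ℝ → Fin 4 → ℂ} {q' : Fin 4 → ℂ} {r : ℝ → ℂ} {x : ℝ}
    (hq : ∀ i, HasDerivAt (fun y => q y i) (q' i) x) (hr : ContinuousAt r x)
    (h0 : ∀ᶠ y in 𝓝 x, quartic (q y) (r y) = 0)
    (hne : 4 * r x ^ 3 + 3 * q x 0 * r x ^ 2 + 2 * q x 1 * r x + q x 2 ≠ 0) :
    HasDerivAt r (-(q' 0 * r x ^ 3 + q' 1 * r x ^ 2 + q' 2 * r x + q' 3) /
      (4 * r x ^ 3 + 3 * q x 0 * r x ^ 2 + 2 * q x 1 * r x + q x 2)) x := by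
  set W := r x with hW
  have hfix : HasDerivAt (fun y => quartic (q y) W)
      (q' 0 * W ^ 3 + q' 1 * W ^ 2 + q' 2 * W + q' 3) x := by
    have := ((((hq 0).mul_const (W ^ 3)).const_add (W ^ 4)).add ((hq 1).mul_const (W ^ 2))
      |>.add ((hq 2).mul_const W)).add (hq 3)
    exact this
  set D : ℝ → ℂ := fun y => (r y ^ 3 + r y ^ 2 * W + r y * W ^ 2 + W ^ 3) +
    q y 0 * (r y ^ 2 + r y * W + W ^ 2) + q y 1 * (r y + W) + q y 2 with hD
  have hDc : ContinuousAt D x := by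
    have := (hq 0).continuousAt
    have := (hq 1).continuousAt
    have := (hq 2).continuousAt
    fun_prop
  have hDx : D x = 4 * W ^ 3 + 3 * q x 0 * W ^ 2 + 2 * q x 1 * W + q x 2 := by
    simp only [hD, ← hW]; ring
  rw [hasDerivAt_iff_tendsto_slope] at hfix ⊢
  have hDx' : D x ≠ 0 := by rw [hDx]; exact hne
  have hlim := hfix.neg.div (hDc.tendsto.mono_left nhdsWithin_le_nhds) hDx'
  rw [← hDx, neg_div]
  rw [neg_div] at hlim
  refine hlim.congr' ?_
  filter_upwards [nhdsWithin_le_nhds h0, nhdsWithin_le_nhds (hDc.eventually_ne hDx')] with y hy hDy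
  have hx0 : quartic (q x) W = 0 := h0.self_of_nhds
  simp only [slope, vsub_eq_sub, hx0, sub_zero, ← hW, Pi.div_apply]
  rw [div_eq_iff hDy, smul_mul_assoc, ← smul_neg]
  congr 1
  simp only [hD, quartic] at hy ⊢
  linear_combination -hy

/-- The derivative of `coef` along a path on which `aSum` and `aProd` have derivatives `S'`
and `P'`. -/
noncomputable def coefDeriv (t τ S P S' P' : ℝ) : Fin 4 → ℝ :=
  ![2 * S * S' + 2 * P' + t * S',
    τ ^ 2 * (P' * S + P * S') + P' * (2 * S ^ 2 + P + 3 * t * S + t ^ 2) +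
      P * (4 * S * S' + P' + 3 * t * S'),
    τ ^ 2 * (2 * P * P' * (3 * S + 2 * t) + P ^ 2 * (3 * S')),
    τ ^ 4 * (3 * P ^ 2 * P')]

theorem hasDerivAt_coef {S' P' : ℝ} (hS : HasDerivAt (aSum t τ) S' ξ)
    (hP : HasDerivAt (aProd t τ) P' ξ) (i : Fin 4) :
    HasDerivAt (fun ξ => coef t τ ξ i) (coefDeriv t τ (aSum t τ ξ) (aProd t τ ξ) S' P' i) ξ := by
  fin_cases i <;> simp only [coef, coefDeriv]
  · exact (((hS.pow 2).add (hP.const_mul 2)).add (hS.const_mul t)).congr_deriv (by simp)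
  · exact ((((hP.const_mul (τ ^ 2)).mul hS).add (hP.mul (((((hS.pow 2).const_mul 2).add hP).add
      (hS.const_mul (3 * t))).add_const (t ^ 2))))).congr_deriv (by simp; ring)
  · exact (((hP.pow 2).const_mul (τ ^ 2)).mul ((hS.const_mul 3).add_const (2 * t))).congr_deriv
      (by simp; ring)
  · exact ((hP.pow 3).const_mul (τ ^ 4)).congr_deriv (by simp)

/-- The derivative of the quartic with respect to `ξ`. -/
noncomputable def quarticDeriv (t τ S' P' ξ : ℝ) (W : ℂ) : ℂ :=
  coefDeriv t τ (aSum t τ ξ) (aProd t τ ξ) S' P' 0 * W ^ 3 +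
    coefDeriv t τ (aSum t τ ξ) (aProd t τ ξ) S' P' 1 * W ^ 2 +
    coefDeriv t τ (aSum t τ ξ) (aProd t τ ξ) S' P' 2 * W +
    coefDeriv t τ (aSum t τ ξ) (aProd t τ ξ) S' P' 3

/-- The derivative of `W` with respect to `ξ` at constant `Z`. -/
noncomputable def rootDeriv (t τ S' P' ξ : ℝ) (W : ℂ) : ℂ :=
  -quarticDeriv t τ S' P' ξ W / (symbolEuler (coef t τ ξ) W * W ^ 2)

/-- Implicit differentiation of the equation for `W` at constant `Z`, at a simple root. -/
theorem hasDerivAt_upperRoot (hτ : 0 < τ) (hξ : 0 < ξ) {S' P' : ℝ}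
    (hS : HasDerivAt (aSum t τ) S' ξ) (hP : HasDerivAt (aProd t τ) P' ξ)
    (hE : symbolEuler (coef t τ ξ) (upperRoot t τ j Z ξ) ≠ 0) :
    HasDerivAt (fun ξ => upperRoot t τ j Z ξ) (rootDeriv t τ S' P' ξ (upperRoot t τ j Z ξ)) ξ := by
  have hW := upperRoot_ne_zero (t := t) (j := j) (Z := Z) hτ hξ
  have hm := symbolEuler_mul hW (upperRoot_root (t := t) (τ := τ) (ξ := ξ) (Z := Z) (j := j))
  have hc := fun i => (hasDerivAt_coef hS hP i).ofReal_comp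
  have := hasDerivAt_root (q := fun y => symbolCoef (coef t τ y) Z)
    (q' := fun i => coefDeriv t τ (aSum t τ ξ) (aProd t τ ξ) S' P' i)
    (r := fun ξ => upperRoot t τ j Z ξ) (x := ξ) ?_
    (continuousAt_upperRoot_right hτ hξ j Z) (Eventually.of_forall fun y => upperRoot_root) ?_
  · refine this.congr_deriv ?_
    rw [rootDeriv, quarticDeriv, hm]
    simp [symbolCoef]
  · intro i
    fin_cases i
    · exact (hc 0).sub_const _
    · exact hc 1
    · exact hc 2
    · exact hc 3
  · have e : symbolEuler (coef t τ ξ) (upperRoot t τ j Z ξ) * upperRoot t τ j Z ξ ^ 2 ≠ 0 :=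
      mul_ne_zero hE (pow_ne_zero _ hW)
    rw [hm] at e
    simpa [symbolCoef] using e

theorem hasDerivAt_log_norm {r : ℝ → ℂ} {r' : ℂ} {x : ℝ} (h : HasDerivAt r r' x) (hr : r x ≠ 0) :
    HasDerivAt (fun y => Real.log ‖r y‖) (r' / r x).re x := by
  have h1 := h.norm_sq.log (pow_ne_zero 2 (norm_ne_zero_iff.2 hr))
  have h2 := h1.const_mul (1 / 2)
  refine (h2.congr_deriv ?_).congr_of_eventuallyEq (Eventually.of_forall fun y => ?_)
  · have hn : Complex.normSq (r x) ≠ 0 := by simpa using hr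
    rw [← Complex.normSq_eq_norm_sq, Complex.div_re, Complex.inner]
    simp
    field_simp
  · simp [Real.log_pow]

/-- The derivatives of `aSum` and `aProd` away from the critical value. -/
theorem exists_hasDerivAt_aSum (hξ : 0 < ξ) (hne : ξ ≠ xiCr t τ) : ∃ S' P' : ℝ,
    HasDerivAt (aSum t τ) S' ξ ∧ HasDerivAt (aProd t τ) P' ξ ∧
    ((aSum t τ ξ = τ ^ 2 - t ∧ aProd t τ ξ = ξ ∧ S' = 0 ∧ P' = 1) ∨
      ∃ a a' : ℝ, aSum t τ ξ = 2 * a ∧ aProd t τ ξ = a ^ 2 ∧ S' = 2 * a' ∧ P' = 2 * a * a' ∧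
        ξ = 3 * a ^ 2 - (τ ^ 2 - t) * a ∧ (6 * a - (τ ^ 2 - t)) * a' = 1) := by
  rcases lt_or_gt_of_ne hne with h | h
  · refine ⟨0, 1, ?_, ?_, Or.inl ⟨two_cut_aSum hξ h, two_cut_aProd hξ h, rfl, rfl⟩⟩
    · refine (hasDerivAt_const ξ (τ ^ 2 - t)).congr_of_eventuallyEq ?_
      filter_upwards [Ioo_mem_nhds hξ h] with y hy using two_cut_aSum hy.1 hy.2
    · refine (hasDerivAt_id ξ).congr_of_eventuallyEq ?_
      filter_upwards [Ioo_mem_nhds hξ h] with y hy using two_cut_aProd hy.1 hy.2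
  · set R := √((τ ^ 2 - t) ^ 2 + 12 * ξ) with hR
    have hpos : 0 < (τ ^ 2 - t) ^ 2 + 12 * ξ := by positivity
    have hR0 : 0 < R := Real.sqrt_pos.2 hpos
    have ha : HasDerivAt (aOne t τ) (1 / R) ξ := by
      have h1 : HasDerivAt (fun ξ => (τ ^ 2 - t) ^ 2 + 12 * ξ) (12 * 1) ξ :=
        ((hasDerivAt_id ξ).const_mul 12).const_add _
      have h2 := ((h1.sqrt hpos.ne').const_add (τ ^ 2 - t)).div_const 6
      refine h2.congr_deriv ?_
      rw [← hR]; field_simp; norm_num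
    have e1 : (fun ξ => 2 * aOne t τ ξ) =ᶠ[𝓝 ξ] aSum t τ := by
      filter_upwards [Ioi_mem_nhds hξ, Ioi_mem_nhds h] with y hy hy2 using
        (one_cut_aSum hy (le_of_lt hy2)).symm
    have e2 : (fun ξ => aOne t τ ξ ^ 2) =ᶠ[𝓝 ξ] aProd t τ := by
      filter_upwards [Ioi_mem_nhds hξ, Ioi_mem_nhds h] with y hy hy2 using
        (one_cut_aProd hy (le_of_lt hy2)).symm
    refine ⟨2 * (1 / R), 2 * aOne t τ ξ * (1 / R),
      (ha.const_mul 2).congr_of_eventuallyEq e1.symm,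
      ((ha.pow 2).congr_deriv (by simp)).congr_of_eventuallyEq e2.symm, Or.inr
      ⟨aOne t τ ξ, 1 / R, one_cut_aSum hξ h.le, one_cut_aProd hξ h.le, rfl, rfl,
        (aOne_eq t τ hξ.le).symm, ?_⟩⟩
    have : 6 * aOne t τ ξ - (τ ^ 2 - t) = R := by rw [aOne, ← hR]; ring
    rw [this, mul_one_div, div_self hR0.ne']

/-- The potential `½ ξ log |W| - ½ Re (W + A / W + B / W²)`. Up to a function of `ξ` alone, it is a
primitive of `½ log |W|` with respect to `ξ` along every branch of the solutions `W` for
constant `Z`. -/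
noncomputable def potential (t τ : ℝ) (W : ℂ) (ξ : ℝ) : ℝ :=
  1 / 2 * (ξ * Real.log ‖W‖) - 1 / 2 * (W + ((τ ^ 2 * (aProd t τ ξ * (3 * aSum t τ ξ + t)) : ℝ) : ℂ) / W
    + ((3 / 2 * τ ^ 4 * aProd t τ ξ ^ 2 : ℝ) : ℂ) / W ^ 2).re

/-- A function `W + T₁ / W + T₂ / W²` which differs by a real function of `ξ` from the product of
the two spectral coordinates. -/
noncomputable def coordProd (t τ : ℝ) (W : ℂ) (ξ : ℝ) : ℂ :=
  W + ((τ ^ 2 * (aProd t τ ξ * (2 * aSum t τ ξ + t)) : ℝ) : ℂ) / W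
    + ((τ ^ 4 * aProd t τ ξ ^ 2 : ℝ) : ℂ) / W ^ 2

theorem hasDerivAt_inv_terms {r : ℝ → ℂ} {r' : ℂ} {x : ℝ} {f g : ℝ → ℝ} {f' g' : ℝ}
    (h : HasDerivAt r r' x) (hr : r x ≠ 0) (hf : HasDerivAt f f' x) (hg : HasDerivAt g g' x) :
    HasDerivAt (fun y => r y + (f y : ℂ) / r y + (g y : ℂ) / r y ^ 2)
      (r' * (1 - f x / r x ^ 2 - 2 * g x / r x ^ 3) + f' / r x + g' / r x ^ 2) x := by
  refine ((h.add (hf.ofReal_comp.div h hr)).add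
    (hg.ofReal_comp.div (h.pow 2) (pow_ne_zero 2 hr))).congr_deriv ?_
  simp
  field_simp
  ring

theorem hasDerivAt_aProd_mul {S' P' : ℝ} (hS : HasDerivAt (aSum t τ) S' ξ)
    (hP : HasDerivAt (aProd t τ) P' ξ) (m : ℝ) :
    HasDerivAt (fun ξ => τ ^ 2 * (aProd t τ ξ * (m * aSum t τ ξ + t)))
      (τ ^ 2 * (P' * (m * aSum t τ ξ + t) + aProd t τ ξ * (m * S'))) ξ :=
  (hP.mul ((hS.const_mul m).add_const t)).const_mul (τ ^ 2)

theorem hasDerivAt_aProd_sq {P' : ℝ} (hP : HasDerivAt (aProd t τ) P' ξ) (m : ℝ) :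
    HasDerivAt (fun ξ => m * aProd t τ ξ ^ 2) (m * (2 * aProd t τ ξ * P')) ξ :=
  ((hP.pow 2).const_mul m).congr_deriv (by simp)

/-- The algebraic identity behind `exists_hasDerivAt_potential`. -/
theorem exists_rootDeriv_potential {S' P' : ℝ}
    (hcase : (aSum t τ ξ = τ ^ 2 - t ∧ aProd t τ ξ = ξ ∧ S' = 0 ∧ P' = 1) ∨
      ∃ a a' : ℝ, aSum t τ ξ = 2 * a ∧ aProd t τ ξ = a ^ 2 ∧ S' = 2 * a' ∧ P' = 2 * a * a' ∧
        ξ = 3 * a ^ 2 - (τ ^ 2 - t) * a ∧ (6 * a - (τ ^ 2 - t)) * a' = 1) :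
    ∃ k : ℝ, ∀ W : ℂ, W ≠ 0 → symbolEuler (coef t τ ξ) W ≠ 0 →
      ξ * (rootDeriv t τ S' P' ξ W / W) - (rootDeriv t τ S' P' ξ W *
        (1 - (τ ^ 2 * (aProd t τ ξ * (3 * aSum t τ ξ + t)) : ℝ) / W ^ 2
          - 2 * (3 / 2 * τ ^ 4 * aProd t τ ξ ^ 2 : ℝ) / W ^ 3)
        + (τ ^ 2 * (P' * (3 * aSum t τ ξ + t) + aProd t τ ξ * (3 * S')) : ℝ) / W
        + (3 / 2 * τ ^ 4 * (2 * aProd t τ ξ * P') : ℝ) / W ^ 2) = 2 * k := by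
  have key : ∀ (N E W X Y k : ℂ), W ≠ 0 → E ≠ 0 → -N * X = E * W ^ 2 * (Y + 2 * k) →
      -N / (E * W ^ 2) * X - Y = 2 * k := by
    intro N E W X Y k hW hE h
    field_simp
    linear_combination h
  rcases hcase with ⟨h1, h2, h3, h4⟩ | ⟨a, a', h1, h2, h3, h4, h5, h6⟩
  · refine ⟨1, fun W hW hE => ?_⟩
    have := key (quarticDeriv t τ S' P' ξ W) (symbolEuler (coef t τ ξ) W) W (ξ / W - (1 - (τ ^ 2 * (aProd t τ ξ * (3 * aSum t τ ξ + t)) : ℝ) / W ^ 2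
          - 2 * (3 / 2 * τ ^ 4 * aProd t τ ξ ^ 2 : ℝ) / W ^ 3))
        ((τ ^ 2 * (P' * (3 * aSum t τ ξ + t) + aProd t τ ξ * (3 * S')) : ℝ) / W
        + (3 / 2 * τ ^ 4 * (2 * aProd t τ ξ * P') : ℝ) / W ^ 2) (1 : ℝ) hW hE ?_
    · rw [← this, rootDeriv]; ring
    · simp only [quarticDeriv, coefDeriv, symbolEuler, coef, h1, h2, h3, h4]
      simp
      field_simp
      ring
  · refine ⟨(6 * a + t) * a', fun W hW hE => ?_⟩
    have := key (quarticDeriv t τ S' P' ξ W) (symbolEuler (coef t τ ξ) W) W (ξ / W - (1 - (τ ^ 2 * (aProd t τ ξ * (3 * aSum t τ ξ + t)) : ℝ) / W ^ 2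
          - 2 * (3 / 2 * τ ^ 4 * aProd t τ ξ ^ 2 : ℝ) / W ^ 3))
        ((τ ^ 2 * (P' * (3 * aSum t τ ξ + t) + aProd t τ ξ * (3 * S')) : ℝ) / W
        + (3 / 2 * τ ^ 4 * (2 * aProd t τ ξ * P') : ℝ) / W ^ 2) ((6 * a + t) * a' : ℝ) hW hE ?_
    · rw [← this, rootDeriv]; ring
    · have h5' : (ξ : ℂ) = 3 * a ^ 2 - (τ ^ 2 - t) * a := by rw [h5]; push_cast; ring
      simp only [quarticDeriv, coefDeriv, symbolEuler, coef, h1, h2, h3, h4]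
      rw [h5']
      simp
      field_simp
      ring

/-- The algebraic identity behind `exists_hasDerivAt_coordProd`. -/
theorem exists_rootDeriv_coordProd {S' P' : ℝ}
    (hcase : (aSum t τ ξ = τ ^ 2 - t ∧ aProd t τ ξ = ξ ∧ S' = 0 ∧ P' = 1) ∨
      ∃ a a' : ℝ, aSum t τ ξ = 2 * a ∧ aProd t τ ξ = a ^ 2 ∧ S' = 2 * a' ∧ P' = 2 * a * a' ∧
        ξ = 3 * a ^ 2 - (τ ^ 2 - t) * a ∧ (6 * a - (τ ^ 2 - t)) * a' = 1) :
    ∃ k : ℝ, ∀ Z W : ℂ, quartic (symbolCoef (coef t τ ξ) Z) W = 0 → W ≠ 0 →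
      symbolEuler (coef t τ ξ) W ≠ 0 →
      rootDeriv t τ S' P' ξ W *
        (1 - (τ ^ 2 * (aProd t τ ξ * (2 * aSum t τ ξ + t)) : ℝ) / W ^ 2
          - 2 * (τ ^ 4 * aProd t τ ξ ^ 2 : ℝ) / W ^ 3)
        + (τ ^ 2 * (P' * (2 * aSum t τ ξ + t) + aProd t τ ξ * (2 * S')) : ℝ) / W
        + (τ ^ 4 * (2 * aProd t τ ξ * P') : ℝ) / W ^ 2 =
        k - Z * (1 / symbolEuler (coef t τ ξ) W) := by
  have key : ∀ (N E W X Y k Z G : ℂ), W ≠ 0 → E ≠ 0 → Z * W ^ 3 = G →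
      -N * X * W + E * W ^ 3 * (Y - k) = - G →
      -N / (E * W ^ 2) * X + Y = k - Z * (1 / E) := by
    intro N E W X Y k Z G hW hE hG h
    rw [← hG] at h
    have : W * (-N * X + E * W ^ 2 * (Y - k) + Z * W ^ 2) = 0 := by linear_combination h
    have h2 := (mul_eq_zero.1 this).resolve_left hW
    field_simp
    linear_combination h2
  have hroot : ∀ Z W : ℂ, quartic (symbolCoef (coef t τ ξ) Z) W = 0 → Z * W ^ 3 =
      W ^ 4 + coef t τ ξ 0 * W ^ 3 + coef t τ ξ 1 * W ^ 2 + coef t τ ξ 2 * W + coef t τ ξ 3 := by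
    intro Z W h
    rw [quartic_symbolCoef] at h
    linear_combination -h
  rcases hcase with ⟨h1, h2, h3, h4⟩ | ⟨a, a', h1, h2, h3, h4, h5, h6⟩
  · refine ⟨-1, fun Z W hr hW hE => ?_⟩
    have := key (quarticDeriv t τ S' P' ξ W) (symbolEuler (coef t τ ξ) W) W (1 - (τ ^ 2 * (aProd t τ ξ * (2 * aSum t τ ξ + t)) : ℝ) / W ^ 2
          - 2 * (τ ^ 4 * aProd t τ ξ ^ 2 : ℝ) / W ^ 3)
        ((τ ^ 2 * (P' * (2 * aSum t τ ξ + t) + aProd t τ ξ * (2 * S')) : ℝ) / W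
        + (τ ^ 4 * (2 * aProd t τ ξ * P') : ℝ) / W ^ 2) (-1 : ℝ) Z _ hW hE (hroot Z W hr) ?_
    · rw [← this, rootDeriv]; ring
    · simp only [quarticDeriv, coefDeriv, symbolEuler, coef, h1, h2, h3, h4]
      simp
      field_simp
      ring
  · refine ⟨-(τ ^ 2 * a' + (6 * a + t) * a'), fun Z W hr hW hE => ?_⟩
    have := key (quarticDeriv t τ S' P' ξ W) (symbolEuler (coef t τ ξ) W) W (1 - (τ ^ 2 * (aProd t τ ξ * (2 * aSum t τ ξ + t)) : ℝ) / W ^ 2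
          - 2 * (τ ^ 4 * aProd t τ ξ ^ 2 : ℝ) / W ^ 3)
        ((τ ^ 2 * (P' * (2 * aSum t τ ξ + t) + aProd t τ ξ * (2 * S')) : ℝ) / W
        + (τ ^ 4 * (2 * aProd t τ ξ * P') : ℝ) / W ^ 2)
        (-(τ ^ 2 * a' + (6 * a + t) * a') : ℝ) Z _ hW hE (hroot Z W hr) ?_
    · rw [← this, rootDeriv]; ring
    · have h6' : (6 * a - (τ ^ 2 - t)) * a' = (1 : ℂ) := by exact_mod_cast h6
      simp only [quarticDeriv, coefDeriv, symbolEuler, coef, h1, h2, h3, h4]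
      simp
      field_simp
      linear_combination -W ^ 2 * (W ^ 2 + a * (3 * a + t) * W + τ ^ 2 * a ^ 3) ^ 2 * h6'

theorem exists_hasDerivAt_potential (hτ : 0 < τ) (hξ : 0 < ξ) (hne : ξ ≠ xiCr t τ) :
    ∃ k : ℝ, ∀ (j : Fin 4) (Z : ℝ), symbolEuler (coef t τ ξ) (upperRoot t τ j Z ξ) ≠ 0 →
      HasDerivAt (fun ξ => potential t τ (upperRoot t τ j Z ξ) ξ)
        (1 / 2 * Real.log ‖upperRoot t τ j Z ξ‖ + k) ξ := by
  obtain ⟨S', P', hS, hP, hcase⟩ := exists_hasDerivAt_aSum hξ hne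
  obtain ⟨k, hk⟩ := exists_rootDeriv_potential hcase
  refine ⟨k, fun j Z hE => ?_⟩
  have hW := upperRoot_ne_zero (t := t) (j := j) (Z := Z) hτ hξ
  have hd := hasDerivAt_upperRoot hτ hξ hS hP hE
  have h1 := hasDerivAt_inv_terms hd hW (hasDerivAt_aProd_mul hS hP 3)
    (hasDerivAt_aProd_sq hP (3 / 2 * τ ^ 4))
  have h2 := ((hasDerivAt_id ξ).mul (hasDerivAt_log_norm hd hW)).const_mul (1 / 2)
  have h3 := (Complex.reCLM.hasFDerivAt.comp_hasDerivAt ξ h1).const_mul (1 / 2)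
  refine (h2.sub h3).congr_deriv ?_
  have e := congrArg Complex.re (hk _ hW hE)
  rw [Complex.sub_re, Complex.re_ofReal_mul] at e
  simp only [Complex.reCLM_apply, id, one_mul]
  have e2 : (2 * (k : ℂ)).re = 2 * k := by simp
  rw [e2] at e
  linarith

theorem exists_hasDerivAt_coordProd (hτ : 0 < τ) (hξ : 0 < ξ) (hne : ξ ≠ xiCr t τ)
    (hE : symbolEuler (coef t τ ξ) (upperRoot t τ j Z ξ) ≠ 0) :
    ∃ k : ℝ, HasDerivAt (fun ξ => coordProd t τ (upperRoot t τ j Z ξ) ξ)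
        (k - Z * (1 / symbolEuler (coef t τ ξ) (upperRoot t τ j Z ξ))) ξ := by
  obtain ⟨S', P', hS, hP, hcase⟩ := exists_hasDerivAt_aSum hξ hne
  obtain ⟨k, hk⟩ := exists_rootDeriv_coordProd hcase
  have hW := upperRoot_ne_zero (t := t) (j := j) (Z := Z) hτ hξ
  have hd := hasDerivAt_upperRoot hτ hξ hS hP hE
  exact ⟨k, (hasDerivAt_inv_terms hd hW (hasDerivAt_aProd_mul hS hP 2)
    (hasDerivAt_aProd_sq hP (τ ^ 4))).congr_deriv (hk _ _ upperRoot_root hW hE)⟩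

theorem continuousAt_potential (hτ : 0 < τ) {p : ℝ × ℝ} (hp : 0 < p.2) (j : Fin 4) :
    ContinuousAt (fun p : ℝ × ℝ => potential t τ (upperRoot t τ j p.1 p.2) p.2) p := by
  have h1 := continuousAt_upperRoot (t := t) hτ hp j
  have h2 := upperRoot_ne_zero (t := t) (j := j) (Z := p.1) hτ hp
  have h3 := continuous_aSum t τ
  have h4 := continuous_aProd t τ
  unfold potential
  have h5 : ContinuousAt (fun p : ℝ × ℝ => Real.log ‖upperRoot t τ j p.1 p.2‖) p :=
    h1.norm.log (norm_ne_zero_iff.2 h2)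
  have h6 : ContinuousAt (fun p : ℝ × ℝ => upperRoot t τ j p.1 p.2 +
      ((τ ^ 2 * (aProd t τ p.2 * (3 * aSum t τ p.2 + t)) : ℝ) : ℂ) / upperRoot t τ j p.1 p.2
      + ((3 / 2 * τ ^ 4 * aProd t τ p.2 ^ 2 : ℝ) : ℂ) / upperRoot t τ j p.1 p.2 ^ 2) p := by
    refine (h1.add (ContinuousAt.div ?_ h1 h2)).add (ContinuousAt.div ?_ (h1.pow 2) (pow_ne_zero 2 h2))
    · exact (Complex.continuous_ofReal.comp (by fun_prop)).continuousAt
    · exact (Complex.continuous_ofReal.comp (by fun_prop)).continuousAt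
  exact ((continuousAt_snd.mul h5).const_mul _).sub
    ((Complex.continuous_re.continuousAt.comp h6).const_mul _)

theorem continuousAt_coordProd (hτ : 0 < τ) {p : ℝ × ℝ} (hp : 0 < p.2) (j : Fin 4) :
    ContinuousAt (fun p : ℝ × ℝ => coordProd t τ (upperRoot t τ j p.1 p.2) p.2) p := by
  have h1 := continuousAt_upperRoot (t := t) hτ hp j
  have h2 := upperRoot_ne_zero (t := t) (j := j) (Z := p.1) hτ hp
  have h3 := continuous_aSum t τ
  have h4 := continuous_aProd t τ
  refine (h1.add (ContinuousAt.div ?_ h1 h2)).add (ContinuousAt.div ?_ (h1.pow 2) (pow_ne_zero 2 h2))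
  · exact (Complex.continuous_ofReal.comp (by fun_prop)).continuousAt
  · exact (Complex.continuous_ofReal.comp (by fun_prop)).continuousAt

end TwoMatrix

namespace TwoMatrix

/-! ### Integration of the logarithmic gaps -/

/-- If `G` is differentiable with derivative `f` where `f ≠ 0`, and `G` vanishes where `f` does,
then `G` has derivative `f` everywhere. -/
theorem hasDerivAt_of_zero_or {f G : ℝ → ℝ} {s : Set ℝ} (hs : IsOpen s)
    (hf : ContinuousOn f s) (hG : ContinuousOn G s)
    (h0 : ∀ y ∈ s, f y = 0 → G y = 0) (h1 : ∀ y ∈ s, f y ≠ 0 → HasDerivAt G (f y) y)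
    {x : ℝ} (hx : x ∈ s) : HasDerivAt G (f x) x := by
  by_cases hfx : f x = 0
  swap
  · exact h1 x hx hfx
  rw [hfx, hasDerivAt_iff_isLittleO, Asymptotics.isLittleO_iff]
  intro ε hε
  have hfc : ∀ᶠ y in 𝓝 x, |f y| < ε := by
    have := (hf.continuousAt (hs.mem_nhds hx)).abs
    refine this.eventually (gt_mem_nhds ?_)
    simpa [hfx] using hε
  obtain ⟨δ, hδ, hball⟩ := Metric.eventually_nhds_iff_ball.1 (hfc.and (hs.mem_nhds hx))
  filter_upwards [Metric.ball_mem_nhds x hδ] with y hy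
  have hseg : uIcc x y ⊆ Metric.ball x δ := by
    have := (convex_ball x δ).segment_subset (Metric.mem_ball_self hδ) hy
    rwa [segment_eq_uIcc] at this
  rw [h0 x hx hfx]
  simp only [sub_zero, smul_zero, Real.norm_eq_abs]
  -- the point of the zero set of `f` on the segment which is closest to `y`
  have hK : IsCompact (uIcc x y ∩ f ⁻¹' {0}) :=
    isCompact_uIcc.of_isClosed_subset
      ((hf.mono fun z hz => (hball z (hseg hz)).2).preimage_isClosed_of_isClosed
        isClosed_Icc isClosed_singleton) inter_subset_left
  obtain ⟨k, ⟨hk, hk0⟩, hmin⟩ := hK.exists_isMinOn ⟨x, left_mem_uIcc, hfx⟩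
    (f := fun z => |y - z|) (by fun_prop)
  have hk0' : f k = 0 := hk0
  have hGk := h0 k (hball k (hseg hk)).2 hk0'
  have hkx : |y - k| ≤ |y - x| := by
    rcases le_total x y with hxy | hxy
    · rw [uIcc_of_le hxy] at hk
      rw [abs_of_nonneg (by linarith [hk.2]), abs_of_nonneg (by linarith)]; linarith [hk.1]
    · rw [uIcc_of_ge hxy] at hk
      rw [abs_of_nonpos (by linarith [hk.1]), abs_of_nonpos (by linarith)]; linarith [hk.2]
  refine le_trans ?_ (mul_le_mul_of_nonneg_left hkx hε.le)
  have hsub : uIcc k y ⊆ uIcc x y := uIcc_subset_uIcc hk right_mem_uIcc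
  have hne : ∀ z ∈ uIcc k y, z ≠ k → f z ≠ 0 := by
    intro z hz hzk hfz
    have h2 := hmin (show z ∈ uIcc x y ∩ f ⁻¹' {0} from ⟨hsub hz, hfz⟩)
    simp only [mem_ofPred_eq] at h2
    rcases le_total k y with hxy | hxy
    · rw [uIcc_of_le hxy] at hz
      rw [abs_of_nonneg (by linarith [hz.2]), abs_of_nonneg (by linarith [hz.2])] at h2
      exact hzk (le_antisymm (by linarith) hz.1)
    · rw [uIcc_of_ge hxy] at hz
      rw [abs_of_nonpos (by linarith [hz.1]), abs_of_nonpos (by linarith [hz.1])] at h2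
      exact hzk (le_antisymm hz.2 (by linarith))
  have hGc : ContinuousOn G (uIcc k y) := hG.mono fun z hz => (hball z (hseg (hsub hz))).2
  rcases lt_trichotomy k y with hky | rfl | hky
  · rw [uIcc_of_le hky.le] at *
    obtain ⟨c, hc, hce⟩ := exists_hasDerivAt_eq_slope G f hky hGc fun z hz =>
      h1 z (hball z (hseg (hsub (Ioo_subset_Icc_self hz)))).2
        (hne z (Ioo_subset_Icc_self hz) hz.1.ne')
    have hb := (hball c (hseg (hsub (Ioo_subset_Icc_self hc)))).1
    rw [hGk, sub_zero, eq_div_iff (by linarith)] at hce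
    rw [← hce, abs_mul]
    exact mul_le_mul_of_nonneg_right hb.le (abs_nonneg _)
  · rw [hGk]; simp
  · rw [uIcc_of_ge hky.le] at *
    obtain ⟨c, hc, hce⟩ := exists_hasDerivAt_eq_slope G f hky hGc fun z hz =>
      h1 z (hball z (hseg (hsub (Ioo_subset_Icc_self hz)))).2
        (hne z (Ioo_subset_Icc_self hz) hz.2.ne)
    have hb := (hball c (hseg (hsub (Ioo_subset_Icc_self hc)))).1
    rw [hGk, zero_sub, eq_div_iff (by linarith)] at hce
    have : G y = f c * (y - k) := by linarith
    rw [this, abs_mul]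
    exact mul_le_mul_of_nonneg_right hb.le (abs_nonneg _)

/-- Half of `log |W_i / W_{i'}|`. -/
noncomputable def logGap (t τ : ℝ) (i i' : Fin 4) (Z ξ : ℝ) : ℝ :=
  1 / 2 * (Real.log ‖upperRoot t τ i Z ξ‖ - Real.log ‖upperRoot t τ i' Z ξ‖)

/-- The difference of the potentials at two roots. -/
noncomputable def potGap (t τ : ℝ) (i i' : Fin 4) (Z ξ : ℝ) : ℝ :=
  potential t τ (upperRoot t τ i Z ξ) ξ - potential t τ (upperRoot t τ i' Z ξ) ξ

variable {t τ ξ Z : ℝ} {i i' j : Fin 4}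

theorem upperRoot_eq_of_norm_eq (hτ : 0 < τ) (hξ : 0 < ξ)
    (hn : ‖upperRoot t τ i Z ξ‖ = ‖upperRoot t τ i' Z ξ‖) :
    upperRoot t τ i Z ξ = upperRoot t τ i' Z ξ := by
  obtain ⟨ζ, hζ⟩ := exists_negZeros (t := t) hτ hξ
  have hs := isSortedRoots_symbolRoots (coef t τ ξ) (Z : ℂ)
  rw [norm_upperRoot, norm_upperRoot] at hn
  rw [upperRoot, upperRoot]
  rcases hζ.eq_or_conj (hs.root i) (hs.root i') hn with h | h
  · rw [h]
  · rw [h, upper_conj]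

theorem symbolEuler_upperRoot_ne_zero_iff : symbolEuler (coef t τ ξ) (upperRoot t τ j Z ξ) ≠ 0 ↔
    symbolEuler (coef t τ ξ) (symbolRoots (coef t τ ξ) Z j) ≠ 0 := by
  rw [upperRoot]
  rcases upper_eq (symbolRoots (coef t τ ξ) Z j) with h | h <;> rw [h]
  rw [symbolEuler_conj]; simp

/-- A root of unique modulus is simple. -/
theorem symbolEuler_upperRoot_ne_zero (hτ : 0 < τ) (hξ : 0 < ξ)
    (hne : ∀ i, i ≠ j → ‖upperRoot t τ i Z ξ‖ ≠ ‖upperRoot t τ j Z ξ‖) :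
    symbolEuler (coef t τ ξ) (upperRoot t τ j Z ξ) ≠ 0 := by
  rw [symbolEuler_upperRoot_ne_zero_iff]
  obtain ⟨ζ, hζ⟩ := exists_negZeros (t := t) hτ hξ
  have hs := isSortedRoots_symbolRoots (coef t τ ξ) (Z : ℂ)
  refine symbolEuler_ne_zero_of_unique hs (hζ.root_ne_zero (hs.root j)) fun i hi he => ?_
  have := hne i hi
  rw [norm_upperRoot, norm_upperRoot, he] at this
  exact this rfl

theorem norm_upperRoot_antitone (h : i ≤ i') :
    ‖upperRoot t τ i' Z ξ‖ ≤ ‖upperRoot t τ i Z ξ‖ := by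
  rw [norm_upperRoot, norm_upperRoot]
  exact (isSortedRoots_symbolRoots _ _).norm_antitone h

theorem norm_upperRoot_pos (hτ : 0 < τ) (hξ : 0 < ξ) : 0 < ‖upperRoot t τ i Z ξ‖ :=
  norm_pos_iff.2 (upperRoot_ne_zero hτ hξ)

theorem continuousAt_logGap (hτ : 0 < τ) {p : ℝ × ℝ} (hp : 0 < p.2) (i i' : Fin 4) :
    ContinuousAt (fun p : ℝ × ℝ => logGap t τ i i' p.1 p.2) p :=
  (((continuousAt_upperRoot hτ hp i).norm.log (norm_upperRoot_pos hτ hp).ne').sub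
    ((continuousAt_upperRoot hτ hp i').norm.log (norm_upperRoot_pos hτ hp).ne')).const_mul _

theorem continuousAt_potGap (hτ : 0 < τ) {p : ℝ × ℝ} (hp : 0 < p.2) (i i' : Fin 4) :
    ContinuousAt (fun p : ℝ × ℝ => potGap t τ i i' p.1 p.2) p :=
  (continuousAt_potential hτ hp i).sub (continuousAt_potential hτ hp i')

theorem logGap_eq_zero_iff (hτ : 0 < τ) (hξ : 0 < ξ) : logGap t τ i i' Z ξ = 0 ↔
    ‖upperRoot t τ i Z ξ‖ = ‖upperRoot t τ i' Z ξ‖ := by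
  rw [logGap]
  constructor
  · intro h
    refine Real.log_injOn_pos (norm_upperRoot_pos hτ hξ) (norm_upperRoot_pos hτ hξ) ?_
    linarith
  · intro h; rw [h]; ring

theorem logGap_nonneg (hτ : 0 < τ) (hξ : 0 < ξ) (h : i ≤ i') : 0 ≤ logGap t τ i i' Z ξ := by
  have := Real.log_le_log (norm_upperRoot_pos (t := t) (Z := Z) hτ hξ)
    (norm_upperRoot_antitone (t := t) (τ := τ) (Z := Z) (ξ := ξ) h)
  rw [logGap]; linarith

/-- The pairs of indices of the two external fields. -/
def OuterPair (i i' : Fin 4) : Prop := (i = 0 ∧ i' = 1) ∨ (i = 2 ∧ i' = 3)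

theorem OuterPair.le (h : OuterPair i i') : i ≤ i' := by
  rcases h with ⟨rfl, rfl⟩ | ⟨rfl, rfl⟩ <;> decide

/-- Where the two roots have different moduli both are simple, and the two potentials can be
differentiated separately. -/
theorem hasDerivAt_potGap_of_ne (hτ : 0 < τ) (hξ : 0 < ξ) (hcr : ξ ≠ xiCr t τ) (hZ : 0 < Z)
    (hp : OuterPair i i') (hne : logGap t τ i i' Z ξ ≠ 0) :
    HasDerivAt (potGap t τ i i' Z) (logGap t τ i i' Z ξ) ξ := by
  rw [Ne, logGap_eq_zero_iff hτ hξ] at hne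
  obtain ⟨ζ, hζ⟩ := exists_negZeros (t := t) hτ hξ
  have h21 := hζ.norm_two_lt_one hZ (isSortedRoots_symbolRoots (coef t τ ξ) Z)
  rw [← norm_upperRoot, ← norm_upperRoot] at h21
  have h10 := norm_upperRoot_antitone (t := t) (τ := τ) (Z := Z) (ξ := ξ)
    (show (0 : Fin 4) ≤ 1 by decide)
  have h32 := norm_upperRoot_antitone (t := t) (τ := τ) (Z := Z) (ξ := ξ)
    (show (2 : Fin 4) ≤ 3 by decide)
  have hE : symbolEuler (coef t τ ξ) (upperRoot t τ i Z ξ) ≠ 0 ∧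
      symbolEuler (coef t τ ξ) (upperRoot t τ i' Z ξ) ≠ 0 := by
    rcases hp with ⟨rfl, rfl⟩ | ⟨rfl, rfl⟩
    · have h10' := lt_of_le_of_ne h10 (Ne.symm hne)
      constructor <;> refine symbolEuler_upperRoot_ne_zero hτ hξ fun k hk => ?_
      · fin_cases k <;> simp at hk ⊢ <;> [exact h10'.ne; exact (h21.trans h10').ne;
          exact (h32.trans_lt (h21.trans h10')).ne]
      · fin_cases k <;> simp at hk ⊢ <;> [exact h10'.ne'; exact h21.ne;
          exact (h32.trans_lt h21).ne]
    · have h32' := lt_of_le_of_ne h32 (Ne.symm hne)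
      constructor <;> refine symbolEuler_upperRoot_ne_zero hτ hξ fun k hk => ?_
      · fin_cases k <;> simp at hk ⊢ <;> [exact (h21.trans_le h10).ne'; exact h21.ne';
          exact h32'.ne]
      · fin_cases k <;> simp at hk ⊢ <;> [exact (h32'.trans (h21.trans_le h10)).ne';
          exact (h32'.trans h21).ne'; exact h32'.ne']
  obtain ⟨k, hk⟩ := exists_hasDerivAt_potential (t := t) hτ hξ hcr
  refine ((hk i Z hE.1).sub (hk i' Z hE.2)).congr_deriv ?_
  rw [logGap]; ring

theorem intervalIntegrable_logGap (hτ : 0 < τ) {a b : ℝ} (ha : 0 < a) (hab : a ≤ b) (i i' : Fin 4)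
    (Z : ℝ) : IntervalIntegrable (logGap t τ i i' Z) volume a b := by
  refine ContinuousOn.intervalIntegrable fun y hy => ?_
  rw [uIcc_of_le hab] at hy
  exact ((continuousAt_logGap (p := (Z, y)) hτ (ha.trans_le hy.1) i i').comp
    (f := fun y => (Z, y)) (by fun_prop)).continuousWithinAt

theorem integral_logGap_of_pos (hτ : 0 < τ) (hZ : 0 < Z) (hp : OuterPair i i') {a b : ℝ}
    (ha : 0 < a) (hab : a ≤ b) :
    ∫ ξ in a..b, logGap t τ i i' Z ξ = potGap t τ i i' Z b - potGap t τ i i' Z a := by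
  have hG : ∀ y, 0 < y → ContinuousAt (potGap t τ i i' Z) y := fun y hy =>
    (continuousAt_potGap (p := (Z, y)) hτ hy i i').comp (f := fun y => (Z, y)) (by fun_prop)
  have hf : ∀ y, 0 < y → ContinuousAt (logGap t τ i i' Z) y := fun y hy =>
    (continuousAt_logGap (p := (Z, y)) hτ hy i i').comp (f := fun y => (Z, y)) (by fun_prop)
  have hopen : IsOpen (Ioi (0 : ℝ) ∩ {xiCr t τ}ᶜ) := isOpen_Ioi.inter isOpen_compl_singleton
  refine integral_eq_of_hasDerivAt_off_countable_of_le _ _ hab (countable_singleton (xiCr t τ))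
    (fun y hy => (hG y (ha.trans_le hy.1)).continuousWithinAt) (fun y hy => ?_)
    (intervalIntegrable_logGap hτ ha hab i i' Z)
  refine hasDerivAt_of_zero_or hopen (fun y hy => (hf y hy.1).continuousWithinAt)
    (fun y hy => (hG y hy.1).continuousWithinAt) (fun y hy h0 => ?_)
    (fun y hy hne => hasDerivAt_potGap_of_ne hτ hy.1 hy.2 hZ hp hne) ⟨ha.trans hy.1.1, hy.2⟩
  rw [potGap, upperRoot_eq_of_norm_eq hτ hy.1 ((logGap_eq_zero_iff hτ hy.1).1 h0), sub_self]

/-- The case `Z = 0` is obtained from `Z > 0` by continuity in `Z`. -/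
theorem integral_logGap (hτ : 0 < τ) (hZ : 0 ≤ Z) (hp : OuterPair i i') {a b : ℝ}
    (ha : 0 < a) (hab : a ≤ b) :
    ∫ ξ in a..b, logGap t τ i i' Z ξ = potGap t τ i i' Z b - potGap t τ i i' Z a := by
  have hc : Continuous fun Z => ∫ ξ in a..b, logGap t τ i i' Z (max ξ a) := by
    refine intervalIntegral.continuous_parametric_intervalIntegral_of_continuous' ?_ a b
    refine continuous_iff_continuousAt.2 fun p => ?_
    exact (continuousAt_logGap (p := (p.1, max p.2 a)) hτ (lt_max_of_lt_right ha) i i').comp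
      (f := fun p : ℝ × ℝ => (p.1, max p.2 a)) (by fun_prop)
  have hG : ∀ y, 0 < y → Continuous fun Z => potGap t τ i i' Z y := fun y hy =>
    continuous_iff_continuousAt.2 fun Z =>
      (continuousAt_potGap (p := (Z, y)) hτ hy i i').comp (f := fun Z => (Z, y)) (by fun_prop)
  have he : ∀ Z, ∫ ξ in a..b, logGap t τ i i' Z (max ξ a) = ∫ ξ in a..b, logGap t τ i i' Z ξ := by
    intro Z
    refine intervalIntegral.integral_congr fun y hy => ?_
    rw [uIcc_of_le hab] at hy
    simp only [max_eq_left hy.1]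
  have hclosed : IsClosed {Z | ∫ ξ in a..b, logGap t τ i i' Z (max ξ a) =
      potGap t τ i i' Z b - potGap t τ i i' Z a} :=
    isClosed_eq hc ((hG b (ha.trans_le hab)).sub (hG a ha))
  have hsub : closure (Ioi (0 : ℝ)) ⊆ {Z | ∫ ξ in a..b, logGap t τ i i' Z (max ξ a) =
      potGap t τ i i' Z b - potGap t τ i i' Z a} := by
    refine closure_minimal (fun Z hZ => ?_) hclosed
    rw [mem_ofPred_eq, he]; exact integral_logGap_of_pos hτ hZ hp ha hab
  rw [closure_Ioi] at hsub
  rw [← he]; exact hsub hZ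

theorem hasDerivAt_potGap (hτ : 0 < τ) (hZ : 0 ≤ Z) (hp : OuterPair i i') (hξ : 0 < ξ) :
    HasDerivAt (potGap t τ i i' Z) (logGap t τ i i' Z ξ) ξ := by
  have hf : ∀ y, 0 < y → ContinuousAt (logGap t τ i i' Z) y := fun y hy =>
    (continuousAt_logGap (p := (Z, y)) hτ hy i i').comp (f := fun y => (Z, y)) (by fun_prop)
  have h1 := intervalIntegral.integral_hasDerivAt_right
    (intervalIntegrable_logGap (t := t) hτ (half_pos hξ) (half_le_self hξ.le) i i' Z)
    (ContinuousOn.stronglyMeasurableAtFilter_nhdsWithin (s := Ioi 0)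
      (fun y hy => (hf y hy).continuousWithinAt) measurableSet_Ioi ξ |>.filter_mono
      (by rw [IsOpen.nhdsWithin_eq isOpen_Ioi hξ])) (hf ξ hξ)
  refine (h1.add_const (potGap t τ i i' Z (ξ / 2))).congr_of_eventuallyEq ?_
  filter_upwards [Ioi_mem_nhds (half_lt_self hξ)] with y hy
  rw [integral_logGap hτ hZ hp (half_pos hξ) (le_of_lt hy)]; ring

/-- For large `ξ` the solutions of `s₁(w) = z` with real `z` form two conjugate pairs. -/
theorem norm_symbolRoots_eq (hτ : 0 < τ) (hξ : 0 < ξ) (z : ℝ) (hb : z ^ 2 < 4 * bOne t τ ξ)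
    (hp : OuterPair i i') :
    ‖symbolRoots (symbolOne t τ ξ) z i‖ = ‖symbolRoots (symbolOne t τ ξ) z i'‖ := by
  have hs := isSortedRoots_symbolRoots (symbolOne t τ ξ) z
  set w := symbolRoots (symbolOne t τ ξ) z
  have ha := aOne_pos t τ hξ
  have hc : 0 < cOne t τ ξ := by rw [cOne]; positivity
  -- there are no real solutions
  have hreal : ∀ u : ℂ, quartic (symbolCoef (symbolOne t τ ξ) z) u = 0 → u.im ≠ 0 := by
    intro u hu hi
    obtain ⟨x, rfl⟩ : ∃ x : ℝ, u = x := ⟨u.re, Complex.ext (by simp) (by simpa using hi)⟩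
    rw [quartic_symbolCoef] at hu
    simp [symbolOne] at hu
    have : x ^ 4 - z * x ^ 3 + bOne t τ ξ * x ^ 2 + cOne t τ ξ = 0 := by
      have h : ((x ^ 4 - z * x ^ 3 + bOne t τ ξ * x ^ 2 + cOne t τ ξ : ℝ) : ℂ) = 0 := by
        push_cast; linear_combination hu
      exact_mod_cast h
    nlinarith [sq_nonneg (x * (x - z / 2)), sq_nonneg x,
      mul_nonneg (sq_nonneg x) (show 0 ≤ bOne t τ ξ - z ^ 2 / 4 by linarith)]
  have hcj : ∀ j, (starRingEnd ℂ) (w j) = w 0 ∨ (starRingEnd ℂ) (w j) = w 1 ∨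
      (starRingEnd ℂ) (w j) = w 2 ∨ (starRingEnd ℂ) (w j) = w 3 :=
    fun j => hs.mem (quartic_symbolCoef_conj _ _ (hs.root j))
  have hnn : ∀ j k, (starRingEnd ℂ) (w j) = w k → ‖w k‖ = ‖w j‖ := fun j k h => by
    rw [← h, Complex.norm_conj]
  have hself : ∀ j, (starRingEnd ℂ) (w j) ≠ w j := fun j h =>
    hreal _ (hs.root j) (Complex.conj_eq_iff_im.1 h)
  have h1 := hs.le10
  have h2 := hs.le21
  have h3 := hs.le32
  rcases hp with ⟨rfl, rfl⟩ | ⟨rfl, rfl⟩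
  · rcases hcj 0 with h | h | h | h
    · exact absurd h (hself 0)
    all_goals have := hnn _ _ h; linarith
  · rcases hcj 3 with h | h | h | h
    rotate_left 3
    · exact absurd h (hself 3)
    all_goals have := hnn _ _ h; linarith

theorem eventually_norm_upperRoot_eq (hτ : 0 < τ) (hZ : 0 ≤ Z) (hp : OuterPair i i') :
    ∀ᶠ ξ in atTop, ‖upperRoot t τ i Z ξ‖ = ‖upperRoot t τ i' Z ξ‖ := by
  filter_upwards [eventually_gt_atTop 0, eventually_ge_atTop (xiCr t τ), eventually_gt_atTop Z]
    with ξ hξ hcr hlt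
  have hb : (√Z) ^ 2 < 4 * bOne t τ ξ := by
    rw [Real.sq_sqrt hZ, bOne_eq t τ hξ.le]
    have := aOne_pos t τ hξ
    have : 0 < τ ^ 2 * aOne t τ ξ := by positivity
    linarith
  have h1 := norm_symbolRoots_eq hτ hξ _ hb hp
  have h2 := isSortedRoots_sq (t := t) (τ := τ) hξ hcr (√Z : ℝ)
  have e : ((√Z : ℝ) : ℂ) ^ 2 = (Z : ℂ) := by rw [← Complex.ofReal_pow, Real.sq_sqrt hZ]
  rw [e] at h2
  have h3 := fun j => h2.norm_eq (isSortedRoots_symbolRoots (coef t τ ξ) Z) j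
  rw [norm_upperRoot, norm_upperRoot, ← h3, ← h3, norm_pow, norm_pow, h1]

theorem tendsto_potGap_atTop (hτ : 0 < τ) (hZ : 0 ≤ Z) (hp : OuterPair i i') :
    Tendsto (potGap t τ i i' Z) atTop (𝓝 0) := by
  refine tendsto_const_nhds.congr' ?_
  filter_upwards [eventually_norm_upperRoot_eq (t := t) hτ hZ hp, eventually_gt_atTop 0] with ξ h hξ
  rw [potGap, upperRoot_eq_of_norm_eq hτ hξ h, sub_self]

/-- The integral of the logarithmic gap over all `ξ` is minus the limit at `ξ = 0` of the
difference of the potentials. -/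
theorem integral_logGap_Ioi (hτ : 0 < τ) (hZ : 0 ≤ Z) (hp : OuterPair i i') {G0 : ℝ}
    (hlim : Tendsto (potGap t τ i i' Z) (𝓝[>] 0) (𝓝 G0)) :
    IntegrableOn (logGap t τ i i' Z) (Ioi 0) ∧ ∫ ξ in Ioi 0, logGap t τ i i' Z ξ = -G0 := by
  set g := Function.update (potGap t τ i i' Z) 0 G0 with hg
  have hg0 : g 0 = G0 := by simp [hg]
  have hgs : ∀ y, 0 < y → g =ᶠ[𝓝 y] potGap t τ i i' Z := by
    intro y hy
    filter_upwards [Ioi_mem_nhds hy] with z hz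
    exact Function.update_of_ne (ne_of_gt hz) _ _
  have hcont : ContinuousWithinAt g (Ici 0) 0 := by
    rw [← continuousWithinAt_Ioi_iff_Ici, ContinuousWithinAt, hg0]
    refine hlim.congr' ?_
    filter_upwards [self_mem_nhdsWithin] with z hz
    exact (Function.update_of_ne (ne_of_gt hz) _ _).symm
  have hder : ∀ y ∈ Ioi (0 : ℝ), HasDerivAt g (logGap t τ i i' Z y) y := fun y hy =>
    (hasDerivAt_potGap hτ hZ hp hy).congr_of_eventuallyEq (hgs y hy)
  have hpos : ∀ y ∈ Ioi (0 : ℝ), 0 ≤ logGap t τ i i' Z y := fun y hy => logGap_nonneg hτ hy hp.le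
  have htop : Tendsto g atTop (𝓝 0) := by
    refine (tendsto_potGap_atTop (t := t) hτ hZ hp).congr' ?_
    filter_upwards [eventually_gt_atTop 0] with z hz
    exact (Function.update_of_ne (ne_of_gt hz) _ _).symm
  refine ⟨integrableOn_Ioi_deriv_of_nonneg hcont hder hpos htop, ?_⟩
  rw [integral_Ioi_of_hasDerivAt_of_nonneg hcont hder hpos htop, hg0, zero_sub]

end TwoMatrix

namespace TwoMatrix

/-! ### The limit of small parameters -/

/-- The limit of `aSum` at `ξ = 0`. -/
noncomputable def aLim (t τ : ℝ) : ℝ := max (τ ^ 2 - t) 0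

variable {t τ ξ Z : ℝ} {i i' j : Fin 4}

theorem aOne_zero (t τ : ℝ) : aOne t τ 0 = (τ ^ 2 - t + |τ ^ 2 - t|) / 6 := by
  rw [aOne, mul_zero, add_zero, Real.sqrt_sq_eq_abs]

theorem aSum_zero (t τ : ℝ) : aSum t τ 0 = aLim t τ := by
  rw [aSum, aLim, aOne_zero]
  rcases le_total 0 (τ ^ 2 - t) with h | h
  · rw [abs_of_nonneg h, max_eq_left (by linarith), max_eq_left h]
  · rw [abs_of_nonpos h]; simp

theorem aProd_zero (t τ : ℝ) : aProd t τ 0 = 0 := min_eq_left (sq_nonneg _)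

/-- Either `s = 0` or `s + t = τ²`, for the limit `s` of `aSum`. -/
theorem aLim_mul (t τ : ℝ) : aLim t τ * (aLim t τ + t - τ ^ 2) = 0 := by
  rw [aLim]
  rcases le_total 0 (τ ^ 2 - t) with h | h
  · rw [max_eq_left h]; ring
  · rw [max_eq_right h]; ring

/-- The rescaled reciprocals `τ² a₀ a₁ / W` of the roots. -/
noncomputable def scaledInv (t τ : ℝ) (j : Fin 4) (Z ξ : ℝ) : ℂ :=
  ((τ ^ 2 * aProd t τ ξ : ℝ) : ℂ) / symbolRoots (coef t τ ξ) Z j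

theorem isSortedRoots_scaledInv (hτ : 0 < τ) (hξ : 0 < ξ) : IsSortedRoots
    (fun i => ((![3 * aSum t τ ξ + 2 * t,
      τ ^ 2 * aSum t τ ξ + 2 * aSum t τ ξ ^ 2 + aProd t τ ξ + 3 * t * aSum t τ ξ + t ^ 2,
      τ ^ 2 * (aSum t τ ξ ^ 2 + 2 * aProd t τ ξ + t * aSum t τ ξ - Z),
      τ ^ 4 * aProd t τ ξ] i : ℝ) : ℂ))
    ![scaledInv t τ 3 Z ξ, scaledInv t τ 2 Z ξ, scaledInv t τ 1 Z ξ, scaledInv t τ 0 Z ξ] := by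
  have hP := aProd_pos t τ hξ
  have hP' : (aProd t τ ξ : ℂ) ≠ 0 := by exact_mod_cast hP.ne'
  have hτ' : (τ : ℂ) ≠ 0 := by exact_mod_cast hτ.ne'
  have h3 : symbolCoef (coef t τ ξ) Z 3 ≠ 0 := by
    simp [symbolCoef, coef, hτ', hP']
  have h := (isSortedRoots_symbolRoots (coef t τ ξ) (Z : ℂ)).reverse h3 (τ ^ 2 * aProd t τ ξ : ℝ)
  convert h using 1
  · funext i
    fin_cases i <;> simp [symbolCoef, coef] <;> field_simp <;> ring
  · rfl

theorem IsSortedRoots.eq_zero_three {q ρ : Fin 4 → ℂ} (h : IsSortedRoots q ρ) (h0 : q 3 = 0) :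
    ρ 3 = 0 := by
  have h3 := h.v3
  rw [h0] at h3
  have key : ∀ i, ρ i = 0 → ρ 3 = 0 := fun i hi => by
    have := h.norm_antitone (show i ≤ 3 by omega)
    rw [hi, norm_zero] at this
    exact norm_le_zero_iff.1 this
  rcases mul_eq_zero.1 h3 with h4 | h4
  · rcases mul_eq_zero.1 h4 with h5 | h5
    · rcases mul_eq_zero.1 h5 with h6 | h6
      · exact key _ h6
      · exact key _ h6
    · exact key _ h5
  · exact h4

/-- Limits of the roots and of their rescaled reciprocals as `ξ → 0`. The `o j` are the solutions
of `M (M + t)² = τ² Z`, in the order of increasing distance from `aLim t τ`. -/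
structure LimitData (t τ Z : ℝ) (U : Ultrafilter ℝ) (o : Fin 4 → ℂ) : Prop where
  v0 : o 1 + o 2 + o 3 = -2 * t
  v1 : o 1 * o 2 + o 1 * o 3 + o 2 * o 3 = t ^ 2
  v2 : o 1 * o 2 * o 3 = τ ^ 2 * Z
  le12 : ‖o 1 - aLim t τ‖ ≤ ‖o 2 - aLim t τ‖
  le23 : ‖o 2 - aLim t τ‖ ≤ ‖o 3 - aLim t τ‖
  root0 : Tendsto (fun ξ => symbolRoots (coef t τ ξ) Z 0) U (𝓝 (Z - τ ^ 2 * aLim t τ : ℝ))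
  root : ∀ j, j ≠ 0 → Tendsto (fun ξ => symbolRoots (coef t τ ξ) Z j) U (𝓝 0)
  inv0 : Tendsto (fun ξ => scaledInv t τ 0 Z ξ) U (𝓝 0)
  inv : ∀ j, j ≠ 0 → Tendsto (fun ξ => scaledInv t τ j Z ξ) U (𝓝 (o j - aLim t τ))

theorem exists_limitData (hτ : 0 < τ) (Z : ℝ) (U : Ultrafilter ℝ) (hU : (U : Filter ℝ) ≤ 𝓝[>] 0) :
    ∃ o, LimitData t τ Z U o := by
  have hU0 : (U : Filter ℝ) ≤ 𝓝 0 := hU.trans nhdsWithin_le_nhds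
  have hpos : ∀ᶠ ξ in (U : Filter ℝ), 0 < ξ := hU self_mem_nhdsWithin
  have hS := continuous_aSum t τ
  have hP := continuous_aProd t τ
  set s := aLim t τ with hs
  have hs0 := aLim_mul t τ
  rw [← hs] at hs0
  have hs0' : (s : ℂ) * (s + t - τ ^ 2) = 0 := by exact_mod_cast hs0
  -- the roots
  have hq1 : Tendsto (fun ξ => symbolCoef (coef t τ ξ) (Z : ℂ)) U
      (𝓝 (symbolCoef (coef t τ 0) (Z : ℂ))) :=
    ((continuous_symbolCoef.comp ((continuous_coef t τ).prodMk continuous_const)).tendsto 0).mono_left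
      hU0
  obtain ⟨ρ, hρ, hρlim⟩ := exists_tendsto_sortedRoots U hq1
    (Eventually.of_forall fun ξ => isSortedRoots_symbolRoots (coef t τ ξ) (Z : ℂ))
  have r3 : ρ 3 = 0 := hρ.eq_zero_three (by simp [symbolCoef, coef, aProd_zero])
  have r2 : ρ 2 = 0 := by
    have := hρ.v2
    simp [symbolCoef, coef, aProd_zero, r3] at this
    rcases this with (h | h) | h
    · have := hρ.norm_antitone (show (0 : Fin 4) ≤ 2 by decide); rw [h, norm_zero] at this
      exact norm_le_zero_iff.1 this
    · have := hρ.norm_antitone (show (1 : Fin 4) ≤ 2 by decide); rw [h, norm_zero] at this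
      exact norm_le_zero_iff.1 this
    · exact h
  have r1 : ρ 1 = 0 := by
    have := hρ.v1
    simp [symbolCoef, coef, aProd_zero, r3, r2] at this
    rcases this with h | h
    · have := hρ.norm_antitone (show (0 : Fin 4) ≤ 1 by decide); rw [h, norm_zero] at this
      exact norm_le_zero_iff.1 this
    · exact h
  have r0 : ρ 0 = (Z - τ ^ 2 * s : ℝ) := by
    have := hρ.v0
    simp [symbolCoef, coef, aProd_zero, aSum_zero, r1, r2, r3] at this
    rw [this, ← hs]; push_cast; linear_combination -hs0'
  -- the rescaled reciprocals
  obtain ⟨m, hm, hmlim⟩ := exists_tendsto_sortedRoots U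
    (q := fun ξ i => ((![3 * aSum t τ ξ + 2 * t,
      τ ^ 2 * aSum t τ ξ + 2 * aSum t τ ξ ^ 2 + aProd t τ ξ + 3 * t * aSum t τ ξ + t ^ 2,
      τ ^ 2 * (aSum t τ ξ ^ 2 + 2 * aProd t τ ξ + t * aSum t τ ξ - Z),
      τ ^ 4 * aProd t τ ξ] i : ℝ) : ℂ))
    (q0 := fun i => ((![3 * aSum t τ 0 + 2 * t,
      τ ^ 2 * aSum t τ 0 + 2 * aSum t τ 0 ^ 2 + aProd t τ 0 + 3 * t * aSum t τ 0 + t ^ 2,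
      τ ^ 2 * (aSum t τ 0 ^ 2 + 2 * aProd t τ 0 + t * aSum t τ 0 - Z),
      τ ^ 4 * aProd t τ 0] i : ℝ) : ℂ)) (by
        refine tendsto_pi_nhds.2 fun i => (Complex.continuous_ofReal.tendsto _).comp ?_
        refine Tendsto.mono_left ?_ hU0
        refine Continuous.tendsto (f := fun ξ => (![3 * aSum t τ ξ + 2 * t,
          τ ^ 2 * aSum t τ ξ + 2 * aSum t τ ξ ^ 2 + aProd t τ ξ + 3 * t * aSum t τ ξ + t ^ 2,
          τ ^ 2 * (aSum t τ ξ ^ 2 + 2 * aProd t τ ξ + t * aSum t τ ξ - Z),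
          τ ^ 4 * aProd t τ ξ] i : ℝ)) ?_ 0
        fin_cases i <;> simp <;> fun_prop)
    (hpos.mono fun ξ hξ => isSortedRoots_scaledInv hτ hξ)
  have m3 : m 3 = 0 := hm.eq_zero_three (by simp [aProd_zero])
  have e0 := hm.v0
  have e1 := hm.v1
  have e2 := hm.v2
  simp only [aProd_zero, aSum_zero, m3, ← hs] at e0 e1 e2
  simp at e0 e1 e2
  have l := tendsto_pi_nhds.1 hmlim
  have l0 := l 0
  have l1 := l 1
  have l2 := l 2
  have l3 := l 3
  rw [m3] at l3
  simp at l0 l1 l2 l3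
  refine ⟨![0, m 2 + s, m 1 + s, m 0 + s], ?_, ?_, ?_, ?_, ?_, ?_, ?_, l3, ?_⟩
  · simp; linear_combination e0
  · simp; linear_combination e1 + 2 * s * e0 - hs0'
  · simp; linear_combination e2 + s * e1 + s ^ 2 * e0 + t * hs0'
  · simpa [← hs] using hm.le21
  · simpa [← hs] using hm.le10
  · rw [← hs, ← r0]; exact tendsto_pi_nhds.1 hρlim 0
  · intro j hj
    fin_cases j
    · exact absurd rfl hj
    · have := tendsto_pi_nhds.1 hρlim 1; rwa [r1] at this
    · have := tendsto_pi_nhds.1 hρlim 2; rwa [r2] at this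
    · have := tendsto_pi_nhds.1 hρlim 3; rwa [r3] at this
  · intro j hj
    fin_cases j
    · exact absurd rfl hj
    all_goals simp [← hs]; assumption

/-- `ξ log |W|` tends to zero. -/
theorem LimitData.tendsto_mul_log (hτ : 0 < τ) {U : Ultrafilter ℝ} (hU : (U : Filter ℝ) ≤ 𝓝[>] 0)
    {o : Fin 4 → ℂ} (h : LimitData t τ Z U o) (j : Fin 4) :
    Tendsto (fun ξ => ξ * Real.log ‖symbolRoots (coef t τ ξ) Z j‖) U (𝓝 0) := by
  have hU0 : (U : Filter ℝ) ≤ 𝓝 0 := hU.trans nhdsWithin_le_nhds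
  have hpos : ∀ᶠ ξ in (U : Filter ℝ), 0 < ξ := hU self_mem_nhdsWithin
  -- an upper bound for the largest root
  set C := ‖((Z - τ ^ 2 * aLim t τ : ℝ) : ℂ)‖ + 1 with hC
  have hC0 : 0 < C := by positivity
  have hup : ∀ᶠ ξ in (U : Filter ℝ), ‖symbolRoots (coef t τ ξ) Z 0‖ < C :=
    h.root0.norm.eventually (gt_mem_nhds (by rw [hC]; linarith))
  -- a lower bound for the smallest root
  set B := ‖o 3 - aLim t τ‖ + 1 with hB
  have hB0 : 0 < B := by positivity
  have hlow : ∀ᶠ ξ in (U : Filter ℝ), ‖scaledInv t τ 3 Z ξ‖ < B :=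
    (h.inv 3 (by decide)).norm.eventually (gt_mem_nhds (by rw [hB]; linarith))
  set K := |3 * aOne t τ 0 - (τ ^ 2 - t)| + 1 with hK
  have hK1 : 1 ≤ K := by rw [hK]; linarith [abs_nonneg (3 * aOne t τ 0 - (τ ^ 2 - t))]
  have hKev : ∀ᶠ ξ in (U : Filter ℝ), 3 * aOne t τ ξ - (τ ^ 2 - t) < K := by
    have : Continuous fun ξ => 3 * aOne t τ ξ - (τ ^ 2 - t) := by
      have := continuous_aOne t τ; fun_prop
    exact hU0 ((this.tendsto 0).eventually (gt_mem_nhds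
      (by rw [hK]; linarith [le_abs_self (3 * aOne t τ 0 - (τ ^ 2 - t))])))
  have hlt1 : ∀ᶠ ξ in (U : Filter ℝ), ξ < 1 := hU0 (gt_mem_nhds (by norm_num))
  have hbound : ∀ᶠ ξ in (U : Filter ℝ), τ ^ 2 / (K ^ 2 * B) * ξ ^ 2 ≤
      ‖symbolRoots (coef t τ ξ) Z 3‖ := by
    filter_upwards [hpos, hlow, hKev, hlt1] with ξ hξ hl hk h1
    have ha := aOne_pos t τ hξ
    have e := aOne_eq t τ hξ.le
    have hPlow : ξ ^ 2 / K ^ 2 ≤ aProd t τ ξ := by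
      refine le_min ?_ ?_
      · rw [div_le_iff₀ (by positivity)]
        have : 1 ≤ K ^ 2 := one_le_pow₀ hK1
        nlinarith
      · rw [← div_pow]
        refine pow_le_pow_left₀ (by positivity) ?_ 2
        rw [div_le_iff₀ (by positivity)]
        nlinarith
    obtain ⟨ζ, hζ⟩ := exists_negZeros (t := t) hτ hξ
    have hW : 0 < ‖symbolRoots (coef t τ ξ) (Z : ℂ) 3‖ := norm_pos_iff.2
      (hζ.root_ne_zero ((isSortedRoots_symbolRoots _ _).root 3))
    have hPp := aProd_pos t τ hξ
    rw [scaledInv, norm_div, Complex.norm_real, Real.norm_eq_abs, abs_of_pos (by positivity),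
      div_lt_iff₀ hW] at hl
    have : τ ^ 2 * (ξ ^ 2 / K ^ 2) ≤ B * ‖symbolRoots (coef t τ ξ) (Z : ℂ) 3‖ :=
      (mul_le_mul_of_nonneg_left hPlow (sq_nonneg τ)).trans hl.le
    calc _ = τ ^ 2 * (ξ ^ 2 / K ^ 2) / B := by field_simp
      _ ≤ _ := by rw [div_le_iff₀ hB0]; linarith
  set c := τ ^ 2 / (K ^ 2 * B) with hc
  have hc0 : 0 < c := by positivity
  have hid : Tendsto (fun ξ : ℝ => ξ) U (𝓝 0) := hU0
  have hxlog : Tendsto (fun ξ : ℝ => ξ * Real.log ξ) U (𝓝 0) := by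
    have := Real.continuous_mul_log.tendsto 0
    simp at this
    exact this.mono_left hU0
  have hlo : Tendsto (fun ξ : ℝ => ξ * Real.log c + 2 * (ξ * Real.log ξ)) U (𝓝 0) := by
    simpa using (hid.mul_const (Real.log c)).add (hxlog.const_mul 2)
  have hhi : Tendsto (fun ξ : ℝ => ξ * Real.log C) U (𝓝 0) := by
    simpa using hid.mul_const (Real.log C)
  refine tendsto_of_tendsto_of_tendsto_of_le_of_le' hlo hhi ?_ ?_
  · filter_upwards [hpos, hbound] with ξ hξ hb
    have h3 := (isSortedRoots_symbolRoots (coef t τ ξ) (Z : ℂ)).norm_antitone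
      (show j ≤ 3 by omega)
    have h4 := Real.log_le_log (by positivity) (hb.trans h3)
    rw [Real.log_mul hc0.ne' (by positivity), Real.log_pow] at h4
    have := mul_le_mul_of_nonneg_left h4 hξ.le
    push_cast at this
    linarith
  · filter_upwards [hpos, hup, hbound] with ξ hξ hu hb
    have h3 := (isSortedRoots_symbolRoots (coef t τ ξ) (Z : ℂ)).norm_antitone
      (show j ≤ 3 by omega)
    have h0 := (isSortedRoots_symbolRoots (coef t τ ξ) (Z : ℂ)).norm_antitone
      (show 0 ≤ j by omega)
    have hp : 0 < ‖symbolRoots (coef t τ ξ) (Z : ℂ) j‖ :=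
      lt_of_lt_of_le (by positivity) (hb.trans h3)
    exact mul_le_mul_of_nonneg_left (Real.log_le_log hp (h0.trans hu.le)) hξ.le

theorem potential_upper (W : ℂ) (ξ : ℝ) : potential t τ (upper W) ξ = potential t τ W ξ := by
  rcases upper_eq W with h | h <;> rw [h]
  rw [potential, potential, Complex.norm_conj]
  congr 2
  rw [← Complex.conj_re]
  simp [map_ofNat]

theorem potential_symbolRoots : potential t τ (upperRoot t τ j Z ξ) ξ =
    1 / 2 * (ξ * Real.log ‖symbolRoots (coef t τ ξ) Z j‖) -
    1 / 2 * (symbolRoots (coef t τ ξ) Z j + (3 * aSum t τ ξ + t : ℝ) * scaledInv t τ j Z ξ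
      + 3 / 2 * scaledInv t τ j Z ξ ^ 2).re := by
  rw [upperRoot, potential_upper, potential, scaledInv]
  congr 3
  push_cast
  ring

/-- For the outermost root the rescaled reciprocal tends to zero, and only the linear term of the
potential, in the root itself, contributes to the limit. -/
theorem LimitData.tendsto_potential_zero (hτ : 0 < τ) {U : Ultrafilter ℝ}
    (hU : (U : Filter ℝ) ≤ 𝓝[>] 0) {o : Fin 4 → ℂ} (h : LimitData t τ Z U o) :
    Tendsto (fun ξ => potential t τ (upperRoot t τ 0 Z ξ) ξ) U
      (𝓝 (-(1 / 2 * (Z - τ ^ 2 * aLim t τ)))) := by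
  have hU0 : (U : Filter ℝ) ≤ 𝓝 0 := hU.trans nhdsWithin_le_nhds
  have hpos : ∀ᶠ ξ in (U : Filter ℝ), 0 < ξ := hU self_mem_nhdsWithin
  have hS : Tendsto (fun ξ => ((3 * aSum t τ ξ + t : ℝ) : ℂ)) U (𝓝 (3 * aLim t τ + t : ℝ)) := by
    have : Continuous fun ξ => ((3 * aSum t τ ξ + t : ℝ) : ℂ) := by
      have := continuous_aSum t τ; fun_prop
    have := (this.tendsto 0).mono_left hU0
    rwa [aSum_zero] at this
  have h1 := (h.tendsto_mul_log hτ hU 0).const_mul (1 / 2)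
  have h2 := (h.root0.add (hS.mul h.inv0)).add ((h.inv0.pow 2).const_mul (3 / 2))
  have h3 := ((Complex.continuous_re.tendsto _).comp h2).const_mul (1 / 2)
  have h4 := h1.sub h3
  have e : 1 / 2 * 0 - 1 / 2 * (((Z - τ ^ 2 * aLim t τ : ℝ) : ℂ) + (3 * aLim t τ + t : ℝ) * 0
      + 3 / 2 * 0 ^ 2).re = -(1 / 2 * (Z - τ ^ 2 * aLim t τ)) := by
    have : ((Z - τ ^ 2 * aLim t τ : ℝ) : ℂ) + (3 * aLim t τ + t : ℝ) * 0 + 3 / 2 * 0 ^ 2 =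
      ((Z - τ ^ 2 * aLim t τ : ℝ) : ℂ) := by ring
    rw [this, Complex.ofReal_re]; ring
  rw [e] at h4
  exact h4.congr fun ξ => potential_symbolRoots.symm

theorem LimitData.tendsto_potential (hτ : 0 < τ) {U : Ultrafilter ℝ}
    (hU : (U : Filter ℝ) ≤ 𝓝[>] 0) {o : Fin 4 → ℂ} (h : LimitData t τ Z U o) (hj : j ≠ 0) :
    Tendsto (fun ξ => potential t τ (upperRoot t τ j Z ξ) ξ) U
      (𝓝 (-(3 / 4 * o j ^ 2 + 1 / 2 * t * o j).re +
        (3 / 4 * aLim t τ ^ 2 + 1 / 2 * t * aLim t τ))) := by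
  have hU0 : (U : Filter ℝ) ≤ 𝓝 0 := hU.trans nhdsWithin_le_nhds
  have hpos : ∀ᶠ ξ in (U : Filter ℝ), 0 < ξ := hU self_mem_nhdsWithin
  have hS : Tendsto (fun ξ => ((3 * aSum t τ ξ + t : ℝ) : ℂ)) U (𝓝 (3 * aLim t τ + t : ℝ)) := by
    have : Continuous fun ξ => ((3 * aSum t τ ξ + t : ℝ) : ℂ) := by
      have := continuous_aSum t τ; fun_prop
    have := (this.tendsto 0).mono_left hU0
    rwa [aSum_zero] at this
  have h1 := (h.tendsto_mul_log hτ hU j).const_mul (1 / 2)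
  have h2 := ((h.root j hj).add (hS.mul (h.inv j hj))).add (((h.inv j hj).pow 2).const_mul (3 / 2))
  have h3 := ((Complex.continuous_re.tendsto _).comp h2).const_mul (1 / 2)
  have h4 := h1.sub h3
  have e : 1 / 2 * 0 - 1 / 2 * ((0 : ℂ) + (3 * aLim t τ + t : ℝ) * (o j - aLim t τ)
      + 3 / 2 * (o j - aLim t τ) ^ 2).re = -(3 / 4 * o j ^ 2 + 1 / 2 * t * o j).re +
        (3 / 4 * aLim t τ ^ 2 + 1 / 2 * t * aLim t τ) := by
    have : (0 : ℂ) + (3 * aLim t τ + t : ℝ) * (o j - aLim t τ) + 3 / 2 * (o j - aLim t τ) ^ 2 =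
      ((2 : ℝ) : ℂ) * (3 / 4 * o j ^ 2 + 1 / 2 * t * o j) -
        ((3 / 2 * aLim t τ ^ 2 + t * aLim t τ : ℝ) : ℂ) := by push_cast; ring
    rw [this, Complex.sub_re, Complex.re_ofReal_mul, Complex.ofReal_re]; ring
  rw [e] at h4
  exact h4.congr fun ξ => potential_symbolRoots.symm

/-- The absolute values make the statement independent of which of two conjugate roots is
numbered first. -/
theorem LimitData.tendsto_coordProd_im {U : Ultrafilter ℝ}
    (hU : (U : Filter ℝ) ≤ 𝓝[>] 0) {o : Fin 4 → ℂ} (h : LimitData t τ Z U o) (hj : j ≠ 0) :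
    Tendsto (fun ξ => |(coordProd t τ (upperRoot t τ j Z ξ) ξ).im|) U
      (𝓝 |(o j ^ 2 + t * o j).im|) := by
  have hU0 : (U : Filter ℝ) ≤ 𝓝 0 := hU.trans nhdsWithin_le_nhds
  have hS : Tendsto (fun ξ => ((2 * aSum t τ ξ + t : ℝ) : ℂ)) U (𝓝 (2 * aLim t τ + t : ℝ)) := by
    have : Continuous fun ξ => ((2 * aSum t τ ξ + t : ℝ) : ℂ) := by
      have := continuous_aSum t τ; fun_prop
    have := (this.tendsto 0).mono_left hU0
    rwa [aSum_zero] at this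
  have h2 := ((h.root j hj).add (hS.mul (h.inv j hj))).add ((h.inv j hj).pow 2)
  have h3 := ((Complex.continuous_im.tendsto _).comp h2).abs
  have e : (0 : ℂ) + (2 * aLim t τ + t : ℝ) * (o j - aLim t τ) + (o j - aLim t τ) ^ 2 =
      (o j ^ 2 + t * o j) - ((aLim t τ ^ 2 + t * aLim t τ : ℝ) : ℂ) := by push_cast; ring
  rw [e, Complex.sub_im, Complex.ofReal_im, sub_zero] at h3
  refine h3.congr fun ξ => ?_
  have key : coordProd t τ (symbolRoots (coef t τ ξ) Z j) ξ = symbolRoots (coef t τ ξ) Z j +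
      (2 * aSum t τ ξ + t : ℝ) * scaledInv t τ j Z ξ + scaledInv t τ j Z ξ ^ 2 := by
    rw [coordProd, scaledInv]; push_cast; ring
  simp only [Function.comp]
  rw [← key, upperRoot]
  rcases upper_eq (symbolRoots (coef t τ ξ) (Z : ℂ) j) with h | h <;> rw [h]
  rw [← abs_neg, ← Complex.conj_im]
  simp [coordProd, map_ofNat]

end TwoMatrix

namespace TwoMatrix

/-! ### The cubic equation on the real line -/

variable {t τ ξ Z x : ℝ} {i i' j : Fin 4}

theorem mem_sortedRoots_cubic (t y r : ℝ) :
    r ∈ sortedRoots (X ^ 3 + C t * X - C y : ℝ[X]) ↔ r ^ 3 + t * r = y := by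
  rw [← Multiset.mem_coe, coe_sortedRoots, mem_roots (Monic.ne_zero (by monicity!)), IsRoot]
  simp [sub_eq_zero]

theorem exists_real_root_cubic (t y : ℝ) : ∃ r : ℝ, r ^ 3 + t * r = y := by
  set B := |t| + |y| + 1 with hB
  have h1 := abs_nonneg t
  have h2 := abs_nonneg y
  have hB1 : 1 ≤ B := by linarith
  have key : |y| ≤ B ^ 3 + t * B := by
    have : |y| + 1 ≤ B ^ 2 + t := by nlinarith [neg_abs_le t]
    nlinarith
  have hc : Continuous fun r : ℝ => r ^ 3 + t * r := by fun_prop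
  refine mem_range_of_exists_le_of_exists_ge hc ⟨-B, ?_⟩ ⟨B, ?_⟩
  · linarith [neg_abs_le y]
  · linarith [le_abs_self y]

theorem ωReal_one_root (t τ x : ℝ) :
    ωReal t τ 1 x ^ 3 + t * ωReal t τ 1 x = τ * x ∧
    ∀ r : ℝ, r ^ 3 + t * r = τ * x → |r| ≤ |ωReal t τ 1 x| := by
  obtain ⟨r, hr⟩ := exists_real_root_cubic t (τ * x)
  have hm := fun r => mem_sortedRoots_cubic t (τ * x) r
  have hp := pairwise_sortedRoots (X ^ 3 + C t * X - C (τ * x) : ℝ[X])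
  rw [ωReal]
  generalize sortedRoots (X ^ 3 + C t * X - C (τ * x) : ℝ[X]) = l at hm hp ⊢
  rcases l with _ | ⟨a, l⟩
  · exact absurd ((hm r).2 hr) (by simp)
  · simp only [Nat.sub_self, List.getD_cons_zero]
    refine ⟨(hm a).1 (by simp), fun r hr => ?_⟩
    rcases List.mem_cons.1 ((hm r).2 hr) with rfl | h
    · exact le_rfl
    · exact (List.pairwise_cons.1 hp).1 r h

theorem ωReal_one_sq_add (t τ x : ℝ) : 0 ≤ ωReal t τ 1 x ^ 2 + t := by
  obtain ⟨h1, h2⟩ := ωReal_one_root t τ x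
  set ω := ωReal t τ 1 x
  by_contra! hlt
  set D := √(-(3 * ω ^ 2 + 4 * t)) with hD
  have hD2 : D ^ 2 = -(3 * ω ^ 2 + 4 * t) := Real.sq_sqrt (by nlinarith [sq_nonneg ω])
  have hDω : |ω| < D := by
    rw [← Real.sqrt_sq_eq_abs]; exact Real.sqrt_lt_sqrt (sq_nonneg _) (by linarith)
  have a1 := h2 ((-ω + D) / 2) (by
    rw [← h1]; linear_combination (-3 * ω + D) / 8 * hD2)
  have a2 := h2 ((-ω - D) / 2) (by
    rw [← h1]; linear_combination (-3 * ω - D) / 8 * hD2)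
  rw [abs_le] at a1 a2
  rcases le_total 0 ω with h | h
  · rw [abs_of_nonneg h] at *; linarith
  · rw [abs_of_nonpos h] at *; linarith

/-- If the discriminant is not negative, there are three real solutions. -/
theorem ωReal_vieta (h : 3 * ωReal t τ 1 x ^ 2 + 4 * t ≤ 0) :
    ωReal t τ 1 x + ωReal t τ 2 x + ωReal t τ 3 x = 0 ∧
    ωReal t τ 1 x * ωReal t τ 2 x + ωReal t τ 1 x * ωReal t τ 3 x +
      ωReal t τ 2 x * ωReal t τ 3 x = t ∧
    ωReal t τ 1 x * ωReal t τ 2 x * ωReal t τ 3 x = τ * x ∧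
    |ωReal t τ 3 x| ≤ |ωReal t τ 2 x| := by
  obtain ⟨h1, -⟩ := ωReal_one_root t τ x
  have hp := pairwise_sortedRoots (X ^ 3 + C t * X - C (τ * x) : ℝ[X])
  have hc := coe_sortedRoots (X ^ 3 + C t * X - C (τ * x) : ℝ[X])
  set ω := ωReal t τ 1 x with hω
  set D := √(-(3 * ω ^ 2 + 4 * t)) with hD
  have hD2 : D ^ 2 = -(3 * ω ^ 2 + 4 * t) := Real.sq_sqrt (by linarith)
  have hfac : (X ^ 3 + C t * X - C (τ * x) : ℝ[X]) =
      (([ω, (-ω + D) / 2, (-ω - D) / 2] : Multiset ℝ).map (fun a => X - C a)).prod := by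
    refine Polynomial.funext fun r => ?_
    simp
    linear_combination h1 + (r - ω) / 4 * hD2
  have hprod : (X ^ 3 + C t * X - C (τ * x) : ℝ[X]) =
      ((sortedRoots (X ^ 3 + C t * X - C (τ * x) : ℝ[X]) : Multiset ℝ).map
        (fun a => X - C a)).prod := by
    rw [hc]; nth_rw 2 [hfac]; rw [roots_multiset_prod_X_sub_C]; exact hfac
  have hlen : (sortedRoots (X ^ 3 + C t * X - C (τ * x) : ℝ[X])).length = 3 := by
    rw [← Multiset.coe_card, hc, hfac, roots_multiset_prod_X_sub_C]; rfl
  simp only [hω, ωReal] at *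
  generalize sortedRoots (X ^ 3 + C t * X - C (τ * x) : ℝ[X]) = l at hp hprod hlen ⊢
  match l, hlen with
  | [a, b, c], _ =>
    have h0 := congrArg (Polynomial.eval 0) hprod
    have h1 := congrArg (Polynomial.eval 1) hprod
    have h2 := congrArg (Polynomial.eval (-1)) hprod
    simp at h0 h1 h2 hp ⊢
    exact ⟨by linear_combination (h1 + h2) / 2 + h0, by linear_combination -(h1 - h2) / 2,
      by linear_combination -h0, hp.2⟩

/-! ### Identification of the external fields -/

/-- Among the solutions of `M (M + t)² = m (m + t)²`, the one with `m + t ≥ 0` is closest to the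
limit of `aSum`. -/
theorem norm_sub_aLim_lt (hτ : 0 < τ) {m : ℝ} (hm : 0 ≤ m) (hmt : 0 ≤ m + t) {M : ℂ}
    (hM : M ^ 2 + (2 * t + m) * M + (t + m) ^ 2 = 0) (hne : M ≠ m) :
    ‖(m : ℂ) - aLim t τ‖ < ‖M - aLim t τ‖ := by
  have hτ2 : 0 < τ ^ 2 := by positivity
  have hpos : ¬ (m = 0 ∧ t = 0) := by
    rintro ⟨rfl, rfl⟩
    apply hne
    simpa using hM
  have hre := congrArg Complex.re hM
  have him := congrArg Complex.im hM
  simp [pow_two] at hre him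
  have hsq : (m - aLim t τ) ^ 2 < (M.re - aLim t τ) ^ 2 + M.im ^ 2 := by
    by_cases hi : M.im = 0
    · -- a real solution `M` satisfies `M + t ≤ 0` and `m + t ≤ |M + t|`
      rw [hi] at hre ⊢
      set R := M.re with hR
      have hneR : R ≠ m := fun h => hne (Complex.ext (by simp [← hR, h]) (by simp [hi]))
      have hq : (R + t) ^ 2 + m * (R + t) + m * (m + t) = 0 := by linear_combination hre
      have hR0 : R + t ≤ 0 := by
        by_contra! hlt
        have h1 := mul_nonneg hm hlt.le
        have h2 := mul_nonneg hm hmt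
        nlinarith
      have hS : m = 0 ∨ m + t ≤ -(R + t) := by
        rcases hm.eq_or_lt with h | h
        · exact Or.inl h.symm
        · right; by_contra! hlt; nlinarith
      rw [aLim]
      rcases le_total 0 (τ ^ 2 - t) with h | h
      · rw [max_eq_left h]
        have hlt : (m + t - τ ^ 2) < -(R + t) + τ ^ 2 ∧ -(-(R + t) + τ ^ 2) < m + t - τ ^ 2 := by
          rcases hS with rfl | hS
          · refine ⟨by linarith, ?_⟩
            have : R + t = 0 := by
              have : (R + t) ^ 2 = 0 := by linear_combination hq
              exact pow_eq_zero_iff two_ne_zero |>.1 this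
            have : t ≠ 0 := fun h => hpos ⟨rfl, h⟩
            have : 0 < t := lt_of_le_of_ne (by linarith) (Ne.symm this)
            linarith
          · refine ⟨by linarith, ?_⟩
            by_contra! hle
            exact hneR (by linarith)
        nlinarith
      · rw [max_eq_right h]
        have hm0 : m = 0 := by
          rcases hS with h | h
          · exact h
          · nlinarith [sq_nonneg (2 * (R + t) + m)]
        rw [hm0] at hq ⊢
        have : R + t = 0 := by
          have : (R + t) ^ 2 = 0 := by linear_combination hq
          exact pow_eq_zero_iff two_ne_zero |>.1 this
        have : R = -t := by linarith
        rw [this]; nlinarith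
    · -- the two other solutions are conjugate
      have h2 : 2 * M.re = -(2 * t + m) := by
        have : M.im * (2 * M.re + (2 * t + m)) = 0 := by linear_combination him
        have := (mul_eq_zero.1 this).resolve_left hi
        linarith
      have h3 : M.re ^ 2 + M.im ^ 2 = (t + m) ^ 2 := by
        linear_combination (-1 : ℝ) * hre + M.re * h2
      rw [aLim]
      rcases le_total 0 (τ ^ 2 - t) with h | h
      · rw [max_eq_left h]
        have h4 : 0 < τ ^ 2 * (2 * (m + t) + m) - t * (m + t) := by
          rcases hm.eq_or_lt with h | h
          · have : t ≠ 0 := fun h' => hpos ⟨h.symm, h'⟩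
            have : 0 < m + t := lt_of_le_of_ne hmt (by rw [← h]; simpa using this.symm)
            nlinarith
          · nlinarith
        nlinarith
      · rw [max_eq_right h]
        nlinarith
  have e1 : ‖(m : ℂ) - aLim t τ‖ ^ 2 = (m - aLim t τ) ^ 2 := by
    rw [← Complex.ofReal_sub, Complex.norm_real, Real.norm_eq_abs, sq_abs]
  have e2 : ‖M - aLim t τ‖ ^ 2 = (M.re - aLim t τ) ^ 2 + M.im ^ 2 := by
    rw [← Complex.normSq_eq_norm_sq, Complex.normSq_apply]; simp; ring
  exact lt_of_pow_lt_pow_left₀ 2 (norm_nonneg _) (by rw [e1, e2]; exact hsq)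

theorem LimitData.eq_one (hτ : 0 < τ) {U : Ultrafilter ℝ} {o : Fin 4 → ℂ}
    (h : LimitData t τ Z U o) {m : ℝ} (hm : 0 ≤ m) (hmt : 0 ≤ m + t)
    (hmZ : m * (m + t) ^ 2 = τ ^ 2 * Z) :
    o 1 = m ∧ o 2 + o 3 = -(2 * t + m) ∧ o 2 * o 3 = (t + m) ^ 2 := by
  have hmZ' : (m : ℂ) * (m + t) ^ 2 = τ ^ 2 * Z := by exact_mod_cast hmZ
  have hfac : ∀ M : ℂ, (M - o 1) * (M - o 2) * (M - o 3) =
      (M - m) * (M ^ 2 + (2 * t + m) * M + (t + m) ^ 2) := fun M => by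
    linear_combination (-M ^ 2) * h.v0 + M * h.v1 - h.v2 + hmZ'
  have h1 : o 1 = m := by
    by_contra hne
    have hr := hfac (o 1)
    rw [sub_self, zero_mul, zero_mul, eq_comm] at hr
    have hlt := norm_sub_aLim_lt hτ hm hmt ((mul_eq_zero.1 hr).resolve_left (sub_ne_zero.2 hne)) hne
    have hr' := hfac m
    rw [sub_self, zero_mul] at hr'
    have hle := h.le12
    have hle' := h.le12.trans h.le23
    rcases mul_eq_zero.1 hr' with hr' | hr'
    · rcases mul_eq_zero.1 hr' with hr' | hr'
      · exact hne (sub_eq_zero.1 hr').symm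
      · rw [← sub_eq_zero.1 hr'] at hle; linarith
    · rw [← sub_eq_zero.1 hr'] at hle'; linarith
  have h2 : o 2 + o 3 = -(2 * t + m) := by linear_combination h.v0 - h1
  exact ⟨h1, h2, by linear_combination h.v1 - (o 2 + o 3) * h1 - m * h2⟩

/-- If the other two solutions are not distinct and real, they contribute equally. -/
theorem re_eq_of_quadratic {m : ℝ} {M M' : ℂ} (h1 : M + M' = -(2 * t + m))
    (h2 : M * M' = (t + m) ^ 2) (h : 0 ≤ m * (3 * m + 4 * t)) :
    (3 / 4 * M ^ 2 + 1 / 2 * t * M).re = (3 / 4 * M' ^ 2 + 1 / 2 * t * M').re := by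
  have hd : (M - M') ^ 2 = ((-(m * (3 * m + 4 * t)) : ℝ) : ℂ) := by
    push_cast; linear_combination (M + M' - (2 * t + m)) * h1 - 4 * h2
  have e1 := congrArg Complex.re h1
  have e2 := congrArg Complex.im h1
  have e3 := congrArg Complex.re hd
  have e4 := congrArg Complex.im hd
  rw [Complex.ofReal_re] at e3
  rw [Complex.ofReal_im] at e4
  simp [pow_two] at e1 e2 e3 e4
  have hre : M.re = M'.re := by
    by_contra hne
    have hne' : M.re - M'.re ≠ 0 := sub_ne_zero.2 hne
    have hi : M.im - M'.im = 0 := by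
      have : (M.re - M'.re) * (M.im - M'.im) = 0 := by linarith
      exact (mul_eq_zero.1 this).resolve_left hne'
    rw [hi] at e3
    have := mul_self_pos.2 hne'
    linarith
  simp [pow_two, hre]
  have : M.im = -M'.im := by linarith
  rw [this]; ring

theorem xStar_sq (hτ : 0 < τ) (ht : t < 0) : 0 ≤ xStar t τ ∧
    (τ * xStar t τ) ^ 2 = 4 * (-t) ^ 3 / 27 := by
  have h3 : ((-t) ^ (3 / 2 : ℝ)) ^ 2 = (-t) ^ 3 := by
    rw [← Real.rpow_natCast, ← Real.rpow_mul (by linarith)]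
    norm_num
  have hs : √3 ^ 2 = (3 : ℝ) := Real.sq_sqrt (by norm_num)
  have hs0 : 0 < √(3 : ℝ) := by positivity
  constructor
  · rw [xStar]; have := Real.rpow_nonneg (show 0 ≤ -t by linarith) (3 / 2); positivity
  · have : τ * xStar t τ = 2 * (-t) ^ (3 / 2 : ℝ) / (3 * √3) := by rw [xStar]; field_simp
    rw [this, div_pow, mul_pow, h3, mul_pow, hs]; ring

/-- The condition `|x| < x*` says that there are three distinct real solutions. -/
theorem abs_lt_xStar_iff (hτ : 0 < τ) (ht : t < 0) :
    |x| < xStar t τ ↔ 3 * ωReal t τ 1 x ^ 2 + 4 * t < 0 := by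
  obtain ⟨h0, h1⟩ := xStar_sq hτ ht
  obtain ⟨h2, -⟩ := ωReal_one_root t τ x
  have h3 := ωReal_one_sq_add t τ x
  set m := ωReal t τ 1 x ^ 2 with hm
  have h4 : m * (m + t) ^ 2 = (τ * x) ^ 2 := by rw [← h2, hm]; ring
  have h5 : |x| < xStar t τ ↔ (τ * x) ^ 2 < (τ * xStar t τ) ^ 2 := by
    rw [← mul_lt_mul_iff_right₀ hτ, ← sq_lt_sq₀ (by positivity) (by positivity), mul_pow, sq_abs,
      ← mul_pow]
  rw [h5, h1, ← h4]
  have h6 : m * (m + t) ^ 2 - 4 * (-t) ^ 3 / 27 = (3 * m + 4 * t) * (3 * m + t) ^ 2 / 27 := by ring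
  have h7 : 0 < (3 * m + t) ^ 2 := by
    have : 0 < 3 * m + t := by linarith
    positivity
  constructor
  · intro h
    by_contra! hle
    have := mul_nonneg hle h7.le
    linarith
  · intro h
    have := mul_neg_of_neg_of_pos h h7
    linarith

/-- Unless the cubic has three distinct real roots, the second and the third value in the limit are
equal or complex conjugate, and the difference of the real parts is zero. -/
theorem LimitData.re_sub_eq_V₃ (hτ : 0 < τ) {U : Ultrafilter ℝ} {o : Fin 4 → ℂ}
    (h : LimitData t τ (x ^ 2) U o) :
    (3 / 4 * o 2 ^ 2 + 1 / 2 * t * o 2).re - (3 / 4 * o 3 ^ 2 + 1 / 2 * t * o 3).re =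
      V₃ t τ x := by
  obtain ⟨h2, -⟩ := ωReal_one_root t τ x
  have h3 := ωReal_one_sq_add t τ x
  have hv := ωReal_vieta (t := t) (τ := τ) (x := x)
  set m := ωReal t τ 1 x ^ 2 with hm
  have hm0 : 0 ≤ m := sq_nonneg _
  obtain ⟨-, q1, q2⟩ := h.eq_one hτ hm0 h3 (by rw [← mul_pow τ x, ← h2, hm]; ring)
  rw [V₃]
  split_ifs with hc
  swap
  · rw [sub_eq_zero]
    refine re_eq_of_quadratic q1 q2 ?_
    rcases lt_or_ge t 0 with ht | ht
    · have : ¬ 3 * m + 4 * t < 0 := by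
        rw [hm, ← abs_lt_xStar_iff hτ ht]; exact fun h => hc ⟨ht, h⟩
      exact mul_nonneg hm0 (not_lt.1 this)
    · positivity
  obtain ⟨ht, hx⟩ := hc
  have hx' := (abs_lt_xStar_iff hτ ht).1 hx
  rw [← hm] at hx'
  obtain ⟨v0, v1, v2, hle⟩ := hv hx'.le
  set u := ωReal t τ 2 x
  set v := ωReal t τ 3 x
  set ω := ωReal t τ 1 x
  have hle' : v ^ 2 ≤ u ^ 2 := sq_le_sq.2 hle
  have huv : u * v = t + m := by rw [hm]; linear_combination v1 - ω * v0
  have s1 : u ^ 2 + v ^ 2 = -(2 * t + m) := by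
    rw [hm] at huv ⊢
    linear_combination (u + v - ω) * v0 - 2 * huv
  have s2 : u ^ 2 * v ^ 2 = (t + m) ^ 2 := by rw [← huv]; ring
  have s1' : (u : ℂ) ^ 2 + v ^ 2 = -(2 * t + m) := by exact_mod_cast s1
  have s2' : (u : ℂ) ^ 2 * v ^ 2 = (t + m) ^ 2 := by exact_mod_cast s2
  have key : ∀ a b : ℝ, (3 / 4 * ((a : ℂ) ^ 2) ^ 2 + 1 / 2 * t * (a : ℂ) ^ 2).re -
      (3 / 4 * ((b : ℂ) ^ 2) ^ 2 + 1 / 2 * t * (b : ℂ) ^ 2).re =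
      3 / 4 * a ^ 4 + 1 / 2 * t * a ^ 2 - 3 / 4 * b ^ 4 - 1 / 2 * t * b ^ 2 := by
    intro a b
    have e : ∀ a : ℝ, (3 / 4 * ((a : ℂ) ^ 2) ^ 2 + 1 / 2 * t * (a : ℂ) ^ 2) =
      ((3 / 4 * a ^ 4 + 1 / 2 * t * a ^ 2 : ℝ) : ℂ) := by intro a; push_cast; ring
    rw [e, e, Complex.ofReal_re, Complex.ofReal_re]; ring
  have hmul : (o 2 - u ^ 2) * (o 2 - v ^ 2) = 0 := by
    linear_combination o 2 * q1 - q2 - o 2 * s1' + s2'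
  rcases mul_eq_zero.1 hmul with e | e
  · have e2 : o 2 = u ^ 2 := sub_eq_zero.1 e
    have e3 : o 3 = v ^ 2 := by linear_combination q1 - s1' - e2
    rw [e2, e3, key]
  · have e2 : o 2 = v ^ 2 := sub_eq_zero.1 e
    have e3 : o 3 = u ^ 2 := by linear_combination q1 - s1' - e2
    -- the order of the distances forces `u² = v²`
    have hneg : u ^ 2 + t ≤ 0 := by nlinarith [sq_nonneg v]
    have hs : aLim t τ = τ ^ 2 - t := max_eq_left (by nlinarith [sq_nonneg τ])
    have hd := h.le23
    have nn : ∀ a : ℝ, a ^ 2 + t ≤ 0 → ‖(a : ℂ) ^ 2 - (τ ^ 2 - t : ℝ)‖ = τ ^ 2 - t - a ^ 2 := by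
      intro a ha
      rw [← Complex.ofReal_pow, ← Complex.ofReal_sub, Complex.norm_real, Real.norm_eq_abs,
        abs_of_nonpos (by nlinarith [sq_nonneg τ])]; ring
    rw [e2, e3, hs, nn _ hneg, nn _ (by linarith)] at hd
    have : u ^ 2 = v ^ 2 := le_antisymm (by linarith) hle'
    have e4 : u ^ 4 = v ^ 4 := by
      rw [show u ^ 4 = (u ^ 2) ^ 2 by ring, this]; ring
    rw [e2, e3, key, e4, this]

theorem tendsto_potGap_zero_one (hτ : 0 < τ) (x : ℝ) :
    Tendsto (potGap t τ 0 1 (x ^ 2)) (𝓝[>] 0) (𝓝 (-(V₁ t τ x +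
      (3 / 4 * aLim t τ ^ 2 + 1 / 2 * t * aLim t τ - 1 / 2 * τ ^ 2 * aLim t τ)))) := by
  rw [tendsto_iff_ultrafilter]
  intro U hU
  obtain ⟨o, h⟩ := exists_limitData (t := t) hτ (x ^ 2) U hU
  obtain ⟨h2, -⟩ := ωReal_one_root t τ x
  obtain ⟨e1, -⟩ := h.eq_one hτ (sq_nonneg (ωReal t τ 1 x)) (ωReal_one_sq_add t τ x)
    (by rw [← mul_pow τ x, ← h2]; ring)
  have hl := (h.tendsto_potential_zero hτ hU).sub (h.tendsto_potential hτ hU one_ne_zero)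
  refine (congrArg (fun y => Tendsto _ _ (𝓝 y)) ?_).mpr hl
  have : (3 / 4 * o 1 ^ 2 + 1 / 2 * t * o 1) =
      ((3 / 4 * ωReal t τ 1 x ^ 4 + 1 / 2 * t * ωReal t τ 1 x ^ 2 : ℝ) : ℂ) := by
    rw [e1]; push_cast; ring
  rw [this, Complex.ofReal_re, V₁]
  ring

theorem tendsto_potGap_two_three (hτ : 0 < τ) (x : ℝ) :
    Tendsto (potGap t τ 2 3 (x ^ 2)) (𝓝[>] 0) (𝓝 (-V₃ t τ x)) := by
  rw [tendsto_iff_ultrafilter]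
  intro U hU
  obtain ⟨o, h⟩ := exists_limitData (t := t) hτ (x ^ 2) U hU
  have hl := (h.tendsto_potential (j := 2) hτ hU (by decide)).sub
    (h.tendsto_potential (j := 3) hτ hU (by decide))
  refine (congrArg (fun y => Tendsto _ _ (𝓝 y)) ?_).mpr hl
  rw [← h.re_sub_eq_V₃ hτ]
  ring

/-- For `ξ < ξ_cr` the roots are those of the doubled symbol itself, otherwise their squares are;
the factor `2` cancels the weight `1/2` in the averaged field. -/
theorem logRatio_eq (hτ : 0 < τ) (hξ : 0 < ξ) (hi : (i' : ℕ) = i + 1) (x : ℝ) :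
    logRatio t τ (i + 1) x ξ = (if ξ < xiCr t τ then 2 else 1) * logGap t τ i i' (x ^ 2) ξ := by
  have hw : ∀ k : Fin 4, w t τ (k + 1) x ξ ≠ 0 ∧
      (if ξ < xiCr t τ then 1 else 2) * Real.log ‖w t τ (k + 1) x ξ‖ =
        Real.log ‖upperRoot t τ k (x ^ 2) ξ‖ := by
    intro k
    have hp := norm_upperRoot_pos (t := t) (i := k) (Z := x ^ 2) hτ hξ
    rw [norm_upperRoot] at hp ⊢
    push_cast at hp ⊢
    split_ifs with h
    · rw [w_eq_two_cut h hξ, one_mul]; exact ⟨norm_pos_iff.1 hp, rfl⟩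
    · have e := norm_w_sq_one_cut (not_lt.1 h) hξ (x : ℂ) k
      rw [← e] at hp ⊢
      refine ⟨fun h0 => ?_, ?_⟩
      · rw [h0] at hp; simp at hp
      · rw [Real.log_pow]; norm_num
  obtain ⟨n1, l1⟩ := hw i
  obtain ⟨n2, l2⟩ := hw i'
  rw [hi] at n2 l2
  rw [logRatio, logGap, ← l1, ← l2, norm_div,
    Real.log_div (norm_ne_zero_iff.2 n1) (norm_ne_zero_iff.2 n2)]
  split_ifs <;> ring

theorem averagedField_eq (hτ : 0 < τ) (hi : (i' : ℕ) = i + 1) (x : ℝ)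
    (hint : IntegrableOn (logGap t τ i i' (x ^ 2)) (Ioi 0)) :
    IntegrableOn (logRatio t τ (i + 1) x) (Ioi 0) ∧
      averagedField t τ (i + 1) x = ∫ ξ in Ioi 0, logGap t τ i i' (x ^ 2) ξ := by
  have h0 := xiCr_nonneg t τ
  have e1 : EqOn (fun ξ => 2 * logGap t τ i i' (x ^ 2) ξ) (logRatio t τ (i + 1) x)
      (Ioo 0 (xiCr t τ)) := fun ξ hξ => by
    rw [logRatio_eq hτ hξ.1 hi, if_pos hξ.2]
  have e2 : EqOn (logGap t τ i i' (x ^ 2)) (logRatio t τ (i + 1) x)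
      (Ioi (xiCr t τ)) := fun ξ hξ => by
    rw [logRatio_eq hτ (h0.trans_lt hξ) hi, if_neg (not_lt.2 (le_of_lt hξ)), one_mul]
  have i1 : IntegrableOn (logGap t τ i i' (x ^ 2)) (Ioc 0 (xiCr t τ)) :=
    hint.mono_set Ioc_subset_Ioi_self
  have i2 : IntegrableOn (logGap t τ i i' (x ^ 2)) (Ioi (xiCr t τ)) :=
    hint.mono_set (Ioi_subset_Ioi h0)
  constructor
  · rw [← Ioc_union_Ioi_eq_Ioi h0]
    refine IntegrableOn.union ?_ (i2.congr_fun e2 measurableSet_Ioi)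
    rw [integrableOn_Ioc_iff_integrableOn_Ioo]
    have := (i1.mono_set Ioo_subset_Ioc_self).const_mul 2
    exact IntegrableOn.congr_fun this e1 measurableSet_Ioo
  · rw [averagedField, ← setIntegral_congr_fun measurableSet_Ioo e1,
      ← setIntegral_congr_fun measurableSet_Ioi e2, ← Ioc_union_Ioi_eq_Ioi h0,
      setIntegral_union (Ioc_disjoint_Ioi le_rfl) measurableSet_Ioi i1 i2,
      integral_Ioc_eq_integral_Ioo, integral_const_mul]
    ring

theorem tildeV₁_eq (hτ : 0 < τ) (x : ℝ) : IntegrableOn (logRatio t τ 1 x) (Ioi 0) ∧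
    tildeV₁ t τ x = V₁ t τ x +
      (3 / 4 * aLim t τ ^ 2 + 1 / 2 * t * aLim t τ - 1 / 2 * τ ^ 2 * aLim t τ) := by
  obtain ⟨h1, h2⟩ := integral_logGap_Ioi hτ (sq_nonneg x) (Or.inl ⟨rfl, rfl⟩)
    (tendsto_potGap_zero_one (t := t) hτ x)
  obtain ⟨h3, h4⟩ := averagedField_eq (i := 0) (i' := 1) hτ rfl x h1
  exact ⟨h3, h4.trans (by rw [h2, neg_neg])⟩

theorem tildeV₃_eq (hτ : 0 < τ) (x : ℝ) : IntegrableOn (logRatio t τ 3 x) (Ioi 0) ∧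
    tildeV₃ t τ x = V₃ t τ x := by
  obtain ⟨h1, h2⟩ := integral_logGap_Ioi hτ (sq_nonneg x) (Or.inr ⟨rfl, rfl⟩)
    (tendsto_potGap_two_three (t := t) hτ x)
  obtain ⟨h3, h4⟩ := averagedField_eq (i := 2) (i' := 3) hτ rfl x h1
  exact ⟨h3, h4.trans (by rw [h2, neg_neg])⟩

end TwoMatrix

namespace TwoMatrix

/-! ### Branches of the inverse of the symbol -/

/-- The symbol `s(w) = w + d₀ + d₁ / w + d₂ / w² + d₃ / w³`. -/
noncomputable def symbol (d : Fin 4 → ℝ) (W : ℂ) : ℂ :=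
  W + d 0 + d 1 / W + d 2 / W ^ 2 + d 3 / W ^ 3

theorem quartic_symbolCoef_eq_zero_iff {d : Fin 4 → ℝ} {z W : ℂ} (hW : W ≠ 0) :
    quartic (symbolCoef d z) W = 0 ↔ symbol d W = z := by
  have : quartic (symbolCoef d z) W = W ^ 3 * (symbol d W - z) := by
    rw [quartic_symbolCoef, symbol]; field_simp; ring
  rw [this, mul_eq_zero, sub_eq_zero, or_iff_right (pow_ne_zero 3 hW)]

theorem hasDerivAt_symbol (d : Fin 4 → ℝ) {W : ℂ} (hW : W ≠ 0) :
    HasDerivAt (symbol d) (symbolEuler d W / W) W := by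
  have h1 := (((hasDerivAt_id W).add_const (d 0 : ℂ)).add
    ((hasDerivAt_const W (d 1 : ℂ)).div (hasDerivAt_id W) hW)).add
    ((hasDerivAt_const W (d 2 : ℂ)).div ((hasDerivAt_id W).pow 2) (pow_ne_zero 2 hW)) |>.add
    ((hasDerivAt_const W (d 3 : ℂ)).div ((hasDerivAt_id W).pow 3) (pow_ne_zero 3 hW))
  refine h1.congr_deriv ?_
  simp [symbolEuler]
  field_simp
  ring

/-- Through a simple solution of `s(w) = z₀` passes a holomorphic branch of solutions. -/
theorem exists_branch {d : Fin 4 → ℝ} {z0 w0 : ℂ} (hw : w0 ≠ 0)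
    (hr : quartic (symbolCoef d z0) w0 = 0) (hE : symbolEuler d w0 ≠ 0) :
    ∃ g : ℂ → ℂ, g z0 = w0 ∧ ∀ᶠ z in 𝓝 z0, g z ≠ 0 ∧ symbolEuler d (g z) ≠ 0 ∧
      quartic (symbolCoef d z) (g z) = 0 ∧ HasDerivAt g (g z / symbolEuler d (g z)) z := by
  have hs : symbol d w0 = z0 := (quartic_symbolCoef_eq_zero_iff hw).1 hr
  have han : AnalyticAt ℂ (symbol d) w0 := by
    unfold symbol
    have h2 := pow_ne_zero 2 hw
    have h3 := pow_ne_zero 3 hw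
    fun_prop (disch := assumption)
  have hd := (hasDerivAt_symbol d hw).deriv
  have hd0 : deriv (symbol d) w0 ≠ 0 := by rw [hd]; exact div_ne_zero hE hw
  have hg := han.analyticAt_localInverse hd0
  have hgr := HasStrictDerivAt.eventually_right_inverse (hf := han.hasStrictDerivAt) (hf' := hd0)
  have hg0 : HasStrictDerivAt.localInverse (symbol d) _ _ han.hasStrictDerivAt hd0 (symbol d w0)
      = w0 := HasStrictFDerivAt.localInverse_apply_image ..
  set g := HasStrictDerivAt.localInverse (symbol d) _ _ han.hasStrictDerivAt hd0
  rw [hs] at hg hgr hg0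
  have hEc : ContinuousAt (symbolEuler d) w0 := by
    unfold symbolEuler
    have h2 := pow_ne_zero 2 hw
    have h3 := pow_ne_zero 3 hw
    fun_prop (disch := assumption)
  have hE1 : ∀ᶠ z in 𝓝 z0, symbolEuler d (g z) ≠ 0 := by
    refine (ContinuousAt.comp (g := symbolEuler d) (f := g) ?_ hg.continuousAt).eventually_ne ?_
    · rwa [hg0]
    · rw [Function.comp, hg0]; exact hE
  have hW1 : ∀ᶠ z in 𝓝 z0, g z ≠ 0 := hg.continuousAt.eventually_ne (by rwa [hg0])
  refine ⟨g, hg0, ?_⟩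
  filter_upwards [hE1, hW1, hgr, eventually_eventually_nhds.2 hgr,
    hg.eventually_analyticAt] with z h1 h2 h3 h4 h5
  refine ⟨h2, h1, (quartic_symbolCoef_eq_zero_iff h2).2 h3, ?_⟩
  have h6 := h5.differentiableAt.hasDerivAt
  have h7 := (hasDerivAt_symbol d h2).comp z h6
  have h8 : HasDerivAt (symbol d ∘ g) 1 z :=
    (hasDerivAt_id z).congr_of_eventuallyEq (h4.mono fun y hy => hy)
  have h9 := h7.unique h8
  refine h6.congr_deriv ?_
  field_simp at h9 ⊢
  linear_combination h9

/-- Four roots of distinct moduli are the sorted roots. -/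
theorem IsSortedRoots.eq_of_strict {q σ g : Fin 4 → ℂ} (h : IsSortedRoots q σ)
    (hg : ∀ i, quartic q (g i) = 0) (h10 : ‖g 1‖ < ‖g 0‖) (h21 : ‖g 2‖ < ‖g 1‖)
    (h32 : ‖g 3‖ < ‖g 2‖) : g = σ := by
  have : ∀ i, ∃ k, g i = σ k := fun i => by
    rcases h.mem (hg i) with h | h | h | h
    exacts [⟨0, h⟩, ⟨1, h⟩, ⟨2, h⟩, ⟨3, h⟩]
  choose p hp using this
  have key : ∀ i j, ‖g j‖ < ‖g i‖ → p i < p j := fun i j hij => by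
    by_contra! hle
    have := h.norm_antitone hle
    rw [← hp, ← hp] at this
    linarith
  have k1 := key 0 1 h10
  have k2 := key 1 2 h21
  have k3 := key 2 3 h32
  funext i
  rw [hp]
  congr 1
  fin_cases i <;> simp <;> omega

/-- The limit of the logarithmic derivatives of the first two roots on the side of an arc of equal
moduli which the vector `n` points to. The second root continues the one of the two roots of equal
modulus whose modulus increases faster in the direction of `n`. -/
theorem tendsto_logDeriv_symbolRoot {d : Fin 4 → ℝ} {z0 n a A B c : ℂ}
    (hs : IsSortedRoots (symbolCoef d z0) ![a, A, B, c]) (h10 : ‖A‖ < ‖a‖) (hAB : ‖A‖ = ‖B‖)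
    (h32 : ‖c‖ < ‖B‖) (hc : c ≠ 0) (hn : 0 < (n * (1 / symbolEuler d A - 1 / symbolEuler d B)).re) :
    Tendsto (fun h : ℝ => logDeriv (symbolRoot d 1) (z0 + h * n)) (𝓝[>] 0)
      (𝓝 (1 / symbolEuler d a)) ∧
    Tendsto (fun h : ℝ => logDeriv (symbolRoot d 2) (z0 + h * n)) (𝓝[>] 0)
      (𝓝 (1 / symbolEuler d A)) := by
  have hABne : A ≠ B := by rintro rfl; simp at hn
  have hc0 := norm_pos_iff.2 hc
  have hA0 : A ≠ 0 := norm_pos_iff.1 (by linarith)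
  have hB0 : B ≠ 0 := norm_pos_iff.1 (by linarith)
  have ha0 : a ≠ 0 := norm_pos_iff.1 (by linarith)
  have nn : ∀ {u v : ℂ}, ‖u‖ < ‖v‖ → u ≠ v := fun h e => by rw [e] at h; exact lt_irrefl _ h
  have hEa : symbolEuler d a ≠ 0 := symbolEuler_ne_zero_of_unique hs (j := 0) ha0 (by
    intro i hi; fin_cases i
    · exact absurd rfl hi
    · exact nn h10
    · exact nn (show ‖B‖ < ‖a‖ by linarith)
    · exact nn (show ‖c‖ < ‖a‖ by linarith))
  have hEA : symbolEuler d A ≠ 0 := symbolEuler_ne_zero_of_unique hs (j := 1) hA0 (by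
    intro i hi; fin_cases i
    · exact (nn h10).symm
    · exact absurd rfl hi
    · exact hABne.symm
    · exact nn (show ‖c‖ < ‖A‖ by linarith))
  have hEB : symbolEuler d B ≠ 0 := symbolEuler_ne_zero_of_unique hs (j := 2) hB0 (by
    intro i hi; fin_cases i
    · exact (nn (show ‖B‖ < ‖a‖ by linarith)).symm
    · exact hABne
    · exact absurd rfl hi
    · exact nn (show ‖c‖ < ‖B‖ by linarith))
  have hEc : symbolEuler d c ≠ 0 := symbolEuler_ne_zero_of_unique hs (j := 3) hc (by
    intro i hi; fin_cases i
    · exact (nn (show ‖c‖ < ‖a‖ by linarith)).symm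
    · exact (nn (show ‖c‖ < ‖A‖ by linarith)).symm
    · exact (nn h32).symm
    · exact absurd rfl hi)
  obtain ⟨ga, ga0, hga⟩ := exists_branch ha0 (hs.root 0) hEa
  obtain ⟨gA, gA0, hgA⟩ := exists_branch hA0 (hs.root 1) hEA
  obtain ⟨gB, gB0, hgB⟩ := exists_branch hB0 (hs.root 2) hEB
  obtain ⟨gc, gc0, hgc⟩ := exists_branch hc (hs.root 3) hEc
  have ca := hga.self_of_nhds.2.2.2.continuousAt
  have cA := hgA.self_of_nhds.2.2.2.continuousAt
  have cB := hgB.self_of_nhds.2.2.2.continuousAt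
  have cc := hgc.self_of_nhds.2.2.2.continuousAt
  -- away from the set where `A` and `B` have branches of equal modulus the roots are sorted
  have hev : ∀ᶠ z in 𝓝 z0, ‖gB z‖ < ‖gA z‖ →
      ga z = symbolRoot d 1 z ∧ gA z = symbolRoot d 2 z := by
    have e1 : ∀ᶠ z in 𝓝 z0, ‖gA z‖ < ‖ga z‖ :=
      Tendsto.eventually_lt cA.norm ca.norm (by simp only [gA0, ga0]; exact h10)
    have e2 : ∀ᶠ z in 𝓝 z0, ‖gc z‖ < ‖gB z‖ :=
      Tendsto.eventually_lt cc.norm cB.norm (by simp only [gc0, gB0]; exact h32)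
    filter_upwards [e1, e2, hga, hgA, hgB, hgc] with z f1 f2 f3 f4 f5 f6 hlt
    have := (isSortedRoots_symbolRoots d z).eq_of_strict (g := ![ga z, gA z, gB z, gc z])
      (fun i => by fin_cases i <;> [exact f3.2.2.1; exact f4.2.2.1; exact f5.2.2.1;
        exact f6.2.2.1]) f1 hlt f2
    exact ⟨congrFun this 0, congrFun this 1⟩
  have hlog : ∀ᶠ z in 𝓝 z0, ‖gB z‖ < ‖gA z‖ →
      logDeriv (symbolRoot d 1) z = 1 / symbolEuler d (ga z) ∧
      logDeriv (symbolRoot d 2) z = 1 / symbolEuler d (gA z) := by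
    filter_upwards [hev, eventually_eventually_nhds.2 hev, hga, hgA, hgB] with z f1 f2 f3 f4 f5 hlt
    have hlt' : ∀ᶠ y in 𝓝 z, ‖gB y‖ < ‖gA y‖ :=
      Tendsto.eventually_lt f5.2.2.2.continuousAt.norm f4.2.2.2.continuousAt.norm hlt
    have l1 : ga =ᶠ[𝓝 z] symbolRoot d 1 := by filter_upwards [f2, hlt'] with y g1 g2 using (g1 g2).1
    have l2 : gA =ᶠ[𝓝 z] symbolRoot d 2 := by filter_upwards [f2, hlt'] with y g1 g2 using (g1 g2).2
    have n1 := f3.1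
    have n2 := f4.1
    constructor
    · rw [logDeriv_apply, ← l1.deriv_eq, ← (f1 hlt).1, f3.2.2.2.deriv]; field_simp
    · rw [logDeriv_apply, ← l2.deriv_eq, ← (f1 hlt).2, f4.2.2.2.deriv]; field_simp
  -- on the side of `n` the modulus of the branch through `A` is larger
  have hline : Tendsto (fun h : ℝ => z0 + h * n) (𝓝 0) (𝓝 z0) := by
    have : Continuous fun h : ℝ => z0 + h * n := by fun_prop
    simpa using this.tendsto 0
  have hlineR := hline.mono_left (nhdsWithin_le_nhds (s := Ioi 0))
  have hside : ∀ᶠ h : ℝ in 𝓝[>] 0, ‖gB (z0 + h * n)‖ < ‖gA (z0 + h * n)‖ := by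
    have hl : HasDerivAt (fun h : ℝ => z0 + h * n) n 0 := by
      simpa using ((Complex.ofRealCLM.hasDerivAt (x := (0 : ℝ))).mul_const n).const_add z0
    have hder : ∀ {g : ℂ → ℂ} {W : ℂ}, g z0 = W → (g z0 ≠ 0 ∧ symbolEuler d (g z0) ≠ 0 ∧
        quartic (symbolCoef d z0) (g z0) = 0 ∧ HasDerivAt g (g z0 / symbolEuler d (g z0)) z0) →
        HasDerivAt (fun h : ℝ => Real.log ‖g (z0 + h * n)‖) (n * (1 / symbolEuler d W)).re 0 := by
      intro g W h0 h1
      have h2 : HasDerivAt (fun h : ℝ => g (z0 + h * n)) (g z0 / symbolEuler d (g z0) * n) 0 :=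
        HasDerivAt.comp_of_eq (0 : ℝ) h1.2.2.2 hl (by simp)
      have h3 := hasDerivAt_log_norm h2 (by simpa using h1.1)
      refine h3.congr_deriv ?_
      have := h1.1
      have := h1.2.1
      subst h0
      congr 1
      simp
      field_simp
    have hφ := (hder gA0 hgA.self_of_nhds).sub (hder gB0 hgB.self_of_nhds)
    rw [← Complex.sub_re, ← mul_sub, hasDerivAt_iff_tendsto_slope] at hφ
    have hpos := hφ.eventually (lt_mem_nhds hn)
    have hne : ∀ᶠ h : ℝ in 𝓝[>] 0, gA (z0 + h * n) ≠ 0 ∧ gB (z0 + h * n) ≠ 0 := by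
      filter_upwards [hlineR.eventually hgA, hlineR.eventually hgB] with h h1 h2 using ⟨h1.1, h2.1⟩
    filter_upwards [nhdsWithin_mono 0 (fun h (hh : h ∈ Ioi (0 : ℝ)) => ne_of_gt hh) hpos,
      self_mem_nhdsWithin, hne] with h hh hh0 hne
    rw [slope_def_field] at hh
    simp only [Pi.sub_apply, Complex.ofReal_zero, zero_mul, add_zero, gA0, gB0, hAB, sub_self,
      sub_zero] at hh
    have := (div_pos_iff_of_pos_right hh0).1 hh
    exact (Real.log_lt_log_iff (norm_pos_iff.2 hne.2) (norm_pos_iff.2 hne.1)).1 (by linarith)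
  have hcont : ∀ {g : ℂ → ℂ} {W : ℂ}, g z0 = W → W ≠ 0 → symbolEuler d W ≠ 0 → ContinuousAt g z0 →
      Tendsto (fun h : ℝ => 1 / symbolEuler d (g (z0 + h * n))) (𝓝[>] 0)
        (𝓝 (1 / symbolEuler d W)) := by
    intro g W h0 hw hE hg
    subst h0
    have hEc : ContinuousAt (fun W => 1 / symbolEuler d W) (g z0) := by
      refine ContinuousAt.div continuousAt_const ?_ hE
      unfold symbolEuler
      have h2 := pow_ne_zero 2 hw
      have h3 := pow_ne_zero 3 hw
      fun_prop (disch := assumption)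
    exact (ContinuousAt.tendsto (f := fun z => 1 / symbolEuler d (g z))
      (ContinuousAt.comp (f := g) hEc hg)).comp hlineR
  constructor
  · refine (hcont ga0 ha0 hEa ca).congr' ?_
    filter_upwards [hlineR.eventually hlog, hside] with h h1 h2 using (h1 h2).1.symm
  · refine (hcont gA0 hA0 hEA cA).congr' ?_
    filter_upwards [hlineR.eventually hlog, hside] with h h1 h2 using (h1 h2).2.symm

theorem IsSortedRoots.swap {q : Fin 4 → ℂ} {a A B c : ℂ} (h : IsSortedRoots q ![a, A, B, c])
    (hAB : ‖A‖ = ‖B‖) : IsSortedRoots q ![a, B, A, c] := by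
  have h4 := h.le10
  have h5 := h.le32
  refine isSortedRoots_of_quartic_eq (fun W => ?_) ?_ ?_ ?_
  · rw [h.quartic_eq]
    change (W - a) * (W - A) * (W - B) * (W - c) = (W - a) * (W - B) * (W - A) * (W - c)
    ring
  all_goals simp at *; linarith

/-- The density at a point of the arc where the second and the third root have equal modulus. -/
theorem arcDensity_two_eq {d : Fin 4 → ℝ} {z0 T a A B c : ℂ}
    (hs : IsSortedRoots (symbolCoef d z0) ![a, A, B, c]) (h10 : ‖A‖ < ‖a‖) (hAB : ‖A‖ = ‖B‖)
    (h32 : ‖c‖ < ‖B‖) (hc : c ≠ 0)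
    (hn : 0 < (Complex.I * T * (1 / symbolEuler d A - 1 / symbolEuler d B)).re) :
    arcDensity d 2 T z0 =
      1 / (2 * Real.pi) * (Complex.I * T * (1 / symbolEuler d A - 1 / symbolEuler d B)) := by
  obtain ⟨p1, p2⟩ := tendsto_logDeriv_symbolRoot hs h10 hAB h32 hc hn
  obtain ⟨m1, m2⟩ := tendsto_logDeriv_symbolRoot (n := -(Complex.I * T)) (hs.swap hAB)
    (by rwa [← hAB]) hAB.symm (by rwa [hAB]) hc (by
      rw [show -(Complex.I * T) * (1 / symbolEuler d B - 1 / symbolEuler d A) =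
        Complex.I * T * (1 / symbolEuler d A - 1 / symbolEuler d B) by ring]; exact hn)
  simp only [mul_neg, ← sub_eq_add_neg] at m1 m2
  have hI : (Finset.Icc 1 2 : Finset ℕ) = {1, 2} := rfl
  rw [arcDensity, hI, Finset.sum_pair (by norm_num), p1.limUnder_eq, p2.limUnder_eq,
    m1.limUnder_eq, m2.limUnder_eq]
  have hpi : (Real.pi : ℂ) ≠ 0 := by exact_mod_cast Real.pi_ne_zero
  field_simp
  rw [Complex.I_sq]
  ring

end TwoMatrix

namespace TwoMatrix

/-! ### The density on the imaginary axis -/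

/-- The density of `μ₂^ξ` at `i η`, for the pairs in `densitySupport`. -/
noncomputable def imagDensity (t τ η ξ : ℝ) : ℝ :=
  |η| / Real.pi * (1 / symbolEuler (coef t τ ξ) (upperRoot t τ 1 (-η ^ 2) ξ)).im

/-- The pairs `(ξ, η)` for which the second and the third root at `Z = (i η)²` are not real. -/
def densitySupport (t τ : ℝ) : Set (ℝ × ℝ) :=
  {p | 0 < p.1 ∧ p.2 ≠ 0 ∧ 0 < (upperRoot t τ 1 (-p.2 ^ 2) p.1).im}

variable {t τ ξ η Z : ℝ} {i i' j : Fin 4}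

theorem eq_conj_of_upperRoot_im (hτ : 0 < τ) (hξ : 0 < ξ) (hZ : Z < 0)
    (hi : 0 < (upperRoot t τ 1 Z ξ).im) :
    symbolRoots (coef t τ ξ) Z 2 = (starRingEnd ℂ) (symbolRoots (coef t τ ξ) Z 1) := by
  obtain ⟨ζ, hζ⟩ := exists_negZeros (t := t) hτ hξ
  have hs := isSortedRoots_symbolRoots (coef t τ ξ) (Z : ℂ)
  have h10 := hζ.norm_one_lt_zero hZ hs
  have h32 := hζ.norm_three_lt_two hZ hs
  have h21 := hs.le21
  have hi' : (symbolRoots (coef t τ ξ) (Z : ℂ) 1).im ≠ 0 := abs_pos.1 hi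
  have hn := Complex.norm_conj (symbolRoots (coef t τ ξ) (Z : ℂ) 1)
  rcases hs.mem (quartic_symbolCoef_conj _ _ (hs.root 1)) with h | h | h | h
  · rw [h] at hn; linarith
  · exact absurd (Complex.conj_eq_iff_im.1 h) hi'
  · exact h.symm
  · rw [h] at hn; linarith

theorem norm_eq_of_upperRoot_im (hτ : 0 < τ) (hξ : 0 < ξ) (hZ : Z < 0)
    (hi : 0 < (upperRoot t τ 1 Z ξ).im) :
    ‖symbolRoots (coef t τ ξ) Z 1‖ = ‖symbolRoots (coef t τ ξ) Z 2‖ := by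
  rw [eq_conj_of_upperRoot_im hτ hξ hZ hi, Complex.norm_conj]

theorem inv_symbolEuler_im_pos (hτ : 0 < τ) (hξ : 0 < ξ) (hZ : Z < 0)
    (hi : 0 < (upperRoot t τ 1 Z ξ).im) :
    0 < (1 / symbolEuler (coef t τ ξ) (upperRoot t τ 1 Z ξ)).im := by
  obtain ⟨ζ, hζ⟩ := exists_negZeros (t := t) hτ hξ
  obtain ⟨k, hk, he⟩ := hζ.symbolEuler_im (upperRoot_root (j := 1)) hZ.ne
  have h0 := hζ.symbolEuler_ne_zero_of_im (upperRoot_root (j := 1)) hi.ne'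
  have hk' := hk hi.ne'
  rw [one_div, Complex.inv_im]
  refine div_pos ?_ (Complex.normSq_pos.2 h0)
  rw [he]
  have := mul_pos (mul_pos (neg_pos.2 hZ) hi) hk'
  linarith

theorem inv_sub_inv_conj (E : ℂ) :
    1 / E - 1 / (starRingEnd ℂ) E = 2 * Complex.I * ((1 / E).im : ℝ) := by
  have : 1 / (starRingEnd ℂ) E = (starRingEnd ℂ) (1 / E) := by simp
  rw [this, Complex.sub_conj]
  push_cast; ring

theorem imagAxis_sq (η : ℝ) : imagAxis η ^ 2 = ((-η ^ 2 : ℝ) : ℂ) := by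
  rw [imagAxis, mul_pow, Complex.I_sq]; push_cast; ring

theorem mul_symbolEuler_symbolOne {z u : ℂ} (hξ : 0 < ξ) (h : xiCr t τ ≤ ξ) (hu : u ≠ 0)
    (hr : quartic (symbolCoef (symbolOne t τ ξ) z) u = 0) :
    z * symbolEuler (symbolOne t τ ξ) u = symbolEuler (coef t τ ξ) (u ^ 2) := by
  rw [← (quartic_symbolCoef_eq_zero_iff hu).1 hr, coef_one_cut hξ h]
  simp only [symbol, symbolEuler, symbolOne]
  simp
  field_simp
  ring

theorem arcDensity_two_cut (hτ : 0 < τ) (hξ : 0 < ξ) (hZ : Z < 0)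
    (hi : 0 < (upperRoot t τ 1 Z ξ).im) : arcDensity (coef t τ ξ) 2 1 Z =
      (1 / Real.pi * (1 / symbolEuler (coef t τ ξ) (upperRoot t τ 1 Z ξ)).im : ℝ) := by
  obtain ⟨ζ, hζ⟩ := exists_negZeros (t := t) hτ hξ
  have hs := isSortedRoots_symbolRoots (coef t τ ξ) (Z : ℂ)
  have h10 := hζ.norm_one_lt_zero hZ hs
  have h32 := hζ.norm_three_lt_two hZ hs
  have h12 := norm_eq_of_upperRoot_im hτ hξ hZ hi
  have hcj := eq_conj_of_upperRoot_im hτ hξ hZ hi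
  have h3 := hζ.root_ne_zero (hs.root 3)
  have hpos := inv_symbolEuler_im_pos hτ hξ hZ hi
  set R := upperRoot t τ 1 Z ξ with hR
  set ρ := symbolRoots (coef t τ ξ) (Z : ℂ) with hρ
  have hs1 : IsSortedRoots (symbolCoef (coef t τ ξ) Z) ![ρ 0, ρ 1, ρ 2, ρ 3] := by
    convert hs using 1
    funext i; fin_cases i <;> rfl
  have hRn : ‖R‖ = ‖ρ 1‖ := norm_upperRoot
  have hs2 : IsSortedRoots (symbolCoef (coef t τ ξ) Z) ![ρ 0, (starRingEnd ℂ) R, R, ρ 3] := by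
    rcases upper_eq (ρ 1) with h | h
    · rw [hR, upperRoot, ← hρ, h, ← hcj]; exact hs1.swap h12
    · rw [hR, upperRoot, ← hρ, h, Complex.conj_conj, ← hcj]; exact hs1
  have e : Complex.I * 1 * (1 / symbolEuler (coef t τ ξ) ((starRingEnd ℂ) R) -
      1 / symbolEuler (coef t τ ξ) R) = (2 * (1 / symbolEuler (coef t τ ξ) R).im : ℝ) := by
    rw [symbolEuler_conj, ← neg_sub, inv_sub_inv_conj]
    push_cast
    linear_combination (-2 * ((1 / symbolEuler (coef t τ ξ) R).im : ℂ)) * Complex.I_sq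
  rw [arcDensity_two_eq hs2 (by rwa [Complex.norm_conj, hRn]) (Complex.norm_conj _)
    (by rwa [hRn, h12]) h3 (by rw [e, Complex.ofReal_re]; linarith), e]
  push_cast
  field_simp

/-- The symbol `s₁` is related to the common symbol by `s₁(w)² = s(w²)`, so its arcs carry the
density computed from `W = w²`. -/
theorem arcDensity_one_cut (hτ : 0 < τ) (hξ : 0 < ξ) (h : xiCr t τ ≤ ξ) (hη : η ≠ 0)
    (hi : 0 < (upperRoot t τ 1 (-η ^ 2) ξ).im) :
    arcDensity (symbolOne t τ ξ) 2 Complex.I (imagAxis η) = (imagDensity t τ η ξ : ℝ) := by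
  obtain ⟨ζ, hζ⟩ := exists_negZeros (t := t) hτ hξ
  have hZ : -η ^ 2 < 0 := by have := sq_pos_of_ne_zero hη; linarith
  have hs := isSortedRoots_symbolRoots (coef t τ ξ) ((-η ^ 2 : ℝ) : ℂ)
  have h12 := norm_eq_of_upperRoot_im hτ hξ hZ hi
  have hpos := inv_symbolEuler_im_pos hτ hξ hZ hi
  have hz0 : imagAxis η ≠ 0 := by simp [imagAxis, hη]
  have hw := isSortedRoots_symbolRoots (symbolOne t τ ξ) (imagAxis η)
  have hq := isSortedRoots_sq (t := t) (τ := τ) hξ h (imagAxis η)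
  rw [imagAxis_sq] at hq
  have q10 := hζ.norm_one_lt_zero hZ hq
  have q32 := hζ.norm_three_lt_two hZ hq
  have q12 : ‖symbolRoots (symbolOne t τ ξ) (imagAxis η) 1 ^ 2‖ =
      ‖symbolRoots (symbolOne t τ ξ) (imagAxis η) 2 ^ 2‖ := by
    rw [hq.norm_eq hs 1, hq.norm_eq hs 2]; exact h12
  have qcj := hζ.eq_conj_of_norm_eq hq (i := 1) (j := 2) (by decide) q12
  have qn : ∀ i, symbolRoots (symbolOne t τ ξ) (imagAxis η) i ≠ 0 := fun i h0 =>
    hζ.root_ne_zero (hq.root i) (by simp [h0])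
  have qR := hζ.eq_or_conj (upperRoot_root (t := t) (τ := τ) (j := 1)) (hq.root 1)
    (by rw [norm_upperRoot, hq.norm_eq hs 1])
  set u := symbolRoots (symbolOne t τ ξ) (imagAxis η) with hu
  simp only [norm_pow] at q10 q32 q12 qcj
  have q10' : ‖u 1‖ < ‖u 0‖ := lt_of_pow_lt_pow_left₀ 2 (norm_nonneg _) q10
  have q32' : ‖u 3‖ < ‖u 2‖ := lt_of_pow_lt_pow_left₀ 2 (norm_nonneg _) q32
  have q12' : ‖u 1‖ = ‖u 2‖ :=
    (pow_left_inj₀ (norm_nonneg _) (norm_nonneg _) two_ne_zero).1 q12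
  have hw1 : IsSortedRoots (symbolCoef (symbolOne t τ ξ) (imagAxis η)) ![u 0, u 1, u 2, u 3] := by
    convert hw using 1
    funext i; fin_cases i <;> rfl
  set R := upperRoot t τ 1 (-η ^ 2) ξ with hR
  -- the root whose square is `V` is larger in modulus on the left of the imaginary axis
  obtain ⟨V, hV, hVim⟩ : ∃ V : ℂ, (V = R ∨ V = (starRingEnd ℂ) R) ∧
      η * (1 / symbolEuler (coef t τ ξ) V).im = |η| * (1 / symbolEuler (coef t τ ξ) R).im := by
    rcases lt_or_gt_of_ne hη with h | h
    · refine ⟨_, Or.inr rfl, ?_⟩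
      have : 1 / symbolEuler (coef t τ ξ) ((starRingEnd ℂ) R) =
        (starRingEnd ℂ) (1 / symbolEuler (coef t τ ξ) R) := by rw [symbolEuler_conj]; simp
      rw [this, Complex.conj_im, abs_of_neg h]; ring
    · exact ⟨_, Or.inl rfl, by rw [abs_of_pos h]⟩
  have main : ∀ A B : ℂ, IsSortedRoots (symbolCoef (symbolOne t τ ξ) (imagAxis η))
      ![u 0, A, B, u 3] → A ^ 2 = V → B ^ 2 = (starRingEnd ℂ) V → ‖A‖ = ‖u 1‖ → ‖B‖ = ‖u 1‖ →
      arcDensity (symbolOne t τ ξ) 2 Complex.I (imagAxis η) = (imagDensity t τ η ξ : ℝ) := by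
    intro A B hAB hA hB nA nB
    have hinv : ∀ {C : ℂ}, C ≠ 0 → quartic (symbolCoef (symbolOne t τ ξ) (imagAxis η)) C = 0 →
        1 / symbolEuler (symbolOne t τ ξ) C =
          imagAxis η * (1 / symbolEuler (coef t τ ξ) (C ^ 2)) := fun hC hr => by
      rw [← mul_symbolEuler_symbolOne hξ h hC hr]; field_simp
    have u1 := norm_pos_iff.2 (qn 1)
    have e : Complex.I * Complex.I * (1 / symbolEuler (symbolOne t τ ξ) A -
        1 / symbolEuler (symbolOne t τ ξ) B) =
        (2 * (|η| * (1 / symbolEuler (coef t τ ξ) R).im) : ℝ) := by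
      rw [hinv (C := A) (norm_pos_iff.1 (by rwa [nA])) (hAB.root 1),
        hinv (C := B) (norm_pos_iff.1 (by rwa [nB])) (hAB.root 2), hA, hB, symbolEuler_conj, ← mul_sub,
        inv_sub_inv_conj, ← hVim, imagAxis]
      push_cast
      linear_combination (2 * η * ((1 / symbolEuler (coef t τ ξ) V).im : ℂ) *
        (Complex.I ^ 2 - 1)) * Complex.I_sq
    have hη' := abs_pos.2 hη
    rw [arcDensity_two_eq hAB (by rwa [nA]) (by rw [nA, nB]) (by rwa [nB, q12']) (qn 3)
      (by rw [e, Complex.ofReal_re]; positivity), e, imagDensity, ← hR]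
    push_cast
    field_simp
  have hcase : u 1 ^ 2 = V ∨ u 1 ^ 2 = (starRingEnd ℂ) V := by
    rcases hV with rfl | rfl <;> rcases qR with h | h
    · exact Or.inl h
    · exact Or.inr h
    · right; rw [Complex.conj_conj]; exact h
    · exact Or.inl h
  rcases hcase with hc | hc
  · exact main _ _ hw1 hc (by rw [qcj, hc]) rfl q12'.symm
  · exact main _ _ (hw1.swap q12') (by rw [qcj, hc, Complex.conj_conj]) hc q12'.symm rfl

theorem μ₂Density_eq (hτ : 0 < τ) (h : (ξ, η) ∈ densitySupport t τ) :
    μ₂Density t τ ξ η = (imagDensity t τ η ξ : ℝ) := by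
  obtain ⟨hξ, hη, hi⟩ := h
  simp only at hξ hη hi
  have hZ : -η ^ 2 < 0 := by have := sq_pos_of_ne_zero hη; linarith
  rw [μ₂Density]
  split_ifs with hc
  · rw [symbolTwo_eq_coef hξ hc, imagAxis_sq, arcDensity_two_cut hτ hξ hZ hi, imagDensity]
    have : ‖imagAxis η‖ = |η| := by simp [imagAxis]
    rw [this]; push_cast; ring
  · exact arcDensity_one_cut hτ hξ (not_lt.1 hc) hη hi

theorem imagDensity_pos (hτ : 0 < τ) (h : (ξ, η) ∈ densitySupport t τ) :
    0 < imagDensity t τ η ξ := by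
  obtain ⟨hξ, hη, hi⟩ := h
  simp only at hξ hη hi
  have := inv_symbolEuler_im_pos hτ hξ (by have := sq_pos_of_ne_zero hη; linarith) hi
  have := abs_pos.2 hη
  have := Real.pi_pos
  rw [imagDensity]
  positivity

theorem continuousAt_upperRoot_neg_sq (hτ : 0 < τ) (hξ : 0 < ξ) :
    ContinuousAt (fun p : ℝ × ℝ => upperRoot t τ j (-p.2 ^ 2) p.1) (ξ, η) :=
  ContinuousAt.comp (f := fun p : ℝ × ℝ => (-p.2 ^ 2, p.1)) (x := (ξ, η))
    (g := fun p : ℝ × ℝ => upperRoot t τ j p.1 p.2)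
    (continuousAt_upperRoot (p := (-η ^ 2, ξ)) hτ hξ j) (by fun_prop)

theorem isOpen_densitySupport (hτ : 0 < τ) : IsOpen (densitySupport t τ) := by
  rw [isOpen_iff_mem_nhds]
  rintro ⟨ξ, η⟩ ⟨hξ, hη, hi⟩
  simp only at hξ hη hi
  have hR : ContinuousAt (fun p : ℝ × ℝ => (upperRoot t τ 1 (-p.2 ^ 2) p.1).im) (ξ, η) :=
    Complex.continuous_im.continuousAt.comp (continuousAt_upperRoot_neg_sq hτ hξ)
  filter_upwards [continuousAt_fst.eventually (lt_mem_nhds hξ),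
    continuousAt_snd.eventually_ne hη, hR.eventually (lt_mem_nhds hi)] with p h1 h2 h3
  exact ⟨h1, h2, h3⟩

theorem continuousAt_imagDensity (hτ : 0 < τ) (h : (ξ, η) ∈ densitySupport t τ) :
    ContinuousAt (fun p : ℝ × ℝ => imagDensity t τ p.2 p.1) (ξ, η) := by
  obtain ⟨hξ, hη, hi⟩ := h
  simp only at hξ hη hi
  obtain ⟨ζ, hζ⟩ := exists_negZeros (t := t) hτ hξ
  have hR : ContinuousAt (fun p : ℝ × ℝ => upperRoot t τ 1 (-p.2 ^ 2) p.1) (ξ, η) :=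
    continuousAt_upperRoot_neg_sq hτ hξ
  have h1 := upperRoot_ne_zero (t := t) (j := 1) (Z := -η ^ 2) hτ hξ
  have h0 := hζ.symbolEuler_ne_zero_of_im (upperRoot_root (j := 1)) hi.ne'
  have hc : ∀ k, ContinuousAt (fun p : ℝ × ℝ => (coef t τ p.1 k : ℂ)) (ξ, η) := fun k =>
    (Complex.continuous_ofReal.comp (((continuous_apply k).comp (continuous_coef t τ)).comp
      continuous_fst)).continuousAt
  have hE : ContinuousAt (fun p : ℝ × ℝ =>
      symbolEuler (coef t τ p.1) (upperRoot t τ 1 (-p.2 ^ 2) p.1)) (ξ, η) := by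
    unfold symbolEuler
    exact ((hR.sub ((hc 1).div hR h1)).sub ((continuousAt_const.mul (hc 2)).div (hR.pow 2)
      (pow_ne_zero 2 h1))).sub ((continuousAt_const.mul (hc 3)).div (hR.pow 3) (pow_ne_zero 3 h1))
  exact ContinuousAt.mul (by fun_prop)
    (Complex.continuous_im.continuousAt.comp (continuousAt_const.div hE h0))

/-- The density of `μ₂^ξ` as a function of both variables. -/
noncomputable def averageDensity (t τ : ℝ) : ℝ × ℝ → ENNReal :=
  (densitySupport t τ).indicator fun p => ENNReal.ofReal (imagDensity t τ p.2 p.1)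

theorem measurable_averageDensity (hτ : 0 < τ) : Measurable (averageDensity t τ) := by
  have hm := (isOpen_densitySupport (t := t) hτ).measurableSet
  classical
  have e : averageDensity t τ = (densitySupport t τ).piecewise
      (fun p => ENNReal.ofReal (imagDensity t τ p.2 p.1)) (fun _ => 0) := by
    funext p; simp [averageDensity, Set.indicator, Set.piecewise]
  rw [e]
  refine ContinuousOn.measurable_piecewise (fun p hp => ?_) continuousOn_const hm
  exact (ENNReal.continuous_ofReal.continuousAt.comp
    (continuousAt_imagDensity hτ hp)).continuousWithinAt

/-- For fixed `ξ`, there are finitely many points at which the symbol has a double solution. -/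
theorem finite_double_points (d : Fin 4 → ℝ) :
    {η : ℝ | ∃ W : ℂ, W ≠ 0 ∧ symbolEuler d W = 0 ∧ symbol d W = ((-η ^ 2 : ℝ) : ℂ)}.Finite := by
  set p : ℂ[X] := X ^ 4 - C (d 1 : ℂ) * X ^ 2 - C (2 * d 2 : ℂ) * X - C (3 * d 3 : ℂ) with hp
  have hp0 : p ≠ 0 := Monic.ne_zero (by rw [hp]; monicity!)
  have hfin : ∀ c : ℝ, {η : ℝ | η ^ 2 = c}.Finite := fun c => by
    refine (Set.toFinite {√c, -√c}).subset fun η hη => ?_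
    have hη' : η ^ 2 = c := hη
    rw [← hη', Real.sqrt_sq_eq_abs]
    rcases abs_cases η with h | h
    · left; exact h.1.symm
    · right; show η = -|η|; rw [h.1, neg_neg]
  refine ((p.roots.toFinset.finite_toSet).biUnion fun W _ => hfin (-(symbol d W).re)).subset ?_
  rintro η ⟨W, hW, hE, hs⟩
  simp only [mem_iUnion]
  refine ⟨W, ?_, ?_⟩
  · simp only [Finset.mem_coe, Multiset.mem_toFinset, mem_roots hp0, IsRoot]
    have : p.eval W = W ^ 3 * symbolEuler d W := by
      simp [hp, symbolEuler]; field_simp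
    rw [this, hE, mul_zero]
  · show η ^ 2 = _
    rw [hs, Complex.ofReal_re]; ring

/-- On `Γ₂` the second and the third root are a pair of non-real conjugates, except at the origin and
where they form a double root, which happens for finitely many points. -/
theorem Gamma_two_ae_eq (hτ : 0 < τ) (hξ : 0 < ξ) :
    {y : ℝ | imagAxis y ∈ Γ t τ 2 ξ} =ᵐ[volume] {y : ℝ | (ξ, y) ∈ densitySupport t τ} := by
  obtain ⟨ζ, hζ⟩ := exists_negZeros (t := t) hτ hξ
  have hfin := (finite_double_points (coef t τ ξ)).union (Set.finite_singleton (0 : ℝ))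
  have hae := (Set.Finite.countable hfin).ae_notMem (volume : Measure ℝ)
  filter_upwards [hae] with η hη
  simp only [mem_union, mem_singleton_iff, not_or] at hη
  obtain ⟨h1, h2⟩ := hη
  refine propext ?_
  have hZ : -η ^ 2 < 0 := by have := sq_pos_of_ne_zero h2; linarith
  have hs := isSortedRoots_symbolRoots (coef t τ ξ) ((-η ^ 2 : ℝ) : ℂ)
  change imagAxis η ∈ Γ t τ 2 ξ ↔ (0 < ξ ∧ η ≠ 0 ∧ 0 < (upperRoot t τ 1 (-η ^ 2) ξ).im)
  rw [mem_Gamma_two_iff hξ, imagAxis_sq]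
  constructor
  · intro hn
    refine ⟨hξ, h2, lt_of_le_of_ne upperRoot_im_nonneg fun hi => ?_⟩
    have hi' : (symbolRoots (coef t τ ξ) ((-η ^ 2 : ℝ) : ℂ) 1).im = 0 := abs_eq_zero.1 hi.symm
    have hcj := hζ.eq_conj_of_norm_eq hs (i := 1) (j := 2) (by decide) hn
    rw [Complex.conj_eq_iff_im.2 hi'] at hcj
    have h0 := hζ.root_ne_zero (hs.root 2)
    exact h1 ⟨_, h0, symbolEuler_eq_zero_of_eq hs (i := 1) (by decide) h0 hcj.symm,
      (quartic_symbolCoef_eq_zero_iff h0).1 (hs.root 2)⟩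
  · rintro ⟨-, -, hi⟩
    exact norm_eq_of_upperRoot_im hτ hξ hZ hi

theorem μ₂_eq (hτ : 0 < τ) (hξ : 0 < ξ) : μ₂ t τ ξ =
    ((volume : Measure ℝ).withDensity (fun y => averageDensity t τ (ξ, y))).map imagAxis := by
  have hm : MeasurableSet {y : ℝ | (ξ, y) ∈ densitySupport t τ} :=
    ((isOpen_densitySupport hτ).preimage (by fun_prop : Continuous fun y : ℝ => (ξ, y))).measurableSet
  rw [μ₂, Measure.restrict_congr_set (Gamma_two_ae_eq hτ hξ), ← withDensity_indicator hm]
  congr 2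
  funext y
  by_cases hy : (ξ, y) ∈ densitySupport t τ
  · rw [indicator_of_mem (show y ∈ {y : ℝ | (ξ, y) ∈ densitySupport t τ} from hy), averageDensity,
      indicator_of_mem hy, μ₂Density_eq hτ hy, Complex.ofReal_re]
  · rw [indicator_of_notMem (show y ∉ {y : ℝ | (ξ, y) ∈ densitySupport t τ} from hy),
      averageDensity, indicator_of_notMem hy]

end TwoMatrix

namespace TwoMatrix

/-! ### Integration of the density with respect to the parameter -/

theorem hasDerivAt_of_eventually_ne {f g : ℝ → ℝ} {x : ℝ}
    (hd : ∀ᶠ y in 𝓝 x, y ≠ x → HasDerivAt f (g y) y) (hf : ContinuousAt f x)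
    (hg : ContinuousAt g x) : HasDerivAt f (g x) x := by
  obtain ⟨δ, hδ, hb⟩ := Metric.eventually_nhds_iff_ball.1 hd
  rw [Real.ball_eq_Ioo] at hb
  have h1 : ∀ y ∈ Ioo x (x + δ), HasDerivAt f (g y) y := fun y hy =>
    hb y ⟨by linarith [hy.1], hy.2⟩ hy.1.ne'
  have h2 : ∀ y ∈ Ioo (x - δ) x, HasDerivAt f (g y) y := fun y hy =>
    hb y ⟨hy.1, by linarith [hy.2]⟩ hy.2.ne
  have m1 : Ioo x (x + δ) ∈ 𝓝[>] x := Ioo_mem_nhdsGT (by linarith)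
  have m2 : Ioo (x - δ) x ∈ 𝓝[<] x := Ioo_mem_nhdsLT (by linarith)
  have a1 := hasDerivWithinAt_Ici_of_tendsto_deriv
    (fun y hy => (h1 y hy).differentiableAt.differentiableWithinAt) hf.continuousWithinAt m1
    ((hg.mono_left nhdsWithin_le_nhds).congr' (by
      filter_upwards [m1] with y hy using (h1 y hy).deriv.symm))
  have a2 := hasDerivWithinAt_Iic_of_tendsto_deriv
    (fun y hy => (h2 y hy).differentiableAt.differentiableWithinAt) hf.continuousWithinAt m2
    ((hg.mono_left nhdsWithin_le_nhds).congr' (by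
      filter_upwards [m2] with y hy using (h2 y hy).deriv.symm))
  simpa using a2.union a1

/-- Let `H` vanish outside of a bounded open set `V` of positive numbers and have a negative
derivative `-D` in `V`. Then `V` is an interval with left endpoint `0`, since `H` cannot vanish at
both endpoints of a component of `V`; hence the integral of `D` over `V` is the limit of `H`
at `0`. -/
theorem lintegral_indicator_of_hasDerivAt {V : Set ℝ} {D H : ℝ → ℝ} {H0 B : ℝ} (hV : IsOpen V)
    (hpos : V ⊆ Ioi 0) (hB : ∀ x, B ≤ x → x ∉ V) (hcont : ContinuousOn H (Ioi 0))
    (hzero : ∀ x, 0 < x → x ∉ V → H x = 0) (hder : ∀ x ∈ V, HasDerivAt H (-D x) x)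
    (hD : ∀ x ∈ V, 0 < D x) (hlim : Tendsto (fun x => |H x|) (𝓝[>] 0) (𝓝 H0)) :
    ∫⁻ x in Ioi 0, V.indicator (fun x => ENNReal.ofReal (D x)) x = ENNReal.ofReal H0 := by
  rw [lintegral_indicator hV.measurableSet, Measure.restrict_restrict hV.measurableSet,
    inter_eq_left.2 hpos]
  have hanti : ∀ a b, 0 < a → Ioo a b ⊆ V → StrictAntiOn H (Icc a b) := fun a b ha hab =>
    strictAntiOn_of_deriv_neg (convex_Icc a b) (hcont.mono fun x hx => ha.trans_le hx.1)
      fun x hx => by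
        rw [interior_Icc] at hx
        rw [(hder x (hab hx)).deriv, neg_lt_zero]
        exact hD x (hab hx)
  -- the right endpoint of the component of a point of `V`
  have hright : ∀ x ∈ V, ∃ b, x < b ∧ b ∉ V ∧ Ico x b ⊆ V := by
    intro x hx
    have hK : IsCompact (Vᶜ ∩ Icc x (max x B)) := isCompact_Icc.inter_left hV.isClosed_compl
    have hne : (Vᶜ ∩ Icc x (max x B)).Nonempty :=
      ⟨max x B, hB _ (le_max_right _ _), le_max_left _ _, le_rfl⟩
    have hmem := hK.sInf_mem hne
    refine ⟨_, lt_of_le_of_ne hmem.2.1 fun h => hmem.1 (by rwa [← h]), hmem.1, fun y hy => ?_⟩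
    by_contra hyV
    exact not_le.2 hy.2 (csInf_le hK.bddBelow ⟨hyV, hy.1, hy.2.le.trans hmem.2.2⟩)
  have hdown : ∀ x ∈ V, ∀ y, 0 < y → y < x → y ∈ V := by
    intro x hx y hy hyx
    by_contra hyV
    have hK : IsCompact (Vᶜ ∩ Icc y x) := isCompact_Icc.inter_left hV.isClosed_compl
    have hmem := hK.sSup_mem ⟨y, hyV, le_rfl, hyx.le⟩
    set a := sSup (Vᶜ ∩ Icc y x)
    have ha : 0 < a := hy.trans_le hmem.2.1
    have hax : a < x := lt_of_le_of_ne hmem.2.2 fun h => hmem.1 (by rwa [h])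
    obtain ⟨b, hxb, hbV, hsub⟩ := hright x hx
    have hab : Ioo a b ⊆ V := fun z hz => by
      rcases le_or_gt x z with h | h
      · exact hsub ⟨h, hz.2⟩
      · by_contra hzV
        exact not_le.2 hz.1 (le_csSup hK.bddAbove ⟨hzV, (hmem.2.1.trans hz.1.le), h.le⟩)
    have := hanti a b ha hab (left_mem_Icc.2 (hax.trans hxb).le)
      (right_mem_Icc.2 (hax.trans hxb).le) (hax.trans hxb)
    rw [hzero a ha hmem.1, hzero b (ha.trans (hax.trans hxb)) hbV] at this
    exact lt_irrefl _ this
  rcases V.eq_empty_or_nonempty with rfl | ⟨x0, hx0⟩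
  · have : Tendsto (fun x => |H x|) (𝓝[>] 0) (𝓝 0) := by
      refine tendsto_const_nhds.congr' ?_
      filter_upwards [self_mem_nhdsWithin] with x hx
      rw [hzero x hx (by simp), abs_zero]
    rw [tendsto_nhds_unique hlim this]; simp
  obtain ⟨b, hxb, hbV, hsub⟩ := hright x0 hx0
  have hb : 0 < b := lt_trans (hpos hx0) hxb
  have hVb : V = Ioo 0 b := by
    ext x
    constructor
    · intro hx
      refine ⟨hpos hx, ?_⟩
      by_contra! hle
      rcases hle.eq_or_lt with h | h
      · exact hbV (by rwa [h])
      · exact hbV (hdown x hx b hb h)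
    · intro hx
      rcases le_or_gt x0 x with h | h
      · exact hsub ⟨h, hx.2⟩
      · exact hdown x0 hx0 x hx.1 h
  have hHpos : ∀ x ∈ Ioo 0 b, 0 < H x := fun x hx => by
    rw [← hzero b hb hbV]
    exact hanti x b hx.1 (by rw [hVb]; exact Ioo_subset_Ioo_left hx.1.le)
      (left_mem_Icc.2 hx.2.le) (right_mem_Icc.2 hx.2.le) hx.2
  have hlim' : Tendsto H (𝓝[>] 0) (𝓝 H0) := by
    refine hlim.congr' ?_
    filter_upwards [Ioo_mem_nhdsGT hb] with x hx using abs_of_pos (hHpos x hx)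
  set g := Function.update H 0 H0 with hg
  have hgne : ∀ x, x ≠ 0 → g x = H x := fun x hx => Function.update_of_ne hx _ _
  have hgev : ∀ x, 0 < x → g =ᶠ[𝓝 x] H := fun x hx => by
    filter_upwards [Ioi_mem_nhds hx] with z hz using hgne z (ne_of_gt hz)
  have hgc : ContinuousOn g (Icc 0 b) := by
    intro x hx
    rcases hx.1.eq_or_lt with rfl | h
    · refine ContinuousWithinAt.mono ?_ Icc_subset_Ici_self
      rw [← continuousWithinAt_Ioi_iff_Ici, ContinuousWithinAt, hg, Function.update_self, ← hg]
      refine hlim'.congr' ?_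
      filter_upwards [self_mem_nhdsWithin] with z hz using (hgne z (ne_of_gt hz)).symm
    · exact (((hcont.continuousAt (Ioi_mem_nhds h)).congr (hgev x h).symm)).continuousWithinAt
  have hgd : ∀ x ∈ Ioo 0 b, HasDerivAt (-g) (D x) x := fun x hx => by
    have := ((hder x (by rwa [hVb])).congr_of_eventuallyEq (hgev x hx.1)).neg
    rwa [neg_neg] at this
  have hint := intervalIntegral.integrableOn_deriv_of_nonneg hgc.neg hgd
    (fun x hx => (hD x (by rwa [hVb])).le)
  have hval := intervalIntegral.integral_eq_sub_of_hasDerivAt_of_le hb.le hgc.neg hgd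
    ((intervalIntegrable_iff_integrableOn_Ioc_of_le hb.le).2 hint)
  rw [Pi.neg_apply, Pi.neg_apply, hgne b hb.ne', hzero b hb hbV, hg, Function.update_self, intervalIntegral.integral_of_le hb.le,
    integral_Ioc_eq_integral_Ioo] at hval
  rw [hVb, ← ofReal_integral_eq_lintegral_ofReal (hint.mono_set Ioo_subset_Ioc_self)
    ((ae_restrict_iff' measurableSet_Ioo).2 (Eventually.of_forall fun x hx =>
      (hD x (by rwa [hVb])).le)), hval]
  simp

variable {t τ ξ η Z : ℝ} {i i' j : Fin 4}

theorem abs_eq_one_of_sq_eq_one {s : ℝ} (hs : s ^ 2 = 1) : |s| = 1 := by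
  rw [← sq_eq_sq₀ (abs_nonneg s) zero_le_one, sq_abs, hs, one_pow]

/-- For large `ξ` all solutions of `s₁(w) = i η` are imaginary. -/
theorem eventually_upperRoot_im_eq_zero (hτ : 0 < τ) (η : ℝ) :
    ∀ᶠ ξ in atTop, (upperRoot t τ j (-η ^ 2) ξ).im = 0 := by
  set c0 := |η| + |τ ^ 2 - t| + 1 with hc0
  have hη := abs_nonneg η
  have ht := abs_nonneg (τ ^ 2 - t)
  filter_upwards [eventually_gt_atTop 0, eventually_ge_atTop (xiCr t τ),
    eventually_gt_atTop (3 * c0 ^ 2 + |τ ^ 2 - t| * c0)] with ξ hξ hcr hlt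
  have ha := aOne_pos t τ hξ
  have e := aOne_eq t τ hξ.le
  have hb := bOne_eq t τ hξ.le
  have hb0 : 0 < bOne t τ ξ := by rw [hb]; positivity
  have hc : 0 < cOne t τ ξ := by rw [cOne]; positivity
  have hac : c0 < aOne t τ ξ := by
    by_contra! hle
    have h1 : aOne t τ ξ ^ 2 ≤ c0 ^ 2 := pow_le_pow_left₀ ha.le hle 2
    have h2 : -(τ ^ 2 - t) * aOne t τ ξ ≤ |τ ^ 2 - t| * c0 :=
      mul_le_mul (neg_le_abs _) hle ha.le ht
    linarith
  set a := aOne t τ ξ with haa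
  set b := bOne t τ ξ with hbb
  set c := cOne t τ ξ with hcc
  set f : ℝ → ℝ := fun v => v ^ 4 - η * v ^ 3 - b * v ^ 2 + c with hf
  have hfc : Continuous f := by fun_prop
  have f0 : 0 < f 0 := by simp only [hf]; simpa using hc
  have fa : ∀ s : ℝ, s ^ 2 = 1 → f (s * a) < 0 := by
    intro s hs
    have hs3 : s ^ 3 = s := by rw [pow_succ, hs, one_mul]
    have hs4 : s ^ 4 = 1 := by rw [show s ^ 4 = (s ^ 2) ^ 2 by ring, hs, one_pow]
    have : f (s * a) = a ^ 3 * (-(2 * a) - s * η - t + τ ^ 2) := by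
      simp only [hf, mul_pow, hs, hs3, hs4]
      rw [hbb, hcc, bOne, cOne, ← haa]; ring
    rw [this]
    refine mul_neg_of_pos_of_neg (by positivity) ?_
    have : |s * η| = |η| := by
      rw [abs_mul, abs_eq_one_of_sq_eq_one hs, one_mul]
    linarith [neg_abs_le (s * η), le_abs_self (τ ^ 2 - t)]
  set K := |η| + b + 1 + a with hK
  have fK : ∀ s : ℝ, s ^ 2 = 1 → 0 < f (s * K) := by
    intro s hs
    have hs3 : s ^ 3 = s := by rw [pow_succ, hs, one_mul]
    have hs4 : s ^ 4 = 1 := by rw [show s ^ 4 = (s ^ 2) ^ 2 by ring, hs, one_pow]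
    have : f (s * K) = K ^ 2 * (K * (K - s * η) - b) + c := by
      simp only [hf, mul_pow, hs, hs3, hs4]; ring
    rw [this]
    have : |s * η| = |η| := by
      rw [abs_mul, abs_eq_one_of_sq_eq_one hs, one_mul]
    have h1 : b + 1 ≤ K - s * η := by linarith [le_abs_self (s * η)]
    have h2 : 1 ≤ K := by linarith
    have h3 : 0 ≤ K * (K - s * η) - b := by nlinarith
    positivity
  have fa1 := fa 1 (by norm_num)
  have fa2 := fa (-1) (by norm_num)
  have fK1 := fK 1 (by norm_num)
  have fK2 := fK (-1) (by norm_num)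
  simp only [one_mul, neg_mul] at fa1 fa2 fK1 fK2
  obtain ⟨v0, hv0, z0⟩ := intermediate_value_Ioo' (by linarith : -K ≤ -a) hfc.continuousOn ⟨fa2, fK2⟩
  obtain ⟨v1, hv1, z1⟩ := intermediate_value_Ioo (by linarith : -a ≤ 0) hfc.continuousOn ⟨fa2, f0⟩
  obtain ⟨v2, hv2, z2⟩ := intermediate_value_Ioo' (by linarith : 0 ≤ a) hfc.continuousOn ⟨fa1, f0⟩
  obtain ⟨v3, hv3, z3⟩ := intermediate_value_Ioo (by linarith : a ≤ K) hfc.continuousOn ⟨fa1, fK1⟩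
  have hs := isSortedRoots_symbolRoots (symbolOne t τ ξ) (imagAxis η)
  have hroot : ∀ v : ℝ, f v = 0 →
      quartic (symbolCoef (symbolOne t τ ξ) (imagAxis η)) (Complex.I * v) = 0 := by
    intro v hv
    have hv' : (v : ℂ) ^ 4 - η * v ^ 3 - b * v ^ 2 + c = 0 := by exact_mod_cast hv
    rw [quartic_symbolCoef]
    simp [symbolOne, imagAxis]
    linear_combination hv' + ((Complex.I ^ 2 - 1) * (v ^ 4 - η * v ^ 3) + b * v ^ 2) * Complex.I_sq
  set v : Fin 4 → ℝ := ![v0, v1, v2, v3] with hv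
  have hvinj : Function.Injective v := by
    have : StrictMono v := by
      refine Fin.strictMono_iff_lt_succ.2 fun i => ?_
      fin_cases i
      · exact hv0.2.trans hv1.1
      · exact hv1.2.trans hv2.1
      · exact hv2.2.trans hv3.1
    exact this.injective
  have hex : ∀ i, ∃ k, Complex.I * v i = symbolRoots (symbolOne t τ ξ) (imagAxis η) k := by
    intro i
    have hz : f (v i) = 0 := by fin_cases i <;> assumption
    rcases hs.mem (hroot _ hz) with h | h | h | h
    exacts [⟨0, h⟩, ⟨1, h⟩, ⟨2, h⟩, ⟨3, h⟩]
  choose p hp using hex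
  have hpinj : Function.Injective p := by
    intro i i' h
    have h1 := hp i
    rw [h, ← hp i'] at h1
    exact hvinj (Complex.ofReal_injective (mul_left_cancel₀ Complex.I_ne_zero h1))
  have hpsurj : Function.Surjective p := Finite.injective_iff_surjective.1 hpinj
  have hq := isSortedRoots_sq (t := t) (τ := τ) hξ hcr (imagAxis η)
  rw [imagAxis_sq] at hq
  have hsq : ∀ k, (symbolRoots (symbolOne t τ ξ) (imagAxis η) k ^ 2).im = 0 := by
    intro k
    obtain ⟨i, rfl⟩ := hpsurj k
    rw [← hp, mul_pow, Complex.I_sq, ← Complex.ofReal_pow]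
    simp [-Complex.ofReal_pow]
  rcases hq.mem (upperRoot_root (t := t) (τ := τ) (ξ := ξ) (j := j)) with h | h | h | h <;>
    rw [h] <;> exact hsq _

/-- Minus the imaginary part of the product of the spectral coordinates, normalized to be a
primitive of `-imagDensity`. -/
noncomputable def densityPrimitive (t τ η ξ : ℝ) : ℝ :=
  -(coordProd t τ (upperRoot t τ 1 (-η ^ 2) ξ) ξ).im / (Real.pi * |η|)

theorem continuousAt_densityPrimitive (hτ : 0 < τ) (hξ : 0 < ξ) :
    ContinuousAt (densityPrimitive t τ η) ξ := by
  have h1 : ContinuousAt (fun ξ => coordProd t τ (upperRoot t τ 1 (-η ^ 2) ξ) ξ) ξ :=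
    ContinuousAt.comp (f := fun ξ => (-η ^ 2, ξ)) (x := ξ)
      (g := fun p : ℝ × ℝ => coordProd t τ (upperRoot t τ 1 p.1 p.2) p.2)
      (continuousAt_coordProd (p := (-η ^ 2, ξ)) hτ hξ 1) (by fun_prop)
  exact (Complex.continuous_im.continuousAt.comp h1).neg.div_const _

theorem hasDerivAt_densityPrimitive_of_ne (hτ : 0 < τ) (h : (ξ, η) ∈ densitySupport t τ)
    (hne : ξ ≠ xiCr t τ) :
    HasDerivAt (densityPrimitive t τ η) (-imagDensity t τ η ξ) ξ := by
  obtain ⟨hξ, hη, hi⟩ := h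
  simp only at hξ hη hi
  obtain ⟨ζ, hζ⟩ := exists_negZeros (t := t) hτ hξ
  have h0 := hζ.symbolEuler_ne_zero_of_im (upperRoot_root (j := 1)) hi.ne'
  obtain ⟨k, hk⟩ := exists_hasDerivAt_coordProd hτ hξ hne h0
  have h1 := (Complex.imCLM.hasFDerivAt.comp_hasDerivAt ξ hk).neg.div_const (Real.pi * |η|)
  refine h1.congr_deriv ?_
  have hη' := abs_pos.2 hη
  have hpi := Real.pi_pos
  simp only [Complex.imCLM_apply, Complex.sub_im, Complex.ofReal_im, Complex.im_ofReal_mul,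
    imagDensity]
  rw [← sq_abs η]
  field_simp
  ring

theorem hasDerivAt_densityPrimitive (hτ : 0 < τ) (h : (ξ, η) ∈ densitySupport t τ) :
    HasDerivAt (densityPrimitive t τ η) (-imagDensity t τ η ξ) ξ := by
  refine hasDerivAt_of_eventually_ne (g := fun ξ => -imagDensity t τ η ξ) ?_
    (continuousAt_densityPrimitive hτ h.1) ?_
  · have hc : Tendsto (fun ξ : ℝ => (ξ, η)) (𝓝 ξ) (𝓝 (ξ, η)) :=
      Continuous.tendsto (by fun_prop) _
    have h1 := hc.eventually ((isOpen_densitySupport (t := t) hτ).mem_nhds h)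
    by_cases hcr : ξ = xiCr t τ
    · filter_upwards [h1] with y hy hne
      exact hasDerivAt_densityPrimitive_of_ne hτ hy (by rwa [← hcr])
    · filter_upwards [h1, eventually_ne_nhds hcr] with y hy hne _
      exact hasDerivAt_densityPrimitive_of_ne hτ hy hne
  · exact (ContinuousAt.comp (f := fun ξ : ℝ => (ξ, η)) (x := ξ)
      (g := fun p : ℝ × ℝ => imagDensity t τ p.2 p.1)
      (continuousAt_imagDensity hτ h) (by fun_prop)).neg

theorem coordProd_im_eq_zero {W : ℂ} (hW : W.im = 0) : (coordProd t τ W ξ).im = 0 := by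
  obtain ⟨x, rfl⟩ : ∃ x : ℝ, W = x := ⟨W.re, Complex.ext (by simp) (by simpa using hW)⟩
  rw [coordProd]
  norm_cast

/-! ### The cubic equation on the imaginary axis -/

theorem imag_cubic {ω : ℂ} {y : ℝ} (h : ω ^ 3 + t * ω = τ * imagAxis y) (hω : 0 < ω.re) :
    3 * ω.im ^ 2 = ω.re ^ 2 + t ∧ 2 * ω.im * (4 * ω.im ^ 2 - t) = τ * y := by
  have h1 := congrArg Complex.re h
  have h2 := congrArg Complex.im h
  simp [imagAxis, pow_succ] at h1 h2
  have h3 : 3 * ω.im ^ 2 = ω.re ^ 2 + t := by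
    have : ω.re * (3 * ω.im ^ 2 - (ω.re ^ 2 + t)) = 0 := by linear_combination -h1
    have := (mul_eq_zero.1 this).resolve_left hω.ne'
    linarith
  exact ⟨h3, by linear_combination h2 + 3 * ω.im * h3⟩

theorem ωImag_eq_zero (hτ : 0 < τ) {y : ℝ} (hy : |y| < yStar t τ) :
    ωImag t τ (imagAxis y) = 0 := by
  rw [ωImag, dif_neg]
  rintro ⟨ω, h, hω⟩
  obtain ⟨h1, h2⟩ := imag_cubic h hω
  rw [yStar] at hy
  split_ifs at hy with ht
  · exact absurd hy (not_lt.2 (abs_nonneg y))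
  rcases (not_lt.1 ht).eq_or_lt with ht0 | ht0
  · rw [← ht0, Real.zero_rpow (by norm_num)] at hy
    simp at hy
    exact absurd hy (not_lt.2 (abs_nonneg y))
  obtain ⟨-, hx⟩ := xStar_sq hτ (neg_lt_zero.2 ht0)
  have e : xStar (-t) τ = 2 * t ^ (3 / 2 : ℝ) / (3 * √3 * τ) := by rw [xStar, neg_neg]
  rw [e, neg_neg] at hx
  have h3 : (τ * y) ^ 2 < 4 * t ^ 3 / 27 := by
    rw [← hx, mul_pow, mul_pow, ← sq_abs y]
    have := pow_lt_pow_left₀ hy (abs_nonneg y) two_ne_zero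
    exact mul_lt_mul_of_pos_left this (by positivity)
  rw [← h2] at h3
  have h4 : t / 3 < ω.im ^ 2 := by have := pow_pos hω 2; linarith
  have h5 : t / 3 < 4 * ω.im ^ 2 - t := by linarith
  have h6 : (t / 3) ^ 2 < (4 * ω.im ^ 2 - t) ^ 2 := pow_lt_pow_left₀ h5 (by positivity) two_ne_zero
  have h7 : t / 3 * (t / 3) ^ 2 < ω.im ^ 2 * (4 * ω.im ^ 2 - t) ^ 2 :=
    mul_lt_mul'' h4 h6 (by positivity) (by positivity)
  linarith [show (2 * ω.im * (4 * ω.im ^ 2 - t)) ^ 2 =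
    4 * (ω.im ^ 2 * (4 * ω.im ^ 2 - t) ^ 2) by ring,
    show t / 3 * (t / 3) ^ 2 = t ^ 3 / 27 by ring]

theorem symbolRoots_three_im (hτ : 0 < τ) (hξ : 0 < ξ) (hZ : Z < 0) :
    (symbolRoots (coef t τ ξ) Z 3).im = 0 := by
  obtain ⟨ζ, hζ⟩ := exists_negZeros (t := t) hτ hξ
  have hs := isSortedRoots_symbolRoots (coef t τ ξ) (Z : ℂ)
  have h32 := hζ.norm_three_lt_two hZ hs
  have hn := Complex.norm_conj (symbolRoots (coef t τ ξ) (Z : ℂ) 3)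
  have h21 := hs.le21
  have h10 := hs.le10
  rcases hs.mem (quartic_symbolCoef_conj _ _ (hs.root 3)) with h | h | h | h
  · rw [h] at hn; linarith
  · rw [h] at hn; linarith
  · rw [h] at hn; linarith
  · exact Complex.conj_eq_iff_im.1 h

theorem LimitData.im_three (hτ : 0 < τ) (hZ : Z < 0) {U : Ultrafilter ℝ}
    (hU : (U : Filter ℝ) ≤ 𝓝[>] 0) {o : Fin 4 → ℂ} (h : LimitData t τ Z U o) : (o 3).im = 0 := by
  have h1 := (Complex.continuous_im.tendsto _).comp (h.inv 3 (by decide))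
  have h2 : Tendsto (fun ξ => (scaledInv t τ 3 Z ξ).im) U (𝓝 0) := by
    refine tendsto_const_nhds.congr' ?_
    filter_upwards [hU self_mem_nhdsWithin] with ξ hξ
    rw [scaledInv, Complex.div_im, symbolRoots_three_im hτ hξ hZ, Complex.ofReal_im, zero_mul,
      mul_zero, zero_div, sub_zero]
  have h3 := tendsto_nhds_unique h1 h2
  simpa using h3

/-- A solution `M` of `M (M + t)² = (τ i η)²` is the square of `ω = τ i η / (M + t)`. -/
theorem LimitData.abs_im_eq (hτ : 0 < τ) (hη : η ≠ 0) {U : Ultrafilter ℝ}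
    (hU : (U : Filter ℝ) ≤ 𝓝[>] 0) {o : Fin 4 → ℂ} (h : LimitData t τ (-η ^ 2) U o) :
    |(o 1 ^ 2 + t * o 1).im| = τ * |η| * (ωImag t τ (imagAxis η)).re := by
  have hZ : -η ^ 2 < 0 := by have := sq_pos_of_ne_zero hη; linarith
  have h3 := h.im_three hτ hZ hU
  have hτc : (τ : ℂ) ≠ 0 := by exact_mod_cast hτ.ne'
  have hz0 : imagAxis η ≠ 0 := by simp [imagAxis, hη]
  have hfac : ∀ M : ℂ, (M - o 1) * (M - o 2) * (M - o 3) =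
      M * (M + t) ^ 2 - (τ * imagAxis η) ^ 2 := fun M => by
    rw [mul_pow, imagAxis_sq]
    linear_combination (-M ^ 2) * h.v0 + M * h.v1 - h.v2
  -- no solution `ω` in the right half plane has a real square
  have hreal : ∀ ω : ℂ, ω ^ 3 + t * ω = τ * imagAxis η → 0 < ω.re → (ω ^ 2).im ≠ 0 := by
    intro ω hω hre him
    have him' : ω.im = 0 := by
      have : ω.re * ω.im = 0 := by
        rw [pow_two, Complex.mul_im] at him; linarith
      exact (mul_eq_zero.1 this).resolve_left hre.ne'
    obtain ⟨-, h2⟩ := imag_cubic hω hre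
    rw [him'] at h2
    have : τ * η = 0 := by linarith
    exact (mul_ne_zero hτ.ne' hη) this
  have i0 := congrArg Complex.im h.v0
  have i1 := congrArg Complex.im h.v1
  rw [← Complex.ofReal_pow, Complex.ofReal_im] at i1
  simp [h3] at i0 i1
  have hi2 : (o 2).im = -(o 1).im := by linarith
  rw [hi2] at i1
  by_cases hi : (o 1).im = 0
  · have hno : ¬ ∃ ω : ℂ, ω ^ 3 + t * ω = τ * imagAxis η ∧ 0 < ω.re := by
      rintro ⟨ω, hω, hre⟩
      have hr := hreal ω hω hre
      have hM := hfac (ω ^ 2)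
      rw [← hω] at hM
      have : (ω ^ 2 - o 1) * (ω ^ 2 - o 2) * (ω ^ 2 - o 3) = 0 := by rw [hM]; ring
      rcases mul_eq_zero.1 this with h4 | h4
      · rcases mul_eq_zero.1 h4 with h5 | h5
        · rw [sub_eq_zero.1 h5] at hr; exact hr hi
        · rw [sub_eq_zero.1 h5] at hr; exact hr (by rw [hi2, hi, neg_zero])
      · rw [sub_eq_zero.1 h4] at hr; exact hr h3
    rw [ωImag, dif_neg hno]
    simp [pow_two, hi]
  · have hre2 : (o 2).re = (o 1).re := by
      have : (o 1).im * ((o 2).re - (o 1).re) = 0 := by linarith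
      have := (mul_eq_zero.1 this).resolve_left hi
      linarith
    have ho2 : o 2 = (starRingEnd ℂ) (o 1) := Complex.ext (by simpa using hre2) (by simpa using hi2)
    have hM : o 1 * (o 1 + t) ^ 2 = (τ * imagAxis η) ^ 2 := by
      have := hfac (o 1)
      rw [sub_self, zero_mul, zero_mul] at this
      linear_combination -this
    have ht0 : o 1 + t ≠ 0 := by
      intro h0
      rw [h0] at hM
      have : (τ * imagAxis η) ^ 2 = 0 := by rw [← hM]; ring
      exact pow_ne_zero 2 (mul_ne_zero hτc hz0) this
    have hex : ∃ ω : ℂ, ω ^ 3 + t * ω = τ * imagAxis η ∧ 0 < ω.re := by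
      set ω := τ * imagAxis η / (o 1 + t) with hω
      have hω2 : ω ^ 2 = o 1 := by rw [hω, div_pow, ← hM]; field_simp
      have hω3 : ω ^ 3 + t * ω = τ * imagAxis η := by
        have : ω ^ 3 + t * ω = ω * (o 1 + t) := by rw [← hω2]; ring
        rw [this, hω]; field_simp
      have hne : ω.re ≠ 0 := by
        intro h0
        apply hi
        rw [← hω2, pow_two, Complex.mul_im, h0]; ring
      rcases lt_or_gt_of_ne hne with h | h
      · refine ⟨-(starRingEnd ℂ) ω, ?_, by simpa using h⟩
        have hcj : (starRingEnd ℂ) (imagAxis η) = -imagAxis η := by simp [imagAxis]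
        have := congrArg (starRingEnd ℂ) hω3
        simp only [map_add, map_mul, map_pow, Complex.conj_ofReal, hcj] at this
        linear_combination -this
      · exact ⟨ω, hω3, h⟩
    rw [ωImag, dif_pos hex]
    obtain ⟨hω, hre⟩ := hex.choose_spec
    set ω := hex.choose
    have hMω := hfac (ω ^ 2)
    rw [← hω] at hMω
    have h0 : (ω ^ 2 - o 1) * (ω ^ 2 - o 2) * (ω ^ 2 - o 3) = 0 := by rw [hMω]; ring
    have hval : ((ω ^ 2) ^ 2 + t * ω ^ 2).im = τ * η * ω.re := by
      have : (ω ^ 2) ^ 2 + t * ω ^ 2 = ω * (τ * imagAxis η) := by rw [← hω]; ring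
      rw [this, imagAxis]; simp; ring
    have hfin : |((ω ^ 2) ^ 2 + t * ω ^ 2).im| = τ * |η| * ω.re := by
      rw [hval, abs_mul, abs_mul, abs_of_pos hτ, abs_of_pos hre]
    rcases mul_eq_zero.1 h0 with h4 | h4
    · rcases mul_eq_zero.1 h4 with h5 | h5
      · rw [← sub_eq_zero.1 h5, hfin]
      · have e : o 1 = (starRingEnd ℂ) (ω ^ 2) := by
          rw [sub_eq_zero.1 h5, ho2, Complex.conj_conj]
        have e2 : o 1 ^ 2 + t * o 1 = (starRingEnd ℂ) ((ω ^ 2) ^ 2 + t * ω ^ 2) := by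
          rw [e]; simp
        rw [e2, Complex.conj_im, abs_neg, hfin]
    · have := hreal ω hω hre
      rw [sub_eq_zero.1 h4] at this
      exact absurd h3 this

/-- The limit `ξ → 0` of the primitive is the density of `σ`. -/
theorem tendsto_densityPrimitive (hτ : 0 < τ) (hη : η ≠ 0) :
    Tendsto (fun ξ => |densityPrimitive t τ η ξ|) (𝓝[>] 0)
      (𝓝 (τ / Real.pi * (ωImag t τ (imagAxis η)).re)) := by
  rw [tendsto_iff_ultrafilter]
  intro U hU
  obtain ⟨o, h⟩ := exists_limitData (t := t) hτ (-η ^ 2) U hU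
  have hl := (h.tendsto_coordProd_im (j := 1) hU (by decide)).div_const (Real.pi * |η|)
  rw [h.abs_im_eq hτ hη hU] at hl
  have hη' := abs_pos.2 hη
  have hpi := Real.pi_pos
  have e : τ * |η| * (ωImag t τ (imagAxis η)).re / (Real.pi * |η|) =
      τ / Real.pi * (ωImag t τ (imagAxis η)).re := by field_simp
  rw [e] at hl
  refine hl.congr fun ξ => ?_
  rw [densityPrimitive, abs_div, abs_neg, abs_of_pos (mul_pos hpi hη')]

/-- The average of the densities of `μ₂^ξ` is the density of `σ`. -/
theorem lintegral_averageDensity (hτ : 0 < τ) (hη : η ≠ 0) :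
    ∫⁻ ξ in Ioi 0, averageDensity t τ (ξ, η) =
      ENNReal.ofReal (τ / Real.pi * (ωImag t τ (imagAxis η)).re) := by
  obtain ⟨B, hB⟩ := eventually_atTop.1 (eventually_upperRoot_im_eq_zero (t := t) (j := 1) hτ η)
  have hV : IsOpen {ξ : ℝ | (ξ, η) ∈ densitySupport t τ} :=
    (isOpen_densitySupport hτ).preimage (by fun_prop : Continuous fun ξ : ℝ => (ξ, η))
  refine lintegral_indicator_of_hasDerivAt (V := {ξ : ℝ | (ξ, η) ∈ densitySupport t τ})
    (D := imagDensity t τ η) (H := densityPrimitive t τ η) (B := B) hV (fun x hx => hx.1)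
    (fun x hx h => h.2.2.ne' (hB x hx))
    (fun x hx => (continuousAt_densityPrimitive hτ hx).continuousWithinAt) (fun x hx hn => ?_)
    (fun x hx => hasDerivAt_densityPrimitive hτ hx) (fun x hx => imagDensity_pos hτ hx)
    (tendsto_densityPrimitive hτ hη)
  have : (upperRoot t τ 1 (-η ^ 2) x).im = 0 :=
    le_antisymm (not_lt.1 fun h => hn ⟨hx, hη, h⟩) upperRoot_im_nonneg
  rw [densityPrimitive, coordProd_im_eq_zero this, neg_zero, zero_div]

/-! ### Identification of the averaged constraint -/

theorem measurable_imagAxis : Measurable imagAxis := by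
  unfold imagAxis; fun_prop

theorem aemeasurable_μ₂ (hτ : 0 < τ) :
    AEMeasurable (μ₂ t τ) (volume.restrict (Ioi (0 : ℝ))) := by
  refine ⟨fun ξ => ((volume : Measure ℝ).withDensity
    (fun y => averageDensity t τ (ξ, y))).map imagAxis, ?_, ?_⟩
  · refine Measure.measurable_of_measurable_coe _ fun s hs => ?_
    have hm := measurable_imagAxis hs
    simp only [Measure.map_apply measurable_imagAxis hs, withDensity_apply _ hm]
    exact Measurable.lintegral_prod_right' (measurable_averageDensity hτ)
  · exact (ae_restrict_iff' measurableSet_Ioi).2 (Eventually.of_forall fun ξ hξ => μ₂_eq hτ hξ)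

theorem σ_eq (hτ : 0 < τ) : σ t τ = ((volume : Measure ℝ).withDensity (fun y =>
    ENNReal.ofReal (τ / Real.pi * (ωImag t τ (imagAxis y)).re))).map imagAxis := by
  have hm : MeasurableSet {y : ℝ | yStar t τ ≤ |y|} :=
    (isClosed_le continuous_const continuous_abs).measurableSet
  rw [σ, ← withDensity_indicator hm]
  congr 2
  funext y
  by_cases hy : yStar t τ ≤ |y|
  · exact indicator_of_mem (s := {y : ℝ | yStar t τ ≤ |y|}) hy _
  · rw [indicator_of_notMem (s := {y : ℝ | yStar t τ ≤ |y|}) hy, ωImag_eq_zero hτ (not_le.1 hy)]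
    simp

theorem tildeσ_eq (hτ : 0 < τ) : tildeσ t τ = σ t τ := by
  ext s hs
  have hm := measurable_imagAxis hs
  rw [tildeσ, Measure.bind_apply hs (aemeasurable_μ₂ hτ), σ_eq hτ,
    Measure.map_apply measurable_imagAxis hs, withDensity_apply _ hm]
  have e : ∀ ξ ∈ Ioi (0 : ℝ), μ₂ t τ ξ s = ∫⁻ y in imagAxis ⁻¹' s, averageDensity t τ (ξ, y) :=
    fun ξ hξ => by
      rw [μ₂_eq hτ hξ, Measure.map_apply measurable_imagAxis hs, withDensity_apply _ hm]
  rw [setLIntegral_congr_fun measurableSet_Ioi e,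
    lintegral_lintegral_swap (f := fun ξ y => averageDensity t τ (ξ, y))
      (measurable_averageDensity hτ).aemeasurable]
  refine lintegral_congr_ae (ae_restrict_of_ae ?_)
  filter_upwards [(Set.countable_singleton (0 : ℝ)).ae_notMem volume] with y hy
  exact lintegral_averageDensity hτ hy

end TwoMatrix

theorem mainTheorem7 (t τ : ℝ) (hτ : 0 < τ) :
    -- the averaged objects are well defined
    (∀ ξ : ℝ, 0 < ξ → ξ ≠ TwoMatrix.xiCr t τ →
      ∀ z ∈ TwoMatrix.Γ t τ 2 ξ, z.re = 0) ∧
    (∀ x : ℝ,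
      IntegrableOn (TwoMatrix.logRatio t τ 1 x) (Ioi 0) volume ∧
      IntegrableOn (TwoMatrix.logRatio t τ 3 x) (Ioi 0) volume) ∧
    AEMeasurable (TwoMatrix.μ₂ t τ) (volume.restrict (Ioi (0 : ℝ))) ∧
    -- they coincide with the explicit ones
    (∃ C : ℝ, ∀ x : ℝ, TwoMatrix.tildeV₁ t τ x = TwoMatrix.V₁ t τ x + C) ∧
    (∀ x : ℝ, TwoMatrix.tildeV₃ t τ x = TwoMatrix.V₃ t τ x) ∧
    TwoMatrix.tildeσ t τ = TwoMatrix.σ t τ :=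
  ⟨fun _ hξ _ _ hz => TwoMatrix.Gamma_two_subset hτ hξ hz,
    fun x => ⟨(TwoMatrix.tildeV₁_eq hτ x).1, (TwoMatrix.tildeV₃_eq hτ x).1⟩,
    TwoMatrix.aemeasurable_μ₂ hτ,
    ⟨_, fun x => (TwoMatrix.tildeV₁_eq hτ x).2⟩,
    fun x => (TwoMatrix.tildeV₃_eq hτ x).2,
    TwoMatrix.tildeσ_eq hτ⟩
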